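/- Let $\tau\colon[0,\infty)\to\mathbb R$ be nondecreasing and convex, differentiable on $(0,\infty)$ with concave derivative $\tau'$, normalized so that $\tau(0)=0$ and $\tau'(x)>0$ for all $x>0$; put $\tau'(0):=\lim_{x\searrow0}\tau'(x)$. For $x>0$ let $\tau''(x)$ denote the right derivative of $\tau'$ at $x$, and use the convention $\tau''(0):=\infty$, i.e. $\tau''(0)^{-1}=0$. Assume $\limsup_{x\to\infty}\tau'(x)=\infty$. Let $(\tau')^{-1}(z):=\sup\{x>0:\tau'(x)\le z\}$ with $\sup\emptyset:=0$, and set $g(x):=\tau''(7x)^{-1}$ and $h(x):=g\big((\tau')^{-1}(12x)\big)$ for $x\ge 0$. Let $(Q,d)$ be a nonempty Hadamard space, that is, a complete metric space such that for all $y_0,y_1\in Q$ there is $c\in Q$ with $d(q,c)^2\le\frac12d(y_0,q)^2+\frac12d(y_1,q)^2-\frac14d(y_0,y_1)^2$ for all $q\in Q$; equip $Q$ with its Borel $\sigma$-algebra. Let $Y$ be a $Q$-valued random variable on a probability space which almost surely takes values in a separable subset of $Q$ (this is automatic if $Q$ is separable), and assume $\mathbb E[\tau'(d(Y,o))]<\infty$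 for some $o\in Q$. Let $n\ge1$ and let $Y_1,\dots,Y_n$ be independent copies of $Y$. Let $$m\in\operatorname*{arg\,min}_{q\in Q}\mathbb E\big[\tau(d(Y,q))-\tau(d(Y,o))\big],\qquad m_n\in\operatorname*{arg\,min}_{q\in Q}\sum_{j=1}^n\tau(d(Y_j,q))$$ be a $\tau$-Fréchet mean of $Y$ and a (measurable) sample $\tau$-Fréchet mean. Let $\chi$ be a median of $d(Y,m)$. For measurable $f\ge 0$ write $\sigma_f:=\mathbb E[f(d(Y,m))]\in[0,\infty]$, and let $\hat\sigma_{\tau'}:=\frac1n\sum_{j=1}^n\tau'(d(Y_j,m))$. For $p>0$ set $$S_p:=\max\Big(\sigma_{g^p},\;2\,h(\sigma_{\tau'})^p,\;\mathbb E\big[h(2\hat\sigma_{\tau'})^p\big]\Big),$$ $$V_{n,p}:=\frac1n\,\mathbb E\big[\tau'(d(Y,m))^{2p}\,g(d(Y,m))^p\big]+\mathbb E\big[\tau'(d(Y,m))^{2p}\,h\big(2n^{-1}\tau'(d(Y,m))\big)^p\big].$$ Let $p,q>1$ with $\frac1p+\frac1q=1$, and set $r_0:=\max\big(\chi,\,2(\tau')^{-1}(16\,\sigma_{\tau'})\big)$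 and $$b_n:=\Big(V_{n,p}+4\,\sigma_{(\tau')^{2p}}\,S_p\Big)^{1/p}\left(\exp\Big(-\frac n{16}\Big)+\frac2n\Big(\frac{\sigma_{(\tau')^2}}{\sigma_{\tau'}^2}-1\Big)\right)^{1/q}.$$ Then $$\mathbb E\Big[d(m,m_n)^2\,\min\big(\tau''(2\chi),\,\tau''(2\,d(m,m_n))\big)\Big]\le\frac{64}n\,\min\left(4\,\sigma_{(\tau')^2}\,S_1+V_{n,1},\;\;\frac{4\,\sigma_{(\tau')^2}}{\tau''(4r_0)}+b_n\right).$$ Here all expectations are taken in $[0,\infty]$ (so the claim is trivial if the right-hand side is infinite), with $0\cdot\infty=0$; in the degenerate case $\sigma_{\tau'}=0$ (where $Y=m$ almost surely), the term $\sigma_{(\tau')^2}/\sigma_{\tau'}^2-1$ is read as $0$. -/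

import Mathlib

open scoped ENNReal

noncomputable section

namespace TransformedFrechet

/-- A (nonempty) Hadamard space: a complete metric space in which any two points have a midpoint
that satisfies the nonpositive curvature inequality. Nonemptiness is supplied by the reference
point wherever this is used. -/
structure IsHadamard (Q : Type*) [MetricSpace Q] : Prop where
  complete : CompleteSpace Q
  exists_midpoint : ∀ y₀ y₁ : Q, ∃ c : Q, ∀ q : Q,
    dist q c ^ 2 ≤ dist y₀ q ^ 2 / 2 + dist y₁ q ^ 2 / 2 - dist y₀ y₁ ^ 2 / 4

/-- Nondecreasing convex functions `τ` on `[0, ∞)`, differentiable on `(0, ∞)` with concave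
derivative, normalized by `τ 0 = 0` and `τ' > 0` on `(0, ∞)`. The values of `τ` at negative
arguments are irrelevant. -/
structure IsTransform (τ : ℝ → ℝ) : Prop where
  monotoneOn : MonotoneOn τ (Set.Ici 0)
  convexOn : ConvexOn ℝ (Set.Ici 0) τ
  differentiableAt : ∀ x : ℝ, 0 < x → DifferentiableAt ℝ τ x
  concaveOn_deriv : ConcaveOn ℝ (Set.Ioi 0) (deriv τ)
  map_zero : τ 0 = 0
  deriv_pos : ∀ x : ℝ, 0 < x → 0 < deriv τ x

/-- The derivative `τ'` on `[0, ∞)`, extended to `0` by its limit from the right. -/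
def dtran (τ : ℝ → ℝ) (x : ℝ) : ℝ :=
  if 0 < x then deriv τ x else Filter.limUnder (nhdsWithin (0 : ℝ) (Set.Ioi 0)) (deriv τ)

/-- The right derivative `τ''` of `τ'` on `(0, ∞)`, with the convention `τ'' 0 = ∞`, that is,
`1 / τ'' 0 = 0`. -/
def ddtran (τ : ℝ → ℝ) (x : ℝ) : ℝ≥0∞ :=
  if 0 < x then ENNReal.ofReal (derivWithin (dtran τ) (Set.Ioi x) x) else ⊤

/-- The generalized inverse `z ↦ sup {x > 0 | τ' x ≤ z}` of `τ'` (with `sup ∅ = 0`). -/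
def invDtran (τ : ℝ → ℝ) (z : ℝ) : ℝ :=
  sSup {x : ℝ | 0 < x ∧ dtran τ x ≤ z}

/-- `g x = τ''(7 x)⁻¹`. -/
def g (τ : ℝ → ℝ) (x : ℝ) : ℝ≥0∞ := (ddtran τ (7 * x))⁻¹

/-- `h x = g ((τ')⁻¹ (12 x))`. -/
def h (τ : ℝ → ℝ) (x : ℝ) : ℝ≥0∞ := g τ (invDtran τ (12 * x))

section Probability

variable {Q Ω : Type*} [MetricSpace Q] [MeasurableSpace Ω]

/-- `m` is a `τ`-Fréchet mean of `Y`: a minimizer of `q ↦ E[τ(d(Y,q)) - τ(d(Y,o))]`. -/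
def IsFrechetMean (τ : ℝ → ℝ) (P : MeasureTheory.Measure Ω) (Y : Ω → Q) (o m : Q) : Prop :=
  ∀ q : Q, ∫ ω, (τ (dist (Y ω) m) - τ (dist (Y ω) o)) ∂P
    ≤ ∫ ω, (τ (dist (Y ω) q) - τ (dist (Y ω) o)) ∂P

/-- `c` is a sample `τ`-Fréchet mean of the points `y₁, …, yₙ`. -/
def IsSampleFrechetMean {n : ℕ} (τ : ℝ → ℝ) (y : Fin n → Q) (c : Q) : Prop :=
  ∀ q : Q, ∑ j, τ (dist (y j) c) ≤ ∑ j, τ (dist (y j) q)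

/-- `χ` is a median of the real random variable `X`. -/
def IsMedian (P : MeasureTheory.Measure Ω) (X : Ω → ℝ) (χ : ℝ) : Prop :=
  1 / 2 ≤ P {ω | X ω ≤ χ} ∧ 1 / 2 ≤ P {ω | χ ≤ X ω}

/-- The moment `σ_f = E[f(d(Y,m))]`, with values in `[0, ∞]`. -/
def moment (P : MeasureTheory.Measure Ω) (Y : Ω → Q) (m : Q) (f : ℝ → ℝ≥0∞) : ℝ≥0∞ :=
  ∫⁻ ω, f (dist (Y ω) m) ∂P

/-- The power moment `E[τ'(d(Y,m))ʳ]`. -/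
def powMoment (τ : ℝ → ℝ) (P : MeasureTheory.Measure Ω) (Y : Ω → Q) (m : Q) (r : ℝ) : ℝ≥0∞ :=
  moment P Y m (fun x => ENNReal.ofReal (dtran τ x) ^ r)

/-- The first moment `σ_{τ'} = E[τ'(d(Y,m))]` as a real number (it is finite as soon as
`E[τ'(d(Y,o))]` is finite for some `o`). -/
def sigma (τ : ℝ → ℝ) (P : MeasureTheory.Measure Ω) (Y : Ω → Q) (m : Q) : ℝ :=
  ∫ ω, dtran τ (dist (Y ω) m) ∂P

/-- The empirical first moment `n⁻¹ ∑ⱼ τ'(d(Yⱼ,m))`. -/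
def sigmaHat {n : ℕ} (τ : ℝ → ℝ) (Ys : Fin n → Ω → Q) (m : Q) (ω : Ω) : ℝ :=
  (∑ j, dtran τ (dist (Ys j ω) m)) / n

/-- `S_p = max(σ_{g^p}, 2 h(σ_{τ'})^p, E[h(2 σ̂_{τ'})^p])`. -/
def S {n : ℕ} (τ : ℝ → ℝ) (P : MeasureTheory.Measure Ω) (Y : Ω → Q) (Ys : Fin n → Ω → Q) (m : Q)
    (p : ℝ) : ℝ≥0∞ :=
  max (moment P Y m (fun x => g τ x ^ p))
    (max (2 * h τ (sigma τ P Y m) ^ p) (∫⁻ ω, h τ (2 * sigmaHat τ Ys m ω) ^ p ∂P))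

/-- `V_{n,p} = n⁻¹ E[τ'(d(Y,m))^{2p} g(d(Y,m))^p]
  + E[τ'(d(Y,m))^{2p} h(2 n⁻¹ τ'(d(Y,m)))^p]`. -/
def V (n : ℕ) (τ : ℝ → ℝ) (P : MeasureTheory.Measure Ω) (Y : Ω → Q) (m : Q) (p : ℝ) : ℝ≥0∞ :=
  (n : ℝ≥0∞)⁻¹ * moment P Y m (fun x => ENNReal.ofReal (dtran τ x) ^ (2 * p) * g τ x ^ p)
    + moment P Y m
        (fun x => ENNReal.ofReal (dtran τ x) ^ (2 * p) * h τ (2 * (n : ℝ)⁻¹ * dtran τ x) ^ p)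

/-- `r₀ = max(χ, 2 (τ')⁻¹(16 σ_{τ'}))`. -/
def r₀ (τ : ℝ → ℝ) (P : MeasureTheory.Measure Ω) (Y : Ω → Q) (m : Q) (χ : ℝ) : ℝ :=
  max χ (2 * invDtran τ (16 * sigma τ P Y m))

/-- `b_n = (V_{n,p} + 4 σ_{(τ')^{2p}} S_p)^{1/p}
  (exp(-n/16) + (2/n) (σ_{(τ')²} / σ_{τ'}² - 1))^{1/q}`. The subtraction is the true one, since
`σ_{(τ')²} ≥ σ_{τ'}²`. -/
def b {n : ℕ} (τ : ℝ → ℝ) (P : MeasureTheory.Measure Ω) (Y : Ω → Q) (Ys : Fin n → Ω → Q) (m : Q)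
    (p q : ℝ) : ℝ≥0∞ :=
  (V n τ P Y m p + 4 * powMoment τ P Y m (2 * p) * S τ P Y Ys m p) ^ (1 / p)
    * (ENNReal.ofReal (Real.exp (-(n : ℝ) / 16))
        + 2 / (n : ℝ≥0∞) * (powMoment τ P Y m 2 / ENNReal.ofReal (sigma τ P Y m ^ 2) - 1))
      ^ (1 / q)

end Probability

end TransformedFrechet

end

noncomputable section

namespace TransformedFrechet

open Set Filter Topology MeasureTheory ProbabilityTheory

/-! ### Calculus of the transform, its derivative and the generalized inverse. -/

section Transform

variable {τ : ℝ → ℝ}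

/-! The loss is controlled by the excess risk of the sample mean, and the excess risk by stability:
exchanging one observation for an independent ghost copy moves the sample mean by only `O(1/n)`.

Three deterministic inequalities carry this. Uniform convexity (`IsTransform.map_le_of_sq_le`):
along a geodesic, `τ` of the distance to a point gains a quadratic term weighted by `τ''` at the
larger endpoint distance. Hence minimizers satisfy variance inequalities, for samples
(`sample_variance_inequality`) and for the population (`weightedLoss_le`), where the median
guarantees curvature on half of the mass. The quadruple inequality (`IsTransform.quadruple`)
transports the metric Cauchy–Schwarz inequality from squared distances to `τ`, with `τ'` of a
distance as one factor. Stability (`sample_stability`): adding the variance inequalities of two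
samples that differ in one observation, all common terms cancel and one quadruple remains, so the
distance of the two means is at most a multiple of `τ'` over the total curvature.

Symmetrization: as the sample mean minimizes the empirical risk, `n` times its excess risk is at
most the sum over `j` of the ghost losses integrated over the ghost observation
(`mul_excessRisk_le`). Exchanging the ghost with observation `j` preserves the product law, and a
ghost loss plus its exchanged version is a quadruple difference of the two sample means. Stability
bounds its mean by `1/n` times the expectation of `τ'(d(Y_j,m))²` times the reciprocal average
curvature (`integral_ghostLoss_le`).

Two estimates of this expectation give the two members of the minimum. Either the
harmonic–arithmetic mean inequality and Jensen replace the reciprocal by averages of `g` and `h`,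
which independence factorizes (`lintegral_rpow_mul_invCurv_rpow_le`); or the reciprocal is at most
`4 / τ''(4 r₀)` outside an event of small probability, on which Hölder's inequality is applied
(`lintegral_sq_mul_invCurv_le`).

Sample means exist, are unique and depend continuously on the sample, which settles measurability
once the observations are moved to a second countable space. -/

theorem dtran_of_pos {x : ℝ} (hx : 0 < x) : dtran τ x = deriv τ x := by simp [dtran, hx]

theorem dtran_of_nonpos {x : ℝ} (hx : x ≤ 0) : dtran τ x = dtran τ 0 := by
  simp [dtran, hx.not_gt]

theorem ddtran_of_pos {x : ℝ} (hx : 0 < x) :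
    ddtran τ x = ENNReal.ofReal (derivWithin (dtran τ) (Ioi x) x) := by simp [ddtran, hx]

theorem ddtran_of_nonpos {x : ℝ} (hx : x ≤ 0) : ddtran τ x = ⊤ := by simp [ddtran, hx.not_gt]

theorem ddtran_ne_top {x : ℝ} (hx : 0 < x) : ddtran τ x ≠ ⊤ := by simp [ddtran_of_pos hx]

namespace IsTransform

theorem monotoneOn_deriv (hτ : IsTransform τ) : MonotoneOn (deriv τ) (Ioi 0) :=
  (hτ.convexOn.subset Ioi_subset_Ici_self (convex_Ioi 0)).monotoneOn_deriv
    fun x hx => hτ.differentiableAt x hx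

/-- A monotone function bounded below tends to its infimum at the left endpoint, so the `limUnder`
in `dtran` is a genuine limit and not a default value. -/
theorem tendsto_deriv_zero (hτ : IsTransform τ) :
    Tendsto (deriv τ) (𝓝[>] 0) (𝓝 (dtran τ 0)) := by
  have h1 : Tendsto (deriv τ) (𝓝[>] 0) (𝓝 (sInf (deriv τ '' Ioi 0))) := by
    refine MonotoneOn.tendsto_nhdsGT hτ.monotoneOn_deriv ⟨0, ?_⟩
    rintro _ ⟨x, hx, rfl⟩
    exact (hτ.deriv_pos x hx).le
  have h2 : dtran τ 0 = sInf (deriv τ '' Ioi 0) := by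
    simp only [dtran, lt_irrefl, if_false]
    exact h1.limUnder_eq
  rwa [h2]

theorem hasDerivAt (hτ : IsTransform τ) {x : ℝ} (hx : 0 < x) : HasDerivAt τ (dtran τ x) x := by
  rw [dtran_of_pos hx]
  exact (hτ.differentiableAt x hx).hasDerivAt

theorem dtran_pos (hτ : IsTransform τ) {x : ℝ} (hx : 0 < x) : 0 < dtran τ x := by
  rw [dtran_of_pos hx]
  exact hτ.deriv_pos x hx

theorem dtran_zero_le (hτ : IsTransform τ) {x : ℝ} (hx : 0 < x) : dtran τ 0 ≤ dtran τ x := by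
  rw [dtran_of_pos hx]
  refine le_of_tendsto hτ.tendsto_deriv_zero ?_
  filter_upwards [Ioo_mem_nhdsGT hx] with y hy
  exact hτ.monotoneOn_deriv hy.1 hx hy.2.le

theorem monotone_dtran (hτ : IsTransform τ) : Monotone (dtran τ) := by
  intro x y hxy
  rcases le_or_gt x 0 with hx | hx
  · rw [dtran_of_nonpos hx]
    rcases le_or_gt y 0 with hy | hy
    · rw [dtran_of_nonpos hy]
    · exact hτ.dtran_zero_le hy
  · rw [dtran_of_pos hx, dtran_of_pos (hx.trans_le hxy)]
    exact hτ.monotoneOn_deriv hx (hx.trans_le hxy) hxy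

theorem dtran_nonneg (hτ : IsTransform τ) (x : ℝ) : 0 ≤ dtran τ x := by
  have h0 : 0 ≤ dtran τ 0 := by
    refine ge_of_tendsto hτ.tendsto_deriv_zero ?_
    filter_upwards [self_mem_nhdsWithin] with y hy
    exact (hτ.deriv_pos y hy).le
  rcases le_or_gt x 0 with hx | hx
  · rwa [dtran_of_nonpos hx]
  · exact (hτ.dtran_pos hx).le

theorem concaveOn_dtran_Ioi (hτ : IsTransform τ) : ConcaveOn ℝ (Ioi 0) (dtran τ) :=
  hτ.concaveOn_deriv.congr fun _ hx => (dtran_of_pos hx).symm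

/-- Since `dtran` is constant on the negative axis, continuity and monotonicity hold on all of `ℝ`,
and later measurability arguments need no restriction to the half line. -/
theorem continuous_dtran (hτ : IsTransform τ) : Continuous (dtran τ) := by
  have h : ContinuousOn (dtran τ) (Ici 0) := by
    intro x hx
    rcases (mem_Ici.1 hx).eq_or_lt with rfl | hx
    · rw [← continuousWithinAt_Ioi_iff_Ici, ContinuousWithinAt]
      refine hτ.tendsto_deriv_zero.congr' ?_
      filter_upwards [self_mem_nhdsWithin] with y hy
      exact (dtran_of_pos hy).symm
    · exact ((hτ.concaveOn_dtran_Ioi.continuousOn isOpen_Ioi).continuousAt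
        (Ioi_mem_nhds hx)).continuousWithinAt
  have h2 : dtran τ = fun x => dtran τ (max x 0) := by
    funext x
    rcases le_or_gt x 0 with hx | hx
    · rw [max_eq_right hx, dtran_of_nonpos hx]
    · rw [max_eq_left hx.le]
  rw [h2]
  exact h.comp_continuous (by fun_prop) fun x => mem_Ici.2 (le_max_right _ _)

theorem concaveOn_dtran (hτ : IsTransform τ) : ConcaveOn ℝ (Ici 0) (dtran τ) := by
  refine ⟨convex_Ici 0, fun x hx y hy a b ha hb hab => ?_⟩
  -- Concavity on the open half line is applied at points shifted by `e > 0`, and then `e` tends to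
  -- `0`.
  have h1 : Tendsto (fun e : ℝ => a • dtran τ (x + e) + b • dtran τ (y + e)) (𝓝[>] 0)
      (𝓝 (a • dtran τ (x + 0) + b • dtran τ (y + 0))) := by
    have := hτ.continuous_dtran
    exact Tendsto.mono_left (Continuous.tendsto (by fun_prop) 0) nhdsWithin_le_nhds
  have h2 : Tendsto (fun e : ℝ => dtran τ (a • x + b • y + e)) (𝓝[>] 0)
      (𝓝 (dtran τ (a • x + b • y + 0))) := by
    have := hτ.continuous_dtran
    exact Tendsto.mono_left (Continuous.tendsto (by fun_prop) 0) nhdsWithin_le_nhds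
  simp only [add_zero] at h1 h2
  refine le_of_tendsto_of_tendsto h1 h2 ?_
  filter_upwards [self_mem_nhdsWithin] with e he
  have he : 0 < e := he
  have hx : 0 ≤ x := hx
  have hy : 0 ≤ y := hy
  have := hτ.concaveOn_dtran_Ioi.2 (x := x + e) (y := y + e) (by simp; linarith)
    (by simp; linarith) ha hb hab
  refine this.trans_eq (congrArg _ ?_)
  simp only [smul_eq_mul]
  linear_combination e * hab

theorem continuousOn (hτ : IsTransform τ) : ContinuousOn τ (Ici 0) := by
  intro x hx
  rcases (mem_Ici.1 hx).eq_or_lt with rfl | hx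
  · rw [ContinuousWithinAt, hτ.map_zero]
    -- Convexity on `[0, 1]` and `τ 0 = 0` give `0 ≤ τ y ≤ y * τ 1`, hence continuity at the
    -- endpoint.
    have h1 : Tendsto (fun x : ℝ => x * τ 1) (𝓝[≥] 0) (𝓝 0) := by
      have : Tendsto (fun x : ℝ => x * τ 1) (𝓝 0) (𝓝 (0 * τ 1)) :=
        Continuous.tendsto (by fun_prop) 0
      rw [zero_mul] at this
      exact this.mono_left nhdsWithin_le_nhds
    refine tendsto_of_tendsto_of_tendsto_of_le_of_le' tendsto_const_nhds h1 ?_ ?_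
    · filter_upwards [self_mem_nhdsWithin] with y hy
      rw [← hτ.map_zero]
      exact hτ.monotoneOn (mem_Ici.2 le_rfl) hy hy
    · filter_upwards [Icc_mem_nhdsGE (zero_lt_one' ℝ)] with y hy
      have := hτ.convexOn.2 (x := 0) (y := 1) (by simp) (by simp) (sub_nonneg.2 hy.2) hy.1
        (by ring)
      simpa [hτ.map_zero] using this
  · exact (hτ.hasDerivAt hx).continuousAt.continuousWithinAt

theorem nonneg (hτ : IsTransform τ) {x : ℝ} (hx : 0 ≤ x) : 0 ≤ τ x := by
  rw [← hτ.map_zero]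
  exact hτ.monotoneOn (mem_Ici.2 le_rfl) hx hx

/-- The midpoint half of the Hermite–Hadamard inequality for the concave function `τ'`. -/
theorem sub_le_midpoint (hτ : IsTransform τ) {a b : ℝ} (ha : 0 ≤ a) (hab : a ≤ b) :
    τ b - τ a ≤ dtran τ ((a + b) / 2) * (b - a) := by
  set x := (a + b) / 2 with hx
  set r := (b - a) / 2 with hr
  -- Concavity gives `τ' (x + s) + τ' (x - s) ≤ 2 * τ' x`, so `H` is nondecreasing; the claim is `H
  -- 0 ≤ H r`.
  let H : ℝ → ℝ := fun s => 2 * s * dtran τ x - (τ (x + s) - τ (x - s))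
  have hH : MonotoneOn H (Icc 0 r) := by
    refine monotoneOn_of_hasDerivWithinAt_nonneg (f' := fun s =>
      2 * dtran τ x - (dtran τ (x + s) + dtran τ (x - s))) (convex_Icc 0 r) ?_ ?_ ?_
    · refine ContinuousOn.sub (by fun_prop) (ContinuousOn.sub ?_ ?_)
      · refine hτ.continuousOn.comp (by fun_prop) fun s hs => ?_
        simp only [mem_Icc, mem_Ici] at hs ⊢
        linarith
      · refine hτ.continuousOn.comp (by fun_prop) fun s hs => ?_
        simp only [mem_Icc, mem_Ici] at hs ⊢
        linarith
    · intro s hs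
      rw [interior_Icc] at hs
      have h1 : HasDerivAt (fun s => τ (x + s)) (dtran τ (x + s)) s :=
        (hτ.hasDerivAt (by linarith [hs.1, hs.2])).comp_const_add x s
      have h2 : HasDerivAt (fun s => τ (x - s)) (-dtran τ (x - s)) s :=
        (hτ.hasDerivAt (by linarith [hs.1, hs.2])).comp_const_sub x s
      have h3 : HasDerivAt (fun s : ℝ => 2 * s * dtran τ x) (2 * dtran τ x) s := by
        simpa using ((hasDerivAt_id s).const_mul 2).mul_const (dtran τ x)
      exact ((h3.sub (h1.sub h2)).congr_deriv (by ring)).hasDerivWithinAt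
    · intro s hs
      rw [interior_Icc] at hs
      have := hτ.concaveOn_dtran.2 (x := x + s) (y := x - s)
        (by simp only [mem_Ici]; linarith [hs.1, hs.2])
        (by simp only [mem_Ici]; linarith [hs.1, hs.2]) 
        (by norm_num : (0 : ℝ) ≤ 1 / 2) (by norm_num : (0 : ℝ) ≤ 1 / 2) (by norm_num)
      simp only [smul_eq_mul] at this
      rw [show 1 / 2 * (x + s) + 1 / 2 * (x - s) = x by ring] at this
      linarith
  have h0 := hH (left_mem_Icc.2 (by linarith)) (right_mem_Icc.2 (by linarith))
    (show (0 : ℝ) ≤ r by linarith)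
  simp only [H] at h0
  rw [show x + r = b by rw [hx, hr]; ring, show x - r = a by rw [hx, hr]; ring] at h0
  simp only [mul_zero, zero_mul, add_zero, sub_zero, sub_self] at h0
  have : 2 * r = b - a := by rw [hr]; ring
  rw [this] at h0
  linarith

/-- The trapezoidal half of the Hermite–Hadamard inequality for the concave function `τ'`. -/
theorem trapezoid_le_sub (hτ : IsTransform τ) {a b : ℝ} (ha : 0 ≤ a) (hab : a ≤ b) :
    (dtran τ a + dtran τ b) / 2 * (b - a) ≤ τ b - τ a := by
  rcases hab.eq_or_lt with rfl | hlt
  · simp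
  have hba : 0 < b - a := sub_pos.2 hlt
  set c := (dtran τ b - dtran τ a) / (b - a) with hc
  have hcb : c * (b - a) = dtran τ b - dtran τ a := div_mul_cancel₀ _ hba.ne'
  -- The subtracted quadratic is a primitive of the chord of `τ'` over `[a, b]`, and a concave
  -- function lies above its chord.
  let G : ℝ → ℝ := fun x => τ x - (dtran τ a * (x - a) + c / 2 * (x - a) ^ 2)
  have hG : MonotoneOn G (Icc a b) := by
    refine monotoneOn_of_hasDerivWithinAt_nonneg (f' := fun x =>
      dtran τ x - (dtran τ a + c * (x - a))) (convex_Icc a b) ?_ ?_ ?_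
    · exact (hτ.continuousOn.mono fun x hx => ha.trans hx.1).sub (by fun_prop)
    · intro x hx
      rw [interior_Icc] at hx
      have h1 := hτ.hasDerivAt (ha.trans_lt hx.1)
      have h2 : HasDerivAt (fun x : ℝ => dtran τ a * (x - a) + c / 2 * (x - a) ^ 2)
          (dtran τ a + c * (x - a)) x := by
        have h3 : HasDerivAt (fun x : ℝ => x - a) 1 x := (hasDerivAt_id x).sub_const a
        exact ((h3.const_mul _).add ((h3.pow 2).const_mul _)).congr_deriv (by simp; ring)
      exact (h1.sub h2).hasDerivWithinAt
    · intro x hx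
      rw [interior_Icc] at hx
      set t := (x - a) / (b - a) with ht
      have htb : t * (b - a) = x - a := div_mul_cancel₀ _ hba.ne'
      have ht0 : 0 ≤ t := div_nonneg (by linarith [hx.1]) hba.le
      have ht1 : t ≤ 1 := (div_le_one hba).2 (by linarith [hx.2])
      have := hτ.concaveOn_dtran.2 (x := a) (y := b) ha (ha.trans hab)
        (sub_nonneg.2 ht1) ht0 (by ring)
      simp only [smul_eq_mul] at this
      rw [show (1 - t) * a + t * b = x by linear_combination htb] at this
      have e : c * (x - a) = t * (dtran τ b - dtran τ a) := by
        rw [← htb, ← hcb]; ring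
      rw [e]
      linarith
  have h0 := hG (left_mem_Icc.2 hab) (right_mem_Icc.2 hab) hab
  simp only [G, sub_self, mul_zero, zero_pow two_ne_zero, add_zero, sub_zero] at h0
  have e : dtran τ a * (b - a) + c / 2 * (b - a) ^ 2
      = (dtran τ a + dtran τ b) / 2 * (b - a) := by
    linear_combination (b - a) / 2 * hcb
  linarith

/-- Concavity and `0 ≤ τ' 0` make `τ' x / x` nonincreasing; this is the division-free form.
Subadditivity of `τ'` and most comparisons of `τ'` at different scales come from it. -/
theorem mul_dtran_le (hτ : IsTransform τ) {x y : ℝ} (hx : 0 ≤ x) (hxy : x ≤ y) :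
    x * dtran τ y ≤ y * dtran τ x := by
  rcases hx.eq_or_lt with rfl | hx'
  · simpa using mul_nonneg hxy (hτ.dtran_nonneg 0)
  have hy : 0 < y := hx'.trans_le hxy
  have h := hτ.concaveOn_dtran.2 (x := 0) (y := y) (by simp) hy.le
    (sub_nonneg.2 ((div_le_one hy).2 hxy)) (by positivity : 0 ≤ x / y) (by ring)
  simp only [smul_eq_mul, mul_zero, zero_add, div_mul_cancel₀ x hy.ne'] at h
  have h1 : 0 ≤ (1 - x / y) * dtran τ 0 :=
    mul_nonneg (sub_nonneg.2 ((div_le_one hy).2 hxy)) (hτ.dtran_nonneg 0)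
  have h2 : x / y * dtran τ y ≤ dtran τ x := by linarith
  calc x * dtran τ y = y * (x / y * dtran τ y) := by field_simp
    _ ≤ _ := by gcongr

theorem dtran_add_le (hτ : IsTransform τ) {x y : ℝ} (hx : 0 ≤ x) (hy : 0 ≤ y) :
    dtran τ (x + y) ≤ dtran τ x + dtran τ y := by
  rcases (add_nonneg hx hy).eq_or_lt with h | h
  · have hx0 : x = 0 := by linarith
    have hy0 : y = 0 := by linarith
    subst hx0 hy0
    simpa using hτ.dtran_nonneg 0
  · have h1 := hτ.mul_dtran_le hx (le_add_of_nonneg_right hy)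
    have h2 := hτ.mul_dtran_le hy (le_add_of_nonneg_left hx)
    refine le_of_mul_le_mul_left ?_ h
    linarith

theorem dtran_mul_le (hτ : IsTransform τ) {x c : ℝ} (hx : 0 ≤ x) (hc : 1 ≤ c) :
    dtran τ (c * x) ≤ c * dtran τ x := by
  rcases hx.eq_or_lt with rfl | hx
  · simpa using le_mul_of_one_le_left (hτ.dtran_nonneg 0) hc
  · have := hτ.mul_dtran_le hx.le (le_mul_of_one_le_left hx.le hc)
    refine le_of_mul_le_mul_left (a := x) ?_ hx
    linarith

theorem abs_sub_le (hτ : IsTransform τ) {a b M : ℝ} (ha : 0 ≤ a) (hb : 0 ≤ b) (haM : a ≤ M)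
    (hbM : b ≤ M) : |τ a - τ b| ≤ |a - b| * dtran τ M := by
  have key : ∀ {a b : ℝ}, 0 ≤ a → a ≤ b → b ≤ M → |τ a - τ b| ≤ |a - b| * dtran τ M := by
    intro a b ha hab hbM
    have h0 := hτ.monotoneOn (mem_Ici.2 ha) (mem_Ici.2 (ha.trans hab)) hab
    rw [abs_sub_comm, abs_of_nonneg (sub_nonneg.2 h0), abs_sub_comm,
      abs_of_nonneg (sub_nonneg.2 hab), mul_comm]
    refine (hτ.sub_le_midpoint ha hab).trans ?_
    exact mul_le_mul_of_nonneg_right (hτ.monotone_dtran (by linarith)) (by linarith)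
  rcases le_total a b with hab | hab
  · exact key ha hab hbM
  · rw [abs_sub_comm, abs_sub_comm a]
    exact key hb hab haM

/-- The trapezoidal rule on `[0, x]` with `τ' 0 ≥ 0` dropped. It turns bounds on `τ` of a distance
into bounds on `τ'`. -/
theorem mul_dtran_le_two_mul (hτ : IsTransform τ) {x : ℝ} (hx : 0 ≤ x) :
    x * dtran τ x ≤ 2 * τ x := by
  have h := hτ.trapezoid_le_sub le_rfl hx
  rw [hτ.map_zero] at h
  nlinarith [mul_nonneg hx (hτ.dtran_nonneg 0)]

theorem rightDeriv_neg_dtran (x : ℝ) :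
    derivWithin (-dtran τ) (Ioi x) x = -derivWithin (dtran τ) (Ioi x) x :=
  derivWithin.neg

theorem sub_le_rightDeriv_mul (hτ : IsTransform τ) {x y : ℝ} (hx : 0 < x) (hxy : x ≤ y) :
    dtran τ y - dtran τ x ≤ derivWithin (dtran τ) (Ioi x) x * (y - x) := by
  rcases hxy.eq_or_lt with rfl | hlt
  · simp
  have h := hτ.concaveOn_dtran.neg.rightDeriv_le_slope_of_mem_interior
    (by simpa using hx) (mem_Ici.2 (hx.le.trans hxy)) hlt
  rw [rightDeriv_neg_dtran, slope_def_field, le_div_iff₀ (sub_pos.2 hlt)] at h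
  simp only [Pi.neg_apply] at h
  linarith

theorem rightDeriv_mul_le_sub (hτ : IsTransform τ) {x y : ℝ} (hx : 0 ≤ x) (hxy : x ≤ y) :
    derivWithin (dtran τ) (Ioi y) y * (y - x) ≤ dtran τ y - dtran τ x := by
  rcases hxy.eq_or_lt with rfl | hlt
  · simp
  have hy : y ∈ interior (Ici (0 : ℝ)) := by simpa using hx.trans_lt hlt
  have h := (hτ.concaveOn_dtran.neg.slope_le_leftDeriv_of_mem_interior (mem_Ici.2 hx) hy
    hlt).trans (hτ.concaveOn_dtran.neg.leftDeriv_le_rightDeriv_of_mem_interior hy)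
  rw [rightDeriv_neg_dtran, slope_def_field, div_le_iff₀ (sub_pos.2 hlt)] at h
  simp only [Pi.neg_apply] at h
  linarith

theorem rightDeriv_nonneg (hτ : IsTransform τ) {x : ℝ} (hx : 0 < x) :
    0 ≤ derivWithin (dtran τ) (Ioi x) x := by
  have h := hτ.sub_le_rightDeriv_mul hx (le_add_of_nonneg_right zero_le_one)
  have h2 := hτ.monotone_dtran (le_add_of_nonneg_right zero_le_one : x ≤ x + 1)
  linarith

theorem antitone_ddtran (hτ : IsTransform τ) : Antitone (ddtran τ) := by
  intro x y hxy
  rcases le_or_gt x 0 with hx | hx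
  · simp [ddtran_of_nonpos hx]
  · rw [ddtran_of_pos hx, ddtran_of_pos (hx.trans_le hxy)]
    refine ENNReal.ofReal_le_ofReal ?_
    have h := hτ.concaveOn_dtran.neg.monotoneOn_rightDeriv (by simpa using hx)
      (by simpa using hx.trans_le hxy) hxy
    simp only [rightDeriv_neg_dtran] at h
    exact neg_le_neg_iff.1 h

/-- As `τ''` is nonincreasing, a lower bound at `M` is one on all of `(0, M]`. A real `κ` is used so
that the value `⊤` of `τ''` at zero needs no separate treatment. -/
theorem mul_sub_le_dtran_sub (hτ : IsTransform τ) {κ x y M : ℝ}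
    (hκ : ENNReal.ofReal κ ≤ ddtran τ M) (hx : 0 ≤ x) (hxy : x ≤ y) (hy : y ≤ M) :
    κ * (y - x) ≤ dtran τ y - dtran τ x := by
  rcases hxy.eq_or_lt with rfl | hlt
  · simp
  have hy0 : 0 < y := hx.trans_lt hlt
  have h := hκ.trans (hτ.antitone_ddtran hy)
  rw [ddtran_of_pos hy0, ENNReal.ofReal_le_ofReal_iff (hτ.rightDeriv_nonneg hy0)] at h
  exact (mul_le_mul_of_nonneg_right h (sub_nonneg.2 hxy)).trans (hτ.rightDeriv_mul_le_sub hx hxy)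

theorem ddtran_le_div (hτ : IsTransform τ) {x : ℝ} (hx : 0 < x) :
    ddtran τ x ≤ ENNReal.ofReal (dtran τ x / x) := by
  rw [ddtran_of_pos hx]
  refine ENNReal.ofReal_le_ofReal ?_
  rw [le_div_iff₀ hx]
  have := hτ.rightDeriv_mul_le_sub le_rfl hx.le
  rw [sub_zero] at this
  linarith [hτ.dtran_nonneg 0]

theorem tendsto_dtran_atTop (hτ : IsTransform τ)
    (hlim : limsup (fun x : ℝ => ((dtran τ x : ℝ) : EReal)) atTop = ⊤) :
    Tendsto (dtran τ) atTop atTop := by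
  refine tendsto_atTop_atTop_of_monotone hτ.monotone_dtran fun B => ?_
  by_contra! hB
  have : limsup (fun x : ℝ => ((dtran τ x : ℝ) : EReal)) atTop ≤ (B : EReal) :=
    limsup_le_of_le (by isBoundedDefault)
      (Eventually.of_forall fun x => EReal.coe_le_coe_iff.2 (hB x).le)
  rw [hlim, top_le_iff] at this
  exact EReal.coe_ne_top B this

/-- If the right derivative of the concave `τ'` vanished at `x`, then `τ'` could never exceed `τ' x`
afterwards, against unboundedness. -/
theorem ddtran_ne_zero (hτ : IsTransform τ) (hlim : Tendsto (dtran τ) atTop atTop) (x : ℝ) :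
    ddtran τ x ≠ 0 := by
  rcases le_or_gt x 0 with hx | hx
  · simp [ddtran_of_nonpos hx]
  · rw [ddtran_of_pos hx, Ne, ENNReal.ofReal_eq_zero, not_le]
    refine lt_of_not_ge fun h => ?_
    obtain ⟨y, hy, hxy⟩ := ((hlim.eventually_gt_atTop (dtran τ x)).and
      (eventually_ge_atTop x)).exists
    have h1 := hτ.sub_le_rightDeriv_mul hx hxy
    have h2 := mul_nonpos_of_nonpos_of_nonneg h (sub_nonneg.2 hxy)
    linarith

/-- This keeps `invDtran` away from the default value `0` of `sSup` on unbounded sets. -/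
theorem bddAbove_dtran_le (hτ : IsTransform τ) (hlim : Tendsto (dtran τ) atTop atTop) (z : ℝ) :
    BddAbove {x : ℝ | 0 < x ∧ dtran τ x ≤ z} := by
  obtain ⟨y, hy⟩ := (hlim.eventually_gt_atTop z).exists
  refine ⟨y, fun x hx => le_of_not_gt fun h => ?_⟩
  exact (hy.trans_le (hτ.monotone_dtran h.le)).not_ge hx.2

end IsTransform

theorem invDtran_nonneg (z : ℝ) : 0 ≤ invDtran τ z :=
  Real.sSup_nonneg fun _ hx => hx.1.le

namespace IsTransform

theorem le_invDtran (hτ : IsTransform τ) (hlim : Tendsto (dtran τ) atTop atTop) {x z : ℝ}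
    (h : dtran τ x ≤ z) : x ≤ invDtran τ z := by
  rcases le_or_gt x 0 with hx | hx
  · exact hx.trans (invDtran_nonneg z)
  · exact le_csSup (hτ.bddAbove_dtran_le hlim z) ⟨hx, h⟩

theorem monotone_invDtran (hτ : IsTransform τ) (hlim : Tendsto (dtran τ) atTop atTop) :
    Monotone (invDtran τ) := by
  intro z w hzw
  refine Real.sSup_le (fun x hx => ?_) (invDtran_nonneg w)
  exact hτ.le_invDtran hlim (hx.2.trans hzw)

theorem dtran_invDtran_le (hτ : IsTransform τ) {z : ℝ} (h : 0 < invDtran τ z) :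
    dtran τ (invDtran τ z) ≤ z := by
  -- An empty or unbounded set would have supremum `0` in `ℝ`; positivity of `invDtran τ z` excludes
  -- both.
  have hne : {x : ℝ | 0 < x ∧ dtran τ x ≤ z}.Nonempty := by
    by_contra hne
    rw [not_nonempty_iff_eq_empty] at hne
    simp [invDtran, hne] at h
  have hb : BddAbove {x : ℝ | 0 < x ∧ dtran τ x ≤ z} := by
    by_contra hb
    simp [invDtran, Real.sSup_of_not_bddAbove hb] at h
  have hc : IsClosed {x : ℝ | dtran τ x ≤ z} := isClosed_le hτ.continuous_dtran continuous_const
  exact closure_minimal (fun x hx => hx.2) hc (csSup_mem_closure hne hb)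

theorem monotone_g (hτ : IsTransform τ) : Monotone (g τ) := fun _ _ hxy =>
  ENNReal.inv_le_inv.2 (hτ.antitone_ddtran (by linarith))

theorem monotone_h (hτ : IsTransform τ) (hlim : Tendsto (dtran τ) atTop atTop) :
    Monotone (h τ) := fun _ _ hxy =>
  hτ.monotone_g (hτ.monotone_invDtran hlim (by linarith))

theorem h_ne_top (hτ : IsTransform τ) (hlim : Tendsto (dtran τ) atTop atTop) (z : ℝ) :
    h τ z ≠ ⊤ := by
  simpa [h, g] using hτ.ddtran_ne_zero hlim _

/-- With `u = (τ')⁻¹(12 z)`, concavity gives `τ''(7u) ≤ τ'(7u) / (7u) ≤ τ'(u) / u ≤ 12 z / u`.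
Through this bound, moments involving `h` control the distance from `m` to the sample mean. -/
theorem invDtran_le_mul_h (hτ : IsTransform τ) (z : ℝ) :
    ENNReal.ofReal (invDtran τ (12 * z)) ≤ ENNReal.ofReal (12 * z) * h τ z := by
  set u := invDtran τ (12 * z) with hu
  rcases (invDtran_nonneg (12 * z) : 0 ≤ invDtran τ (12 * z)).eq_or_lt with h0 | h0
  · rw [hu, ← h0]; simp
  have hfu : dtran τ u ≤ 12 * z := hτ.dtran_invDtran_le h0
  have hz : 0 < 12 * z := (hτ.dtran_pos h0).trans_le hfu
  have h1 : ddtran τ (7 * u) ≤ ENNReal.ofReal (12 * z / u) := by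
    refine (hτ.ddtran_le_div (by positivity)).trans (ENNReal.ofReal_le_ofReal ?_)
    rw [div_le_div_iff₀ (by positivity) h0]
    have := hτ.dtran_mul_le h0.le (by norm_num : (1 : ℝ) ≤ 7)
    nlinarith
  have h2 : ENNReal.ofReal (u / (12 * z)) ≤ h τ z := by
    rw [h, g, ← hu, ← inv_div, ENNReal.ofReal_inv_of_pos (by positivity)]
    exact ENNReal.inv_le_inv.2 h1
  calc ENNReal.ofReal u = ENNReal.ofReal (12 * z) * ENNReal.ofReal (u / (12 * z)) := by
        rw [← ENNReal.ofReal_mul hz.le, mul_div_cancel₀ _ hz.ne']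
    _ ≤ _ := by gcongr

/-! ### The quadruple inequality and uniform convexity for real variables. -/

theorem dtran_mul_le_of_mul_le (hτ : IsTransform τ) {u X ε c : ℝ} (hX : 0 ≤ X)
    (hXε : X ≤ ε) (hc : 0 ≤ c) (hεc : ε ≤ c) (huX : u * X ≤ ε * c) :
    dtran τ u * X ≤ ε * dtran τ c := by
  have hfc := hτ.dtran_nonneg c
  have hε : 0 ≤ ε := hX.trans hXε
  -- Up to `c`, monotonicity of `τ'` and `X ≤ ε` suffice. Beyond `c`, `τ'` grows at most linearly,
  -- which the bound on `u * X` compensates.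
  rcases le_total u c with huc | huc
  · rw [mul_comm]
    exact mul_le_mul hXε (hτ.monotone_dtran huc) (hτ.dtran_nonneg u) hε
  · rcases hc.eq_or_lt with rfl | hc0
    · have : X = 0 := by linarith
      subst this
      simpa using mul_nonneg hε hfc
    · have h1 := hτ.mul_dtran_le hc huc
      refine le_of_mul_le_mul_left ?_ hc0
      calc c * (dtran τ u * X) = c * dtran τ u * X := by ring
        _ ≤ u * dtran τ c * X := by gcongr
        _ = u * X * dtran τ c := by ring
        _ ≤ ε * c * dtran τ c := by gcongr
        _ = _ := by ring

/-- A linearization of the quadruple inequality at the midpoint `u` of `a` and `a'`. -/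
theorem quadruple_real_of_linear (hτ : IsTransform τ) {a a' b b' ε c u W : ℝ} (ha : 0 ≤ a)
    (hb : 0 ≤ b) (haa : a ≤ a') (hbb : b ≤ b') (hc : 0 ≤ c) (hu : u = (a + a') / 2)
    (hupos : 0 < u) (huc : c ≤ u) (hε : 0 ≤ ε)
    (h1 : W * dtran τ u ≤ u * ((dtran τ b + dtran τ b') / 2))
    (h2 : u * (a' - a) - W * (b' - b) ≤ 2 * ε * c) :
    τ a' - τ a - τ b' + τ b ≤ 2 * ε * dtran τ c := by
  have hmid := hτ.sub_le_midpoint ha haa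
  rw [← hu] at hmid
  have htrap := hτ.trapezoid_le_sub hb hbb
  have hY0 : 0 ≤ b' - b := by linarith
  -- The midpoint rule bounds the increment over `[a, a']` from above, the trapezoidal rule the one
  -- over `[b, b']` from below. The weight `W` expresses both through `τ' u`.
  have h3 : u * (τ a' - τ a - τ b' + τ b) ≤ dtran τ u * (2 * ε * c) := by
    calc u * (τ a' - τ a - τ b' + τ b)
        ≤ u * (dtran τ u * (a' - a) - (dtran τ b + dtran τ b') / 2 * (b' - b)) :=
          mul_le_mul_of_nonneg_left (by linarith) hupos.le
      _ = dtran τ u * (u * (a' - a)) - u * ((dtran τ b + dtran τ b') / 2) * (b' - b) := by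
          ring
      _ ≤ dtran τ u * (u * (a' - a)) - W * dtran τ u * (b' - b) :=
          sub_le_sub_left (mul_le_mul_of_nonneg_right h1 hY0) _
      _ = dtran τ u * (u * (a' - a) - W * (b' - b)) := by ring
      _ ≤ _ := mul_le_mul_of_nonneg_left h2 (hτ.dtran_nonneg u)
  have h4 := mul_le_mul_of_nonneg_left (hτ.mul_dtran_le hc huc) (by linarith : 0 ≤ 2 * ε)
  refine le_of_mul_le_mul_left (h3.trans ?_) hupos
  linarith

theorem quadruple_real_of_increasing (hτ : IsTransform τ) {a a' b b' ε c : ℝ} (ha : 0 ≤ a)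
    (hb : 0 ≤ b) (haa : a ≤ a') (hbb : b ≤ b') (hX : a' - a ≤ ε) (hY : b' - b ≤ ε)
    (hab : |a - b| ≤ c) (hab' : |a' - b'| ≤ c)
    (hcs : a' ^ 2 - a ^ 2 - b' ^ 2 + b ^ 2 ≤ 2 * ε * c) (hεc : ε ≤ c) :
    τ a' - τ a - τ b' + τ b ≤ 2 * ε * dtran τ c := by
  have hX0 : 0 ≤ a' - a := by linarith
  have hY0 : 0 ≤ b' - b := by linarith
  have hε : 0 ≤ ε := by linarith
  have hc : 0 ≤ c := by linarith
  have hfc := hτ.dtran_nonneg c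
  have hεfc := mul_nonneg hε hfc
  have hmid := hτ.sub_le_midpoint ha haa
  have hmono := hτ.monotoneOn (mem_Ici.2 hb) (mem_Ici.2 (hb.trans hbb)) hbb
  rw [abs_le] at hab hab'
  obtain ⟨u, hu⟩ : ∃ u, u = (a + a') / 2 := ⟨_, rfl⟩
  rw [← hu] at hmid
  have hu0 : 0 ≤ u := by linarith
  have eX : u * (a' - a) = (a' ^ 2 - a ^ 2) / 2 := by rw [hu]; ring
  rcases le_total u c with huc | huc
  · have h1 : dtran τ u * (a' - a) ≤ dtran τ c * ε :=
      mul_le_mul (hτ.monotone_dtran huc) hX hX0 hfc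
    linarith
  rcases hu0.eq_or_lt with hu00 | hupos
  · have h1 : a' - a = 0 := by linarith
    rw [h1, mul_zero] at hmid
    linarith
  -- Each endpoint `t` of `[b, b']` contributes `min t u / 2` to the weight `W`: `τ' t ≥ τ' u` if `t
  -- ≥ u`, and `u * τ' t ≥ t * τ' u` if `t ≤ u`.
  rcases le_total u b with hub | hub
  · refine hτ.quadruple_real_of_linear (W := u) ha hb haa hbb hc hu hupos huc hε ?_ ?_
    · have h1 := hτ.monotone_dtran hub
      have h2 := hτ.monotone_dtran (hub.trans hbb)
      exact mul_le_mul_of_nonneg_left (by linarith) hu0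
    · have h1 : ((b + b') / 2 - u) * (b' - b) ≤ c * ε :=
        mul_le_mul (by linarith) hY hY0 hc
      linarith
  rcases le_total b' u with hbu | hbu
  · refine hτ.quadruple_real_of_linear (W := (b + b') / 2) ha hb haa hbb hc hu hupos huc hε ?_ ?_
    · have h1 := hτ.mul_dtran_le hb hub
      have h2 := hτ.mul_dtran_le (hb.trans hbb) hbu
      linarith
    · have := mul_nonneg hε hc
      linarith
  · refine hτ.quadruple_real_of_linear (W := (b + u) / 2) ha hb haa hbb hc hu hupos huc hε ?_ ?_
    · have h1 := hτ.mul_dtran_le hb hub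
      have h2 := mul_le_mul_of_nonneg_left (hτ.monotone_dtran hbu) hu0
      linarith
    · have h1 : (b' - u) * (b' - b) ≤ 2 * c * ε :=
        mul_le_mul (by linarith) hY hY0 (by linarith)
      linarith

/-- The real-variable form of the quadruple inequality in the case `ε ≤ c`. -/
theorem quadruple_real_of_le (hτ : IsTransform τ) {a a' b b' ε c : ℝ} (ha : 0 ≤ a) (ha' : 0 ≤ a')
    (hb : 0 ≤ b) (hb' : 0 ≤ b') (haε : |a' - a| ≤ ε) (hbε : |b' - b| ≤ ε) (hac : |a - b| ≤ c)
    (hac' : |a' - b'| ≤ c) (hcs : a' ^ 2 - a ^ 2 - b' ^ 2 + b ^ 2 ≤ 2 * ε * c) (hεc : ε ≤ c) :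
    τ a' - τ a - τ b' + τ b ≤ 2 * ε * dtran τ c := by
  have hε : 0 ≤ ε := (abs_nonneg _).trans haε
  have hc : 0 ≤ c := hε.trans hεc
  have hεfc := mul_nonneg hε (hτ.dtran_nonneg c)
  rw [abs_le] at haε hbε
  rcases le_total a a' with haa | haa <;> rcases le_total b b' with hbb | hbb
  · exact hτ.quadruple_real_of_increasing ha hb haa hbb haε.2 hbε.2 hac hac' hcs hεc
  · have h1 := hτ.sub_le_midpoint ha haa
    have h2 := hτ.sub_le_midpoint hb' hbb
    have p1 : 0 ≤ (a + a') / 2 * (a' - a) := mul_nonneg (by linarith) (by linarith)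
    have p2 : 0 ≤ (b' + b) / 2 * (b - b') := mul_nonneg (by linarith) (by linarith)
    have h3 := hτ.dtran_mul_le_of_mul_le (u := (a + a') / 2) (X := a' - a)
      (by linarith) haε.2 hc hεc (by linarith)
    have h4 := hτ.dtran_mul_le_of_mul_le (u := (b' + b) / 2) (X := b - b')
      (by linarith) (by linarith [hbε.1]) hc hεc (by linarith)
    linarith
  · have h1 := hτ.monotoneOn (mem_Ici.2 ha') (mem_Ici.2 ha) haa
    have h2 := hτ.monotoneOn (mem_Ici.2 hb) (mem_Ici.2 hb') hbb
    linarith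
  · have h := hτ.quadruple_real_of_increasing hb' ha' hbb haa (by linarith [hbε.1])
      (by linarith [haε.1]) (by rwa [abs_sub_comm]) (by rwa [abs_sub_comm]) (by linarith) hεc
    linarith

/-- The real-variable form of the quadruple inequality. -/
theorem quadruple_real (hτ : IsTransform τ) {a a' b b' ε c : ℝ} (ha : 0 ≤ a) (ha' : 0 ≤ a')
    (hb : 0 ≤ b) (hb' : 0 ≤ b') (haε : |a' - a| ≤ ε) (hbε : |b' - b| ≤ ε) (hac : |a - b| ≤ c)
    (hac' : |a' - b'| ≤ c) (hcs : a' ^ 2 - a ^ 2 - b' ^ 2 + b ^ 2 ≤ 2 * ε * c) :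
    τ a' - τ a - τ b' + τ b ≤ 2 * ε * dtran τ c := by
  rcases le_total ε c with h | h
  · exact hτ.quadruple_real_of_le ha ha' hb hb' haε hbε hac hac' hcs h
  · have h1 := hτ.quadruple_real_of_le (a := b') (a' := a') (b := b) (b' := a) hb' ha' hb ha
      hac' hac hbε haε (by linarith) h
    have h2 := hτ.mul_dtran_le ((abs_nonneg _).trans hac) h
    linarith

/-- Uniform convexity of `τ` composed with a distance that satisfies the `CAT(0)` inequality. -/
theorem map_le_of_sq_le (hτ : IsTransform τ) {a b d e t κ : ℝ} (ha : 0 ≤ a) (hb : 0 ≤ b)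
    (hd : 0 ≤ d) (ht : 0 ≤ t) (ht1 : t ≤ 1) (hκ0 : 0 ≤ κ)
    (hκ : ENNReal.ofReal κ ≤ ddtran τ (max a b)) (hab : |a - b| ≤ e)
    (h : d ^ 2 ≤ (1 - t) * a ^ 2 + t * b ^ 2 - t * (1 - t) * e ^ 2) :
    τ d ≤ (1 - t) * τ a + t * τ b - t * (1 - t) / 2 * κ * e ^ 2 := by
  have ht1' : 0 ≤ 1 - t := sub_nonneg.2 ht1
  set M := max a b with hM
  -- The remainder `ρ` is still nondecreasing and convex on `[0, M]`, because `τ'' ≥ κ` there; the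
  -- hypothesis on `d ^ 2` handles the quadratic part.
  let ρ : ℝ → ℝ := fun x => τ x - κ / 2 * x ^ 2
  let ρ' : ℝ → ℝ := fun x => dtran τ x - κ * x
  have hcont : ContinuousOn ρ (Icc 0 M) :=
    (hτ.continuousOn.mono fun x hx => hx.1).sub (by fun_prop)
  have hderiv : ∀ x ∈ interior (Icc 0 M), HasDerivWithinAt ρ (ρ' x) (interior (Icc 0 M)) x := by
    intro x hx
    rw [interior_Icc] at hx
    have h1 := hτ.hasDerivAt hx.1
    have h2 : HasDerivAt (fun x : ℝ => κ / 2 * x ^ 2) (κ * x) x :=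
      (((hasDerivAt_id x).pow 2).const_mul (κ / 2)).congr_deriv (by simp; ring)
    exact (h1.sub h2).hasDerivWithinAt
  have hmonoρ : MonotoneOn ρ (Icc 0 M) := by
    refine monotoneOn_of_hasDerivWithinAt_nonneg (convex_Icc 0 M) hcont hderiv fun x hx => ?_
    rw [interior_Icc] at hx
    have := hτ.mul_sub_le_dtran_sub hκ le_rfl hx.1.le hx.2.le
    have := hτ.dtran_nonneg 0
    simp only [ρ']
    linarith
  have hconvρ : ConvexOn ℝ (Icc 0 M) ρ := by
    refine MonotoneOn.convexOn_of_deriv (convex_Icc 0 M) hcont ?_ ?_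
    · intro x hx
      exact (hderiv x hx).differentiableWithinAt
    · intro x hx y hy hxy
      have e : ∀ z ∈ interior (Icc 0 M), deriv ρ z = ρ' z := fun z hz =>
        ((hderiv z hz).hasDerivAt (isOpen_interior.mem_nhds hz)).deriv
      rw [e x hx, e y hy]
      rw [interior_Icc] at hx hy
      have := hτ.mul_sub_le_dtran_sub hκ hx.1.le hxy hy.2.le
      simp only [ρ']
      linarith
  have haM : a ∈ Icc 0 M := ⟨ha, le_max_left _ _⟩
  have hbM : b ∈ Icc 0 M := ⟨hb, le_max_right _ _⟩
  have habM : (1 - t) * a + t * b ∈ Icc 0 M := by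
    have := (convex_Icc 0 M) haM hbM ht1' ht (by ring)
    simpa using this
  have hde : d ≤ (1 - t) * a + t * b := by
    refine abs_le_of_sq_le_sq' ?_ habM.1 |>.2
    have h1 : (a - b) ^ 2 ≤ e ^ 2 := sq_le_sq' (abs_le.1 hab).1 (abs_le.1 hab).2
    have h2 : 0 ≤ t * (1 - t) := mul_nonneg ht ht1'
    nlinarith
  have h1 := hmonoρ ⟨hd, hde.trans habM.2⟩ habM hde
  have h2 := hconvρ.2 haM hbM ht1' ht (by ring)
  simp only [smul_eq_mul, ρ] at h1 h2
  have h3 := mul_le_mul_of_nonneg_left h (by positivity : 0 ≤ κ / 2)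
  linarith

end IsTransform

end Transform

/-! ### Geometry of Hadamard spaces and the quadruple inequality for `τ`. -/

section Hadamard

variable {Q : Type*} [MetricSpace Q]

namespace IsHadamard

/-- The admissible parameters contain `0` and `1`, are closed under midpoints, and form a closed set
by completeness. A gap in such a set would contain the midpoint of its own endpoints. -/
theorem exists_point (hQ : IsHadamard Q) (p q : Q) {t : ℝ} (ht : t ∈ Icc (0 : ℝ) 1) :
    ∃ c : Q, ∀ y : Q, dist y c ^ 2
      ≤ (1 - t) * dist y p ^ 2 + t * dist y q ^ 2 - t * (1 - t) * dist p q ^ 2 := by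
  have := hQ.complete
  let P : ℝ → Q → Prop := fun t c => ∀ y : Q, dist y c ^ 2
    ≤ (1 - t) * dist y p ^ 2 + t * dist y q ^ 2 - t * (1 - t) * dist p q ^ 2
  let D : Set ℝ := {t | t ∈ Icc (0 : ℝ) 1 ∧ ∃ c, P t c}
  have hp : ∀ {t c}, P t c → dist c p ^ 2 ≤ t ^ 2 * dist p q ^ 2 := by
    intro t c h
    have := h p
    rw [dist_self, dist_comm p c] at this
    linarith
  have hq : ∀ {t c}, P t c → dist c q ^ 2 ≤ (1 - t) ^ 2 * dist p q ^ 2 := by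
    intro t c h
    have := h q
    rw [dist_self, dist_comm q c, dist_comm q p] at this
    linarith
  have hst : ∀ {s t c e}, s ∈ Icc (0 : ℝ) 1 → P s c → P t e →
      dist c e ≤ dist p q * dist s t := by
    intro s t c e hs hc he
    refine abs_le_of_sq_le_sq' ?_ (by positivity) |>.2
    have h1 := hc e
    have h2 := mul_le_mul_of_nonneg_left (hp he) (sub_nonneg.2 hs.2)
    have h3 := mul_le_mul_of_nonneg_left (hq he) hs.1
    rw [Real.dist_eq, mul_pow, sq_abs, dist_comm c e]
    linarith
  have hmid : ∀ s ∈ D, ∀ u ∈ D, (s + u) / 2 ∈ D := by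
    rintro s ⟨hs, c, hc⟩ u ⟨hu, e, he⟩
    refine ⟨⟨by linarith [hs.1, hu.1], by linarith [hs.2, hu.2]⟩, ?_⟩
    obtain ⟨w, hw⟩ := hQ.exists_midpoint c e
    refine ⟨w, fun y => ?_⟩
    -- The midpoint inequality subtracts `dist c e ^ 2 / 4`, so a lower bound on this distance is
    -- needed; it comes from the triangle inequality along `p`, the two points and `q`.
    have h1 : dist p q ^ 2 * (u - s) ^ 2 ≤ dist c e ^ 2 := by
      have h2 : dist p q ≤ dist c p + dist c e + dist e q := by
        rw [dist_comm c p]; exact dist_triangle4 p c e q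
      have h3 : dist c p ≤ s * dist p q :=
        abs_le_of_sq_le_sq' (by rw [mul_pow]; exact hp hc) (mul_nonneg hs.1 dist_nonneg) |>.2
      have h4 : dist e q ≤ (1 - u) * dist p q :=
        abs_le_of_sq_le_sq' (by rw [mul_pow]; exact hq he)
          (mul_nonneg (sub_nonneg.2 hu.2) dist_nonneg) |>.2
      have h5 : dist c e ≤ dist p q * |s - u| := by
        have := hst hs hc he
        rwa [Real.dist_eq] at this
      have h6 : dist p q * (u - s) ≤ dist c e := by linarith
      rcases le_total s u with hsu | hsu
      · rw [← mul_pow]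
        exact pow_le_pow_left₀ (mul_nonneg dist_nonneg (sub_nonneg.2 hsu)) h6 2
      · have h2' : dist p q ≤ dist e p + dist c e + dist c q := by
          rw [dist_comm e p, dist_comm c e]; exact dist_triangle4 p e c q
        have h3' : dist e p ≤ u * dist p q :=
          abs_le_of_sq_le_sq' (by rw [mul_pow]; exact hp he) (mul_nonneg hu.1 dist_nonneg) |>.2
        have h4' : dist c q ≤ (1 - s) * dist p q :=
          abs_le_of_sq_le_sq' (by rw [mul_pow]; exact hq hc)
            (mul_nonneg (sub_nonneg.2 hs.2) dist_nonneg) |>.2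
        rw [show (u - s) ^ 2 = (s - u) ^ 2 by ring, ← mul_pow]
        exact pow_le_pow_left₀ (mul_nonneg dist_nonneg (sub_nonneg.2 hsu)) (by linarith) 2
    have h2 := hw y
    have h3 := hc y
    have h4 := he y
    rw [dist_comm c y, dist_comm e y] at h2
    linarith
  have hclosed : IsClosed D := by
    refine isClosed_of_closure_subset fun t htD => ?_
    obtain ⟨s, hsD, hs⟩ := mem_closure_iff_seq_limit.1 htD
    have ht : t ∈ Icc (0 : ℝ) 1 :=
      isClosed_Icc.mem_of_tendsto hs (Eventually.of_forall fun k => (hsD k).1)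
    choose c hc using fun k => (hsD k).2
    have hcau : CauchySeq c := by
      have h0 : Tendsto (fun x : ℕ × ℕ => dist p q * dist (s x.1) (s x.2)) atTop (𝓝 0) := by
        have := (cauchySeq_iff_tendsto_dist_atTop_0.1 hs.cauchySeq).const_mul (dist p q)
        simpa using this
      rw [cauchySeq_iff_tendsto_dist_atTop_0]
      exact squeeze_zero (fun _ => dist_nonneg) (fun x => hst (hsD x.1).1 (hc x.1) (hc x.2)) h0
    obtain ⟨w, hw⟩ := cauchySeq_tendsto_of_complete hcau
    refine ⟨ht, w, fun y => ?_⟩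
    refine le_of_tendsto_of_tendsto' ((tendsto_const_nhds.dist hw).pow 2) ?_ fun k => hc k y
    have : Continuous fun t : ℝ =>
      (1 - t) * dist y p ^ 2 + t * dist y q ^ 2 - t * (1 - t) * dist p q ^ 2 := by fun_prop
    exact (this.tendsto t).comp hs
  have h0 : (0 : ℝ) ∈ D := ⟨by simp, p, fun y => by simp⟩
  have h1 : (1 : ℝ) ∈ D := ⟨by simp, q, fun y => by simp⟩
  by_contra hcon
  have htD : t ∉ D := fun h => hcon h.2
  have hs := (hclosed.inter isClosed_Iic).csSup_mem (s := D ∩ Iic t) ⟨0, h0, ht.1⟩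
    ⟨t, fun x hx => hx.2⟩
  have hu := (hclosed.inter isClosed_Ici).csInf_mem (s := D ∩ Ici t) ⟨1, h1, ht.2⟩
    ⟨t, fun x hx => hx.2⟩
  set s := sSup (D ∩ Iic t)
  set u := sInf (D ∩ Ici t)
  have hst' : s < t := lt_of_le_of_ne hs.2 fun h => htD (h ▸ hs.1)
  have htu : t < u := lt_of_le_of_ne hu.2 fun h => htD (h ▸ hu.1)
  have hm := hmid s hs.1 u hu.1
  rcases le_total ((s + u) / 2) t with h | h
  · have := le_csSup (s := D ∩ Iic t) ⟨t, fun x hx => hx.2⟩ ⟨hm, h⟩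
    linarith
  · have := csInf_le (s := D ∩ Ici t) ⟨t, fun x hx => hx.2⟩ ⟨hm, h⟩
    linarith

/-- The metric Cauchy–Schwarz inequality. -/
theorem cauchy_schwarz (hQ : IsHadamard Q) (y z p q : Q) :
    dist y q ^ 2 - dist y p ^ 2 - dist z q ^ 2 + dist z p ^ 2 ≤ 2 * dist p q * dist y z := by
  rcases (dist_nonneg (x := y) (y := z)).eq_or_lt with h | hyz
  · rw [eq_comm, dist_eq_zero] at h
    subst h
    simp
  rcases (dist_nonneg (x := p) (y := q)).eq_or_lt with h | hpq
  · rw [eq_comm, dist_eq_zero] at h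
    subst h
    simp
  set A := dist y z with hA
  set B := dist p q with hB
  -- This `t` minimizes `(1 - t) / t * A ^ 2 + t / (1 - t) * B ^ 2`, with minimum `2 * A * B`. The
  -- comparison point lies on the diagonal from `y` to `q`.
  set t := A / (A + B) with ht
  have hAB : 0 < A + B := by positivity
  have htA : t * (A + B) = A := div_mul_cancel₀ _ hAB.ne'
  have ht0 : 0 < t := by positivity
  have ht1 : 0 < 1 - t := by
    have : (1 - t) * (A + B) = B := by linarith
    exact pos_of_mul_pos_left (this.symm ▸ hpq) hAB.le
  obtain ⟨c, hc⟩ := hQ.exists_point y q ⟨ht0.le, by linarith⟩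
  have hz := hc z
  have hp := hc p
  rw [dist_comm z y, ← hA] at hz
  rw [dist_comm p y, ← hB] at hp
  have htri : dist z p ^ 2 ≤ (dist z c + dist p c) ^ 2 :=
    pow_le_pow_left₀ dist_nonneg (dist_triangle_right z p c) 2
  have hkey : t * (1 - t) * dist z p ^ 2
      ≤ (1 - t) * dist z c ^ 2 + t * dist p c ^ 2 := by
    have h1 := mul_le_mul_of_nonneg_left htri (mul_pos ht0 ht1).le
    have h2 := sq_nonneg ((1 - t) * dist z c - t * dist p c)
    linarith
  have hz' := mul_le_mul_of_nonneg_left hz ht1.le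
  have hp' := mul_le_mul_of_nonneg_left hp ht0.le
  have e1 : (1 - t) * A = t * B := by linarith
  refine le_of_mul_le_mul_left ?_ (mul_pos ht0 ht1)
  have e2 : (1 - t) ^ 2 * A ^ 2 = t * (1 - t) * (A * B) := by
    linear_combination (1 - t) * A * e1
  have e3 : t ^ 2 * B ^ 2 = t * (1 - t) * (A * B) := by
    linear_combination -t * B * e1
  linarith

end IsHadamard

variable {τ : ℝ → ℝ}

namespace IsTransform

/-- The quadruple inequality induced by `τ`. -/
theorem quadruple (hτ : IsTransform τ) (hQ : IsHadamard Q) (y z p q : Q) :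
    τ (dist y q) - τ (dist y p) - τ (dist z q) + τ (dist z p)
      ≤ 2 * dist p q * dtran τ (dist y z) := by
  refine hτ.quadruple_real dist_nonneg dist_nonneg dist_nonneg dist_nonneg ?_ ?_ ?_ ?_
    (hQ.cauchy_schwarz y z p q)
  · rw [dist_comm y, dist_comm y, dist_comm p q]; exact abs_dist_sub_le _ _ _
  · rw [dist_comm z, dist_comm z, dist_comm p q]; exact abs_dist_sub_le _ _ _
  · exact abs_dist_sub_le _ _ _
  · exact abs_dist_sub_le _ _ _

theorem exists_point (hτ : IsTransform τ) (hQ : IsHadamard Q) (p q : Q) {t : ℝ}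
    (ht : t ∈ Icc (0 : ℝ) 1) :
    ∃ c : Q, ∀ (y : Q) (κ : ℝ), 0 ≤ κ →
      ENNReal.ofReal κ ≤ ddtran τ (max (dist y p) (dist y q)) →
      τ (dist y c) ≤ (1 - t) * τ (dist y p) + t * τ (dist y q)
        - t * (1 - t) / 2 * κ * dist p q ^ 2 := by
  obtain ⟨c, hc⟩ := hQ.exists_point p q ht
  refine ⟨c, fun y κ hκ0 hκ => ?_⟩
  refine hτ.map_le_of_sq_le dist_nonneg dist_nonneg dist_nonneg ht.1 ht.2 hκ0 hκ ?_ (hc y)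
  rw [dist_comm y, dist_comm y]; exact abs_dist_sub_le _ _ _

theorem continuous_comp_dist (hτ : IsTransform τ) {X : Type*} [TopologicalSpace X] {u v : X → Q}
    (hu : Continuous u) (hv : Continuous v) : Continuous fun x => τ (dist (u x) (v x)) :=
  hτ.continuousOn.comp_continuous (hu.dist hv) fun _ => dist_nonneg

/-! ### Sample Fréchet means: variance inequality, stability, existence, uniqueness, continuity. -/

variable {n : ℕ}

/-- Minimality of `c` against the point a quarter of the way to `q` isolates the gain from uniform
convexity. Smaller parameters would bring `3 / 8` closer to `1 / 2`, but the constant `64` leaves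
room. -/
theorem sample_variance_inequality (hτ : IsTransform τ) (hQ : IsHadamard Q) {y : Fin n → Q}
    {c : Q} (hc : IsSampleFrechetMean τ y c) (q : Q) {κ : Fin n → ℝ} (hκ0 : ∀ i, 0 ≤ κ i)
    (hκ : ∀ i, ENNReal.ofReal (κ i) ≤ ddtran τ (max (dist (y i) c) (dist (y i) q))) :
    3 / 8 * (∑ i, κ i) * dist c q ^ 2 ≤ ∑ i, (τ (dist (y i) q) - τ (dist (y i) c)) := by
  obtain ⟨w, hw⟩ := hτ.exists_point hQ c q (t := 1 / 4) (by norm_num)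
  have h1 := hc w
  have h2 : ∑ i, τ (dist (y i) w) ≤ ∑ i, (3 / 4 * τ (dist (y i) c) + 1 / 4 * τ (dist (y i) q)
      - 3 / 32 * dist c q ^ 2 * κ i) := by
    refine Finset.sum_le_sum fun i _ => (hw (y i) (κ i) (hκ0 i) (hκ i)).trans_eq ?_
    ring
  rw [Finset.sum_sub_distrib, Finset.sum_add_distrib, ← Finset.mul_sum, ← Finset.mul_sum,
    ← Finset.mul_sum] at h2
  rw [Finset.sum_sub_distrib]
  linarith

/-- With `D = dist m c`, the quadruple inequality at `m, y i; m, c`, summed over `i`, and minimality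
of `c` give `n τ(D) ≤ 2 D ∑ τ'(d(y i, m))`. Then `D τ'(D) ≤ 2 τ(D)` removes the factor `D`. -/
theorem dist_sampleMean_le (hτ : IsTransform τ) (hlim : Tendsto (dtran τ) atTop atTop)
    (hQ : IsHadamard Q) (hn : 1 ≤ n) {y : Fin n → Q} {c : Q} (hc : IsSampleFrechetMean τ y c)
    (m : Q) : dist m c ≤ invDtran τ (4 * ((∑ i, dtran τ (dist (y i) m)) / n)) := by
  rcases (dist_nonneg (x := m) (y := c)).eq_or_lt with h | h
  · rw [← h]; exact invDtran_nonneg _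
  refine hτ.le_invDtran hlim ?_
  have hn0 : (0 : ℝ) < n := by exact_mod_cast hn
  have h1 : ∀ i, τ (dist m c) - (2 * dist m c * dtran τ (dist (y i) m))
      ≤ τ (dist (y i) c) - τ (dist (y i) m) := by
    intro i
    have := hτ.quadruple hQ m (y i) m c
    rw [dist_self, hτ.map_zero, dist_comm m (y i)] at this
    linarith
  have h2 := Finset.sum_le_sum fun i (_ : i ∈ Finset.univ) => h1 i
  have h3 := hc m
  rw [Finset.sum_sub_distrib, Finset.sum_sub_distrib, ← Finset.mul_sum, Finset.sum_const,
    Finset.card_univ, Fintype.card_fin, nsmul_eq_mul] at h2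
  have h4 := hτ.mul_dtran_le_two_mul h.le
  set s := ∑ i, dtran τ (dist (y i) m)
  have h5 : n * τ (dist m c) ≤ 2 * dist m c * s := by linarith
  rw [← mul_div_assoc, le_div_iff₀ hn0]
  refine le_of_mul_le_mul_left ?_ h
  nlinarith

/-- Stability of the sample Fréchet mean under the replacement of one observation. -/
theorem sample_stability (hτ : IsTransform τ) (hQ : IsHadamard Q) {y y' : Fin n → Q} {j : Fin n}
    (hyy' : ∀ i, i ≠ j → y' i = y i) {c c' : Q} (hc : IsSampleFrechetMean τ y c)
    (hc' : IsSampleFrechetMean τ y' c') {κ κ' : Fin n → ℝ} (hκ0 : ∀ i, 0 ≤ κ i)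
    (hκ : ∀ i, ENNReal.ofReal (κ i) ≤ ddtran τ (max (dist (y i) c) (dist (y i) c')))
    (hκ0' : ∀ i, 0 ≤ κ' i)
    (hκ' : ∀ i, ENNReal.ofReal (κ' i) ≤ ddtran τ (max (dist (y' i) c) (dist (y' i) c'))) :
    dist c c' * (∑ i, κ i + ∑ i, κ' i) ≤ 16 / 3 * dtran τ (dist (y j) (y' j)) := by
  rcases (dist_nonneg (x := c) (y := c')).eq_or_lt with h | h
  · rw [← h, zero_mul]
    have := hτ.dtran_nonneg (dist (y j) (y' j))
    positivity
  have h1 := hτ.sample_variance_inequality hQ hc c' hκ0 hκ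
  have h2 := hτ.sample_variance_inequality hQ hc' c hκ0' fun i => by
    rw [max_comm]; exact hκ' i
  -- The unchanged observations cancel in the sum of the two variance inequalities.
  have h3 : ∑ i, (τ (dist (y i) c') - τ (dist (y i) c))
      + ∑ i, (τ (dist (y' i) c) - τ (dist (y' i) c'))
      = τ (dist (y j) c') - τ (dist (y j) c) - τ (dist (y' j) c') + τ (dist (y' j) c) := by
    rw [← Finset.sum_add_distrib, Finset.sum_eq_single j]
    · ring
    · intro i _ hij
      rw [hyy' i hij]
      ring
    · simp
  have h4 := hτ.quadruple hQ (y j) (y' j) c c'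
  rw [dist_comm c' c] at h2
  refine le_of_mul_le_mul_left ?_ h
  linarith

/-- Direct method: `τ` grows at least linearly, so a minimizing sequence is bounded; on bounded sets
the curvature has a positive lower bound, and comparison with midpoints makes the sequence Cauchy.
-/
theorem exists_isSampleFrechetMean (hτ : IsTransform τ) (hlim : Tendsto (dtran τ) atTop atTop)
    (hQ : IsHadamard Q) (hn : 1 ≤ n) (y : Fin n → Q) : ∃ c, IsSampleFrechetMean τ y c := by
  have := hQ.complete
  let j : Fin n := ⟨0, hn⟩
  have hn0 : (0 : ℝ) < n := by exact_mod_cast hn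
  let φ : Q → ℝ := fun q => ∑ i, τ (dist (y i) q)
  have hterm : ∀ i q, 0 ≤ τ (dist (y i) q) := fun i q => hτ.nonneg dist_nonneg
  have hbdd : BddBelow (range φ) := ⟨0, by
    rintro _ ⟨q, rfl⟩
    exact Finset.sum_nonneg fun i _ => hterm i q⟩
  have : Nonempty Q := ⟨y j⟩
  set I := iInf φ with hI
  have hIle : ∀ q, I ≤ φ q := fun q => ciInf_le hbdd q
  have hseq : ∀ k : ℕ, ∃ q, φ q < I + 1 / ((k : ℝ) + 1) := fun k =>
    exists_lt_of_ciInf_lt (by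
      have : (0 : ℝ) < 1 / ((k : ℝ) + 1) := by positivity
      linarith)
  choose q hq using hseq
  have hf1 := hτ.dtran_pos one_pos
  set R₀ := 1 + 2 * (I + 1) / dtran τ 1 with hR₀
  have hR : ∀ k, dist (y j) (q k) ≤ R₀ := by
    intro k
    have hI0 : 0 ≤ I := le_ciInf fun q => Finset.sum_nonneg fun i _ => hterm i q
    rcases le_total (dist (y j) (q k)) 1 with h | h
    · have : 0 ≤ 2 * (I + 1) / dtran τ 1 := by positivity
      linarith
    · have h1 := hτ.mul_dtran_le_two_mul (dist_nonneg (x := y j) (y := q k))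
      have h2 := mul_le_mul_of_nonneg_left (hτ.monotone_dtran h)
        (dist_nonneg (x := y j) (y := q k))
      have h3 : τ (dist (y j) (q k)) ≤ φ (q k) :=
        Finset.single_le_sum (f := fun i => τ (dist (y i) (q k)))
          (fun i _ => hterm i _) (Finset.mem_univ j)
      have h4 : 1 / ((k : ℝ) + 1) ≤ 1 := by
        rw [div_le_one (by positivity)]
        have : (0 : ℝ) ≤ k := by positivity
        linarith
      have h5 : dist (y j) (q k) ≤ 2 * (I + 1) / dtran τ 1 := by
        rw [le_div_iff₀ hf1]
        linarith [hq k]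
      linarith
  set R := ∑ i, dist (y i) (y j) + |R₀| + 1 with hRdef
  have hR0 : 0 < R := by
    have : 0 ≤ ∑ i, dist (y i) (y j) := Finset.sum_nonneg fun _ _ => dist_nonneg
    positivity
  have hRi : ∀ i k, dist (y i) (q k) ≤ R := by
    intro i k
    have h1 := dist_triangle (y i) (y j) (q k)
    have h2 : dist (y i) (y j) ≤ ∑ i, dist (y i) (y j) :=
      Finset.single_le_sum (f := fun i => dist (y i) (y j))
        (fun _ _ => dist_nonneg) (Finset.mem_univ i)
    linarith [hR k, le_abs_self R₀]
  set κ := (ddtran τ R).toReal with hκ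
  have hκpos : 0 < κ := ENNReal.toReal_pos (hτ.ddtran_ne_zero hlim R) (ddtran_ne_top hR0)
  have hκle : ENNReal.ofReal κ = ddtran τ R := ENNReal.ofReal_toReal (ddtran_ne_top hR0)
  have hdist : ∀ k l, n * κ * dist (q k) (q l) ^ 2 ≤ 4 * (φ (q k) - I) + 4 * (φ (q l) - I) := by
    intro k l
    obtain ⟨w, hw⟩ := hτ.exists_point hQ (q k) (q l) (t := 1 / 2) (by norm_num)
    have h1 := hIle w
    have h2 : φ w ≤ ∑ i, (1 / 2 * τ (dist (y i) (q k)) + 1 / 2 * τ (dist (y i) (q l))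
        - 1 / 8 * κ * dist (q k) (q l) ^ 2) := by
      refine Finset.sum_le_sum fun i _ => (hw (y i) κ hκpos.le ?_).trans_eq (by ring)
      rw [hκle]
      exact hτ.antitone_ddtran (max_le (hRi i k) (hRi i l))
    rw [Finset.sum_sub_distrib, Finset.sum_add_distrib, ← Finset.mul_sum, ← Finset.mul_sum,
      Finset.sum_const, Finset.card_univ, Fintype.card_fin, nsmul_eq_mul] at h2
    simp only [φ] at h1 h2 ⊢
    linarith
  have hcau : CauchySeq q := by
    refine cauchySeq_of_le_tendsto_0 (fun N : ℕ => √(8 / (n * κ) * (1 / ((N : ℝ) + 1)))) ?_ ?_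
    · intro k l N hk hl
      refine Real.le_sqrt_of_sq_le ?_
      have h1 := hdist k l
      have hmono : ∀ {k : ℕ}, N ≤ k → φ (q k) - I ≤ 1 / ((N : ℝ) + 1) := by
        intro k hk
        have : 1 / ((k : ℝ) + 1) ≤ 1 / ((N : ℝ) + 1) := by gcongr
        linarith [hq k]
      have h2 : n * κ * dist (q k) (q l) ^ 2 ≤ 8 * (1 / ((N : ℝ) + 1)) := by
        linarith [hmono hk, hmono hl]
      rw [div_mul_eq_mul_div, le_div_iff₀ (by positivity)]
      linarith
    · have h1 : Tendsto (fun N : ℕ => 8 / (n * κ) * (1 / ((N : ℝ) + 1))) atTop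
          (𝓝 (8 / (n * κ) * 0)) := tendsto_one_div_add_atTop_nhds_zero_nat.const_mul _
      have h2 := (Real.continuous_sqrt.tendsto _).comp h1
      simpa [Function.comp_def] using h2
  obtain ⟨c, hc⟩ := cauchySeq_tendsto_of_complete hcau
  refine ⟨c, fun p => ?_⟩
  have hφ : Continuous φ := continuous_finsetSum _ fun i _ =>
    hτ.continuous_comp_dist continuous_const continuous_id
  have h1 : φ c ≤ I := by
    have h2 : Tendsto (fun k : ℕ => I + 1 / ((k : ℝ) + 1)) atTop (𝓝 (I + 0)) :=
      tendsto_one_div_add_atTop_nhds_zero_nat.const_add I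
    rw [add_zero] at h2
    exact le_of_tendsto_of_tendsto' ((hφ.tendsto c).comp hc) h2 fun k => (hq k).le
  exact h1.trans (hIle p)

/-- No observation coincides with both of two distinct minimizers, so all curvatures are finite and
positive and the variance inequality is strict. Uniqueness later identifies a given sample mean with
a continuous selection. -/
theorem isSampleFrechetMean_unique (hτ : IsTransform τ) (hlim : Tendsto (dtran τ) atTop atTop)
    (hQ : IsHadamard Q) (hn : 1 ≤ n) {y : Fin n → Q} {c c' : Q} (hc : IsSampleFrechetMean τ y c)
    (hc' : IsSampleFrechetMean τ y c') : c = c' := by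
  by_contra hne
  have hD : 0 < dist c c' := dist_pos.2 hne
  have hM : ∀ i, 0 < max (dist (y i) c) (dist (y i) c') := by
    intro i
    have := dist_triangle_left c c' (y i)
    rw [lt_max_iff]
    by_contra! h
    linarith
  let κ : Fin n → ℝ := fun i => (ddtran τ (max (dist (y i) c) (dist (y i) c'))).toReal
  have hκ : ∀ i, 0 < κ i := fun i =>
    ENNReal.toReal_pos (hτ.ddtran_ne_zero hlim _) (ddtran_ne_top (hM i))
  have h1 := hτ.sample_variance_inequality hQ hc c' (fun i => (hκ i).le) fun i => by
    rw [ENNReal.ofReal_toReal (ddtran_ne_top (hM i))]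
  have h2 := hc' c
  rw [Finset.sum_sub_distrib] at h1
  have : Nonempty (Fin n) := ⟨⟨0, hn⟩⟩
  have h3 : 0 < ∑ i, κ i := Finset.sum_pos (fun i _ => hκ i) Finset.univ_nonempty
  have h4 : 0 < 3 / 8 * (∑ i, κ i) * dist c c' ^ 2 := by positivity
  linarith

/-- The variance inequality at `z` bounds the squared displacement of the mean by a change of
losses, which is Lipschitz in the sample on bounded sets; the local modulus is a square root.
Measurability of everything built from sample means rests on this. -/
theorem continuous_sampleMean (hτ : IsTransform τ) (hlim : Tendsto (dtran τ) atTop atTop)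
    (hQ : IsHadamard Q) (hn : 1 ≤ n) {M : (Fin n → Q) → Q}
    (hM : ∀ y, IsSampleFrechetMean τ y (M y)) : Continuous M := by
  rw [continuous_iff_continuousAt]
  intro z
  have hn0 : (0 : ℝ) < n := by exact_mod_cast hn
  set c := M z with hc
  set R₀ := invDtran τ (4 * ((∑ i, dtran τ (dist (z i) c + 1)) / n)) with hR₀
  have hR₀0 : 0 ≤ R₀ := invDtran_nonneg _
  set R := ∑ i, dist (z i) c + R₀ + 1 with hR
  have hzi : ∀ i, dist (z i) c ≤ ∑ i, dist (z i) c := fun i =>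
    Finset.single_le_sum (f := fun i => dist (z i) c) (fun _ _ => dist_nonneg) (Finset.mem_univ i)
  have hR0 : 0 < R := by
    have : 0 ≤ ∑ i, dist (z i) c := Finset.sum_nonneg fun _ _ => dist_nonneg
    positivity
  set κ := (ddtran τ R).toReal with hκ
  have hκpos : 0 < κ := ENNReal.toReal_pos (hτ.ddtran_ne_zero hlim R) (ddtran_ne_top hR0)
  have hκle : ENNReal.ofReal κ = ddtran τ R := ENNReal.ofReal_toReal (ddtran_ne_top hR0)
  set C := 16 / 3 * dtran τ R / κ with hC
  have key : ∀ z', dist z' z ≤ 1 → dist (M z') c ≤ √(C * dist z' z) := by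
    intro z' hz'
    have hzz : ∀ i, dist (z' i) (z i) ≤ dist z' z := fun i => dist_le_pi_dist z' z i
    have hzc : ∀ i, dist (z' i) c ≤ dist (z i) c + 1 := fun i =>
      (dist_triangle (z' i) (z i) c).trans (by linarith [hzz i])
    have hD : dist c (M z') ≤ R₀ := by
      refine (hτ.dist_sampleMean_le hlim hQ hn (hM z') c).trans
        (hτ.monotone_invDtran hlim ?_)
      have : ∑ i, dtran τ (dist (z' i) c) ≤ ∑ i, dtran τ (dist (z i) c + 1) :=
        Finset.sum_le_sum fun i _ => hτ.monotone_dtran (hzc i)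
      gcongr
    have h1 := hτ.sample_variance_inequality hQ (hM z) (M z') (κ := fun _ => κ)
      (fun _ => hκpos.le) fun i => by
        rw [hκle]
        refine hτ.antitone_ddtran (max_le ?_ ?_)
        · linarith [hzi i]
        · linarith [hzi i, dist_triangle (z i) c (M z')]
    have h2 := hM z' c
    rw [← sub_nonneg, ← Finset.sum_sub_distrib] at h2
    have h3 : ∀ i, (τ (dist (z i) (M z')) - τ (dist (z i) c))
        + (τ (dist (z' i) c) - τ (dist (z' i) (M z'))) ≤ 2 * (dist z' z * dtran τ R) := by
      intro i
      have a1 := (abs_le.1 (hτ.abs_sub_le (M := R) (dist_nonneg (x := z i) (y := M z'))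
        (dist_nonneg (x := z' i) (y := M z'))
        (by linarith [hzi i, dist_triangle (z i) c (M z')])
        (by linarith [hzi i, dist_triangle (z' i) c (M z'), hzc i]))).2
      have a2 := (abs_le.1 (hτ.abs_sub_le (M := R) (dist_nonneg (x := z' i) (y := c))
        (dist_nonneg (x := z i) (y := c)) (by linarith [hzi i, hzc i])
        (by linarith [hzi i]))).2
      have b1 : |dist (z i) (M z') - dist (z' i) (M z')| ≤ dist z' z :=
        (abs_dist_sub_le _ _ _).trans ((dist_comm _ _).trans_le (hzz i))
      have b2 : |dist (z' i) c - dist (z i) c| ≤ dist z' z :=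
        (abs_dist_sub_le _ _ _).trans (hzz i)
      have c1 := mul_le_mul_of_nonneg_right b1 (hτ.dtran_nonneg R)
      have c2 := mul_le_mul_of_nonneg_right b2 (hτ.dtran_nonneg R)
      linarith
    have h4 := Finset.sum_le_sum fun i (_ : i ∈ Finset.univ) => h3 i
    rw [Finset.sum_add_distrib, Finset.sum_const, Finset.card_univ, Fintype.card_fin,
      nsmul_eq_mul] at h4
    rw [Finset.sum_const, Finset.card_univ, Fintype.card_fin, nsmul_eq_mul] at h1
    refine Real.le_sqrt_of_sq_le ?_
    rw [hC, div_mul_eq_mul_div, le_div_iff₀ hκpos, dist_comm (M z')]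
    refine le_of_mul_le_mul_left ?_ hn0
    linarith
  rw [ContinuousAt, tendsto_iff_dist_tendsto_zero]
  have h0 : Tendsto (fun z' => √(C * dist z' z)) (𝓝 z) (𝓝 0) := by
    have : Continuous fun z' => √(C * dist z' z) := by fun_prop
    simpa using this.tendsto z
  refine squeeze_zero' (Eventually.of_forall fun _ => dist_nonneg) ?_ h0
  filter_upwards [Metric.closedBall_mem_nhds z one_pos] with z' hz'
  exact key z' hz'

end IsTransform

end Hadamard

/-! ### Independence under product measures and two tail bounds. -/

section Product

variable {T I K : Type*} [MeasurableSpace T] [Fintype I] [Fintype K] {μ : Measure T}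
  [IsProbabilityMeasure μ]

theorem iIndepFun_eval_pi : iIndepFun (fun (i : I) (x : I → T) => x i) (Measure.pi fun _ => μ) :=
  iIndepFun_pi (μ := fun _ : I => μ) (X := fun _ => id) fun _ => aemeasurable_id

theorem measurePreserving_comp_pi {e : K → I} (he : Function.Injective e) :
    MeasurePreserving (fun (x : I → T) (k : K) => x (e k)) (Measure.pi fun _ => μ)
      (Measure.pi fun _ => μ) := by
  refine ⟨by fun_prop, ?_⟩
  have h : iIndepFun (fun (k : K) (x : I → T) => x (e k)) (Measure.pi fun _ => μ) :=
    (iIndepFun_eval_pi (μ := μ)).precomp he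
  rw [(iIndepFun_iff_map_fun_eq_pi_map fun k => (measurable_pi_apply (e k)).aemeasurable).1 h]
  congr
  funext k
  exact (measurePreserving_eval (fun _ : I => μ) (e k)).map_eq

theorem lintegral_eval_pi {A : T → ℝ≥0∞} (hA : Measurable A) (i : I) :
    ∫⁻ x, A (x i) ∂(Measure.pi fun _ : I => μ) = ∫⁻ t, A t ∂μ :=
  (measurePreserving_eval (fun _ : I => μ) i).lintegral_comp hA

/-- The range of `e` avoids `j`, so the two factors are independent. This is applied to the ghost
against the sample and to an observation against the exchanged sample. -/
theorem lintegral_eval_mul_comp_pi {A : T → ℝ≥0∞} {B : (K → T) → ℝ≥0∞} (hA : Measurable A)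
    (hB : Measurable B) {e : K → I} (he : Function.Injective e) {j : I} (hj : ∀ k, e k ≠ j) :
    ∫⁻ x, A (x j) * B (fun k => x (e k)) ∂(Measure.pi fun _ : I => μ)
      = (∫⁻ t, A t ∂μ) * ∫⁻ y, B y ∂(Measure.pi fun _ : K => μ) := by
  classical
  have h := (iIndepFun_eval_pi (μ := μ) (I := I)).indepFun_finset {j} {j}ᶜ
    (Finset.disjoint_left.2 fun a ha => by simpa using ha) (fun i => measurable_pi_apply i)
  have hA' : Measurable fun y : (({j} : Finset I) → T) => A (y ⟨j, by simp⟩) :=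
    hA.comp (measurable_pi_apply _)
  have hB' : Measurable fun y : ((({j} : Finset I)ᶜ : Finset I) → T) =>
      B fun k => y ⟨e k, by simpa using hj k⟩ :=
    hB.comp (measurable_pi_lambda _ fun k => measurable_pi_apply _)
  have h2 := h.comp hA' hB'
  have h3 := lintegral_mul_eq_lintegral_mul_lintegral_of_indepFun
    (hA.comp (measurable_pi_apply j)) (hB.comp
      (measurable_pi_lambda _ fun k => measurable_pi_apply (e k))) h2
  simp only [Pi.mul_apply, Function.comp_apply] at h3
  rw [h3, lintegral_eval_pi hA, (measurePreserving_comp_pi he).lintegral_comp hB]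

theorem lintegral_eval_mul_eval_pi {A B : T → ℝ≥0∞} (hA : Measurable A) (hB : Measurable B)
    {i j : I} (hij : i ≠ j) :
    ∫⁻ x, A (x j) * B (x i) ∂(Measure.pi fun _ : I => μ) = (∫⁻ t, A t ∂μ) * ∫⁻ t, B t ∂μ := by
  have h := lintegral_eval_mul_comp_pi (μ := μ) (K := Unit) (B := fun y => B (y ())) hA
    (hB.comp (measurable_pi_apply _)) (e := fun _ => i) (Function.injective_of_subsingleton _)
    (j := j) fun _ => hij
  rw [h, lintegral_eval_pi hB]

/-- A Chernoff bound for the number of coordinates in a set of probability at least `1 / 2`. -/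
theorem measure_count_lt {s : Set T} (hs : MeasurableSet s) (hμs : 1 / 2 ≤ μ s) {n : ℕ}
    {e₁ e₂ : Fin n → I} (h₁ : Function.Injective e₁) (h₂ : Function.Injective e₂) :
    (Measure.pi fun _ : I => μ) {x | ∑ i, s.indicator (fun _ => (1 : ℝ)) (x (e₁ i))
        + ∑ i, s.indicator (fun _ => (1 : ℝ)) (x (e₂ i)) < n / 2}
      ≤ ENNReal.ofReal (Real.exp (-(n : ℝ) / 8)) := by
  set ψ : T → ℝ := s.indicator fun _ => (1 : ℝ) with hψ
  have hψm : Measurable ψ := measurable_const.indicator hs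
  let N : (Fin n → T) → ℝ := fun y => ∑ i, ψ (y i)
  have hNm : Measurable N := by fun_prop
  have hψe : ∀ t, Real.exp (-ψ t) = 1 - (1 - Real.exp (-1)) * ψ t := by
    intro t
    by_cases ht : t ∈ s <;> simp [hψ, ht]
  have hψi : Integrable ψ μ := (integrable_const 1).indicator hs
  have hint : ∫ t, Real.exp (-ψ t) ∂μ = 1 - (1 - Real.exp (-1)) * μ.real s := by
    simp_rw [hψe]
    rw [integral_sub (integrable_const _) (hψi.const_mul _), integral_const_mul, hψ,
      integral_indicator hs]
    simp
  have hreal : 1 / 2 ≤ μ.real s := by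
    have := ENNReal.toReal_mono (measure_ne_top μ s) hμs
    simpa [Measure.real] using this
  have hint2 : ∫ t, Real.exp (-ψ t) ∂μ ≤ Real.exp (-3 / 8) := by
    have h1 : Real.exp (-1) ≤ 1 := Real.exp_le_one_iff.2 (by norm_num)
    -- The mean of `exp (-ψ)` is at most `(1 + e⁻¹) / 2 = e^(-1/2) cosh (1/2) ≤ e^(-1/2 + 1/8)`.
    have h2 := Real.cosh_le_exp_half_sq (1 / 2)
    have h3 : (1 + Real.exp (-1)) / 2 = Real.exp (-(1 / 2)) * Real.cosh (1 / 2) := by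
      rw [Real.cosh_eq, mul_div_assoc', mul_add, ← Real.exp_add, ← Real.exp_add]
      norm_num
    have h4 : Real.exp (-3 / 8) = Real.exp (-(1 / 2)) * Real.exp ((1 / 2) ^ 2 / 2) := by
      rw [← Real.exp_add]; norm_num
    have h5 := mul_le_mul_of_nonneg_left h2 (Real.exp_pos (-(1 / 2))).le
    rw [hint]
    nlinarith
  have hint0 : 0 ≤ ∫ t, Real.exp (-ψ t) ∂μ := integral_nonneg fun t => (Real.exp_pos _).le
  have hNint : ∫⁻ y, ENNReal.ofReal (Real.exp (-N y)) ∂(Measure.pi fun _ : Fin n => μ)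
      ≤ ENNReal.ofReal (Real.exp (-3 / 8) ^ n) := by
    have hN0 : ∀ y, 0 ≤ N y := fun y => Finset.sum_nonneg fun i _ =>
      indicator_nonneg (fun _ _ => zero_le_one) _
    have hi : Integrable (fun y => Real.exp (-N y)) (Measure.pi fun _ : Fin n => μ) := by
      refine Integrable.mono' (integrable_const 1) (by fun_prop) (Eventually.of_forall fun y => ?_)
      rw [Real.norm_eq_abs, abs_of_pos (Real.exp_pos _)]
      exact Real.exp_le_one_iff.2 (by linarith [hN0 y])
    rw [← ofReal_integral_eq_lintegral_ofReal hi (Eventually.of_forall fun y => (Real.exp_pos _).le)]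
    refine ENNReal.ofReal_le_ofReal ?_
    have : (fun y => Real.exp (-N y)) = fun y => ∏ i, Real.exp (-ψ (y i)) := by
      funext y
      rw [← Real.exp_sum, Finset.sum_neg_distrib]
    rw [this, integral_fintype_prod_eq_pow fun t => Real.exp (-ψ t), Fintype.card_fin]
    exact pow_le_pow_left₀ hint0 hint2 n
  -- The two families may share coordinates, so their counts need not be independent; `exp (-(a + b)
  -- / 2) ≤ (exp (-a) + exp (-b)) / 2` separates them all the same.
  let G : (I → T) → ℝ≥0∞ := fun x => ENNReal.ofReal (Real.exp (n / 4) / 2)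
    * (ENNReal.ofReal (Real.exp (-N fun i => x (e₁ i)))
      + ENNReal.ofReal (Real.exp (-N fun i => x (e₂ i))))
  have hGm : Measurable G := by fun_prop
  have hsub : {x : I → T | ∑ i, ψ (x (e₁ i)) + ∑ i, ψ (x (e₂ i)) < n / 2} ⊆ {x | 1 ≤ G x} := by
    intro x hx
    have hx : N (fun i => x (e₁ i)) + N (fun i => x (e₂ i)) < n / 2 := hx
    simp only [mem_ofPred_eq, G]
    rw [← ENNReal.ofReal_add (Real.exp_pos _).le (Real.exp_pos _).le,
      ← ENNReal.ofReal_mul (by positivity), ENNReal.one_le_ofReal]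
    set a := N fun i => x (e₁ i)
    set b := N fun i => x (e₂ i)
    have h1 : Real.exp (-a / 2) ^ 2 = Real.exp (-a) := by
      rw [← Real.exp_nat_mul]; congr 1; push_cast; ring
    have h2 : Real.exp (-b / 2) ^ 2 = Real.exp (-b) := by
      rw [← Real.exp_nat_mul]; congr 1; push_cast; ring
    have h3 : 1 ≤ Real.exp (n / 4) * (Real.exp (-a / 2) * Real.exp (-b / 2)) := by
      rw [← Real.exp_add, ← Real.exp_add]
      exact Real.one_le_exp (by linarith)
    have h4 := two_mul_le_add_sq (Real.exp (-a / 2)) (Real.exp (-b / 2))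
    rw [h1, h2] at h4
    nlinarith [mul_le_mul_of_nonneg_left h4 (Real.exp_pos ((n : ℝ) / 4)).le]
  have hG : ∫⁻ x, G x ∂(Measure.pi fun _ : I => μ)
      ≤ ENNReal.ofReal (Real.exp (-(n : ℝ) / 8)) := by
    have hE : Measurable fun y : Fin n → T => ENNReal.ofReal (Real.exp (-N y)) := by fun_prop
    rw [lintegral_const_mul _ (by fun_prop), lintegral_add_left (by fun_prop),
      (measurePreserving_comp_pi h₁).lintegral_comp hE,
      (measurePreserving_comp_pi h₂).lintegral_comp hE]
    refine (mul_le_mul_right (add_le_add hNint hNint) _).trans_eq ?_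
    rw [← ENNReal.ofReal_add (by positivity) (by positivity), ← ENNReal.ofReal_mul (by positivity)]
    congr 1
    rw [← Real.exp_nat_mul]
    have : Real.exp (-(n : ℝ) / 8) = Real.exp (n / 4) * Real.exp (n * (-3 / 8)) := by
      rw [← Real.exp_add]; congr 1; ring
    rw [this]
    ring
  have := mul_meas_ge_le_lintegral (μ := Measure.pi fun _ : I => μ) hGm 1
  rw [one_mul] at this
  exact (measure_mono hsub).trans (this.trans hG)

/-- Chebyshev's inequality for the average of independent copies of a nonnegative variable. -/
theorem measure_two_mul_mean_lt {f : T → ℝ} (hf : Measurable f) (hf0 : ∀ t, 0 ≤ f t)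
    (hfi : Integrable f μ) {n : ℕ} (hn : 1 ≤ n) :
    (Measure.pi fun _ : Fin n => μ) {y | 2 * ∫ t, f t ∂μ < (∑ i, f (y i)) / n}
      ≤ (n : ℝ≥0∞)⁻¹ * ((∫⁻ t, ENNReal.ofReal (f t) ^ (2 : ℝ) ∂μ)
        / ENNReal.ofReal ((∫ t, f t ∂μ) ^ 2) - 1) := by
  set σ := ∫ t, f t ∂μ with hσ
  have hn0 : (0 : ℝ) < n := by exact_mod_cast hn
  have hσ0 : 0 ≤ σ := integral_nonneg hf0
  -- If the mean is zero, `f` vanishes almost everywhere and the event is null, whatever the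
  -- quotient on the right means.
  rcases hσ0.eq_or_lt with h0 | hpos
  · have h1 : f =ᵐ[μ] 0 := (integral_eq_zero_iff_of_nonneg hf0 hfi).1 (hσ ▸ h0.symm)
    have h2 : ∀ᵐ y ∂(Measure.pi fun _ : Fin n => μ), ∀ i, f (y i) = 0 := by
      rw [ae_all_iff]
      intro i
      exact (Measure.quasiMeasurePreserving_eval (fun _ : Fin n => μ) i).ae h1
    have h3 : (Measure.pi fun _ : Fin n => μ) {y | 2 * σ < (∑ i, f (y i)) / n} = 0 := by
      refine measure_mono_null (t := {y | ¬ ∀ i, f (y i) = 0}) (fun y hy hcon => ?_) h2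
      simp [hcon, ← h0] at hy
    rw [h3]
    exact zero_le
  have hofpos : ENNReal.ofReal (σ ^ 2) ≠ 0 := by simpa using hpos.ne'
  rcases eq_or_ne (∫⁻ t, ENNReal.ofReal (f t) ^ (2 : ℝ) ∂μ) ⊤ with htop | hfin
  · rw [htop, ENNReal.top_div_of_ne_top ENNReal.ofReal_ne_top, ENNReal.top_sub ENNReal.one_ne_top,
      ENNReal.mul_top (by simp)]
    exact le_top
  have hsq : ∀ t, ENNReal.ofReal (f t) ^ (2 : ℝ) = ENNReal.ofReal (f t ^ 2) := by
    intro t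
    rw [ENNReal.rpow_two, ENNReal.ofReal_pow (hf0 t)]
  simp_rw [hsq] at hfin ⊢
  have hf2 : Integrable (fun t => f t ^ 2) μ := by
    refine ⟨by fun_prop, ?_⟩
    rw [hasFiniteIntegral_iff_ofReal (Eventually.of_forall fun t => sq_nonneg _)]
    exact lt_top_iff_ne_top.2 hfin
  have hmem : MemLp f 2 μ := (memLp_two_iff_integrable_sq hf.aestronglyMeasurable).2 hf2
  have hmemi : ∀ i : Fin n, MemLp (fun y : Fin n → T => f (y i)) 2 (Measure.pi fun _ => μ) :=
    fun i => hmem.comp_measurePreserving (measurePreserving_eval (fun _ : Fin n => μ) i)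
  have hvari : ∀ i : Fin n, variance (fun y : Fin n → T => f (y i)) (Measure.pi fun _ => μ)
      = ∫ t, f t ^ 2 ∂μ - σ ^ 2 := by
    intro i
    rw [variance_eq_sub (hmemi i)]
    congr 1
    · exact integral_comp_eval (μ := fun _ : Fin n => μ) hf2.aestronglyMeasurable
    · congr 1
      exact integral_comp_eval (μ := fun _ : Fin n => μ) hf.aestronglyMeasurable
  let X : Fin n → (Fin n → T) → ℝ := fun i y => f (y i)
  have hvar : variance (∑ i, X i) (Measure.pi fun _ => μ) = n * (∫ t, f t ^ 2 ∂μ - σ ^ 2) := by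
    rw [IndepFun.variance_sum fun i _ => hmemi i]
    · rw [Finset.sum_congr rfl fun i _ => hvari i]
      simp [mul_sub]
    · intro i _ j _ hij
      have hI : iIndepFun X (Measure.pi fun _ => μ) :=
        iIndepFun_pi (μ := fun _ : Fin n => μ) (X := fun _ => f) fun _ => hf.aemeasurable
      exact hI.indepFun hij
  have hmean : ∫ y, (∑ i, X i) y ∂(Measure.pi fun _ : Fin n => μ) = n * σ := by
    simp only [Finset.sum_apply]
    rw [integral_finsetSum _ fun i _ => (hmemi i).integrable (by norm_num)]
    have : ∀ i, ∫ y, X i y ∂(Measure.pi fun _ : Fin n => μ) = σ := fun i =>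
      integral_comp_eval (μ := fun _ : Fin n => μ) hf.aestronglyMeasurable
    rw [Finset.sum_congr rfl fun i _ => this i]
    simp
  have hcheb := meas_ge_le_variance_div_sq (memLp_finsetSum' Finset.univ fun i _ => hmemi i :
    MemLp (∑ i, X i) 2 (Measure.pi fun _ => μ)) (mul_pos hn0 hpos)
  refine (measure_mono fun y hy => ?_).trans (hcheb.trans ?_)
  · simp only [mem_ofPred_eq] at hy ⊢
    rw [hmean]
    refine le_trans ?_ (le_abs_self _)
    rw [lt_div_iff₀ hn0] at hy
    simp only [Finset.sum_apply, X]
    linarith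
  · rw [hvar, ← ofReal_integral_eq_lintegral_ofReal hf2 (Eventually.of_forall fun t => sq_nonneg _),
      ← ENNReal.ofReal_div_of_pos (by positivity), ← ENNReal.ofReal_one,
      ← ENNReal.ofReal_sub _ zero_le_one, ← ENNReal.ofReal_natCast n,
      ← ENNReal.ofReal_inv_of_pos hn0, ← ENNReal.ofReal_mul (by positivity)]
    refine ENNReal.ofReal_le_ofReal (le_of_eq ?_)
    field_simp

end Product

/-- The inequality between the harmonic and the arithmetic mean. -/
theorem card_div_sum_le {ι : Type*} (s : Finset ι) (hs : s.Nonempty) (κ : ι → ℝ≥0∞) :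
    (s.card : ℝ≥0∞) / ∑ i ∈ s, κ i ≤ (∑ i ∈ s, (κ i)⁻¹) / s.card := by
  have hc : (s.card : ℝ≥0∞) ≠ 0 := by simpa using hs.ne_empty
  by_cases h0 : ∃ i ∈ s, κ i = 0
  · obtain ⟨i, hi, hκ⟩ := h0
    have : ∑ i ∈ s, (κ i)⁻¹ = ⊤ := ENNReal.sum_eq_top.2 ⟨i, hi, by simp [hκ]⟩
    rw [this, ENNReal.top_div_of_ne_top (by simp)]
    exact le_top
  by_cases ht : ∃ i ∈ s, κ i = ⊤
  · have : ∑ i ∈ s, κ i = ⊤ := ENNReal.sum_eq_top.2 ht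
    simp [this]
  push Not at h0 ht
  have hpos : ∀ i ∈ s, 0 < (κ i).toReal := fun i hi => ENNReal.toReal_pos (h0 i hi) (ht i hi)
  have h1 : ∑ i ∈ s, κ i = ENNReal.ofReal (∑ i ∈ s, (κ i).toReal) := by
    rw [ENNReal.ofReal_sum_of_nonneg fun i hi => (hpos i hi).le]
    exact Finset.sum_congr rfl fun i hi => (ENNReal.ofReal_toReal (ht i hi)).symm
  have h2 : ∑ i ∈ s, (κ i)⁻¹ = ENNReal.ofReal (∑ i ∈ s, (κ i).toReal⁻¹) := by
    rw [ENNReal.ofReal_sum_of_nonneg fun i hi => (inv_pos.2 (hpos i hi)).le]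
    refine Finset.sum_congr rfl fun i hi => ?_
    rw [ENNReal.ofReal_inv_of_pos (hpos i hi), ENNReal.ofReal_toReal (ht i hi)]
  have hcpos : (0 : ℝ) < s.card := by exact_mod_cast hs.card_pos
  have hsum : 0 < ∑ i ∈ s, (κ i).toReal := Finset.sum_pos hpos hs
  rw [h1, h2, ← ENNReal.ofReal_natCast, ← ENNReal.ofReal_div_of_pos hsum,
    ← ENNReal.ofReal_div_of_pos hcpos]
  refine ENNReal.ofReal_le_ofReal ?_
  rw [div_le_div_iff₀ hsum hcpos]
  have := Finset.sum_sq_le_sum_mul_sum_of_sq_le_mul s (r := fun _ => (1 : ℝ))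
    (f := fun i => (κ i).toReal⁻¹) (g := fun i => (κ i).toReal)
    (fun i hi => (inv_pos.2 (hpos i hi)).le) (fun i hi => (hpos i hi).le)
    (fun i hi => by rw [one_pow, inv_mul_cancel₀ (hpos i hi).ne'])
  simp only [Finset.sum_const, nsmul_eq_mul, mul_one] at this
  linarith

theorem ofReal_integral_le_lintegral {α : Type*} [MeasurableSpace α] {ν : Measure α} {f : α → ℝ}
    (hf : Integrable f ν) : ENNReal.ofReal (∫ a, f a ∂ν) ≤ ∫⁻ a, ENNReal.ofReal (f a) ∂ν := by
  have h1 : ∫ a, f a ∂ν ≤ ∫ a, max (f a) 0 ∂ν :=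
    integral_mono hf hf.pos_part fun a => le_max_left _ _
  refine (ENNReal.ofReal_le_ofReal h1).trans ?_
  rw [ofReal_integral_eq_lintegral_ofReal hf.pos_part (Eventually.of_forall fun a => le_max_right _ _)]
  simp

/-! ### Exchanging an observation with a ghost copy. -/

section Exchange

variable {Q T : Type*} [MetricSpace Q] {n : ℕ}

/-- Exchange the ghost observation `x 0` with the `j`-th observation `x j.succ`. -/
def exchange (j : Fin n) (x : Fin (n + 1) → T) : Fin (n + 1) → T :=
  fun i => x (Equiv.swap 0 j.succ i)

/-- The sample mean of the observations `x 1, …, x n`, given a selection `M` of sample means. -/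
def sampleMean (ι : T → Q) (M : (Fin n → Q) → Q) (x : Fin (n + 1) → T) : Q :=
  M fun i => ι (x i.succ)

/-- The empirical first moment `n⁻¹ ∑ⱼ τ'(d(yⱼ, m))`. -/
def empMoment (τ : ℝ → ℝ) (ι : T → Q) (m : Q) (y : Fin n → T) : ℝ :=
  (∑ i : Fin n, dtran τ (dist (ι (y i)) m)) / n

/-- The curvature of the loss at the `i`-th observation between the means of the sample and of
the exchanged sample. -/
def curv (τ : ℝ → ℝ) (ι : T → Q) (M : (Fin n → Q) → Q) (j i : Fin n) (x : Fin (n + 1) → T) :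
    ℝ≥0∞ :=
  ddtran τ (max (dist (ι (x i.succ)) (sampleMean ι M x))
    (dist (ι (x i.succ)) (sampleMean ι M (exchange j x))))

/-- The total curvature over the sample and the exchanged sample. -/
def curvSum (τ : ℝ → ℝ) (ι : T → Q) (M : (Fin n → Q) → Q) (j : Fin n) (x : Fin (n + 1) → T) :
    ℝ≥0∞ :=
  ∑ i : Fin n, curv τ ι M j i x + ∑ i : Fin n, curv τ ι M j i (exchange j x)

/-- The reciprocal of the average curvature over the sample and the exchanged sample. -/
def invCurv (τ : ℝ → ℝ) (ι : T → Q) (M : (Fin n → Q) → Q) (j : Fin n) (x : Fin (n + 1) → T) :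
    ℝ≥0∞ :=
  2 * n / curvSum τ ι M j x

/-- A transform with unbounded derivative, observations `ι t` in a Hadamard space, and a selection
`M` of sample means of `n` points. -/
structure SampleSetting (τ : ℝ → ℝ) (ι : T → Q) (M : (Fin n → Q) → Q) : Prop where
  isTransform : IsTransform τ
  tendsto_dtran : Tendsto (dtran τ) atTop atTop
  isHadamard : IsHadamard Q
  one_le : 1 ≤ n
  isMean : ∀ y, IsSampleFrechetMean τ y (M y)

@[simp]
theorem exchange_exchange (j : Fin n) (x : Fin (n + 1) → T) : exchange j (exchange j x) = x := by
  funext i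
  simp [exchange]

@[simp]
theorem exchange_zero (j : Fin n) (x : Fin (n + 1) → T) : exchange j x 0 = x j.succ := by
  simp [exchange]

@[simp]
theorem exchange_succ_self (j : Fin n) (x : Fin (n + 1) → T) : exchange j x j.succ = x 0 := by
  simp [exchange]

theorem exchange_succ_of_ne {i j : Fin n} (hij : i ≠ j) (x : Fin (n + 1) → T) :
    exchange j x i.succ = x i.succ := by
  rw [exchange, Equiv.swap_apply_of_ne_of_ne (Fin.succ_ne_zero i)]
  simpa using hij

theorem invCurv_exchange (τ : ℝ → ℝ) (ι : T → Q) (M : (Fin n → Q) → Q) (j : Fin n)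
    (x : Fin (n + 1) → T) : invCurv τ ι M j (exchange j x) = invCurv τ ι M j x := by
  rw [invCurv, invCurv, curvSum, curvSum, exchange_exchange, add_comm]

variable {τ : ℝ → ℝ} {ι : T → Q} {M : (Fin n → Q) → Q}

theorem empMoment_nonneg (hτ : IsTransform τ) (ι : T → Q) (m : Q) (y : Fin n → T) :
    0 ≤ empMoment τ ι m y :=
  div_nonneg (Finset.sum_nonneg fun _ _ => hτ.dtran_nonneg _) (Nat.cast_nonneg n)

/-- The samples differ in one observation only. The right side isolates the contribution of `x
j.succ`, while the exchanged sample does not contain it; this is what makes independence usable. -/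
theorem empMoment_le_exchange (hτ : IsTransform τ) (ι : T → Q) (m : Q) (j : Fin n)
    (x : Fin (n + 1) → T) :
    empMoment τ ι m (fun i : Fin n => x i.succ) ≤ (n : ℝ)⁻¹ * dtran τ (dist (ι (x j.succ)) m)
      + empMoment τ ι m (fun i : Fin n => exchange j x i.succ) := by
  have h1 : ∑ i : Fin n, dtran τ (dist (ι (x i.succ)) m) ≤ dtran τ (dist (ι (x j.succ)) m)
      + ∑ i : Fin n, dtran τ (dist (ι (exchange j x i.succ)) m) := by
    rw [← Finset.add_sum_erase _ _ (Finset.mem_univ j),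
      ← Finset.add_sum_erase Finset.univ (fun i => dtran τ (dist (ι (exchange j x i.succ)) m))
        (Finset.mem_univ j)]
    have h2 : ∑ i ∈ Finset.univ.erase j, dtran τ (dist (ι (x i.succ)) m)
        = ∑ i ∈ Finset.univ.erase j, dtran τ (dist (ι (exchange j x i.succ)) m) :=
      Finset.sum_congr rfl fun i hi => by rw [exchange_succ_of_ne (Finset.ne_of_mem_erase hi)]
    rw [h2]
    have := hτ.dtran_nonneg (dist (ι (exchange j x j.succ)) m)
    linarith
  rw [empMoment, empMoment, inv_mul_eq_div, ← add_div]
  gcongr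

namespace SampleSetting

theorem dist_sampleMean_le (hs : SampleSetting τ ι M) (m : Q) (x : Fin (n + 1) → T) :
    dist m (sampleMean ι M x) ≤ invDtran τ (4 * empMoment τ ι m fun i : Fin n => x i.succ) :=
  hs.isTransform.dist_sampleMean_le hs.tendsto_dtran hs.isHadamard hs.one_le (hs.isMean _) m

theorem curvSum_ne_zero (hs : SampleSetting τ ι M) (j : Fin n) (x : Fin (n + 1) → T) :
    curvSum τ ι M j x ≠ 0 := by
  intro h
  rw [curvSum, add_eq_zero, Finset.sum_eq_zero_iff] at h
  exact hs.isTransform.ddtran_ne_zero hs.tendsto_dtran _ (h.1 j (Finset.mem_univ j))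

/-- With total curvature `K`, the constant arises from `16 / (3 K) = 8 / (3 n) * (2 n / K)`. If the
two means differ, no observation is at distance zero from both, so all curvatures are finite. -/
theorem stability (hs : SampleSetting τ ι M) (j : Fin n) (x : Fin (n + 1) → T) :
    ENNReal.ofReal (dist (sampleMean ι M x) (sampleMean ι M (exchange j x))
        * dtran τ (dist (ι (x j.succ)) (ι (x 0))))
      ≤ ENNReal.ofReal (8 / (3 * n)) * (ENNReal.ofReal (dtran τ (dist (ι (x j.succ)) (ι (x 0)))
        ^ 2) * invCurv τ ι M j x) := by
  set c := sampleMean ι M x with hc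
  set c' := sampleMean ι M (exchange j x) with hc'
  set f := dtran τ (dist (ι (x j.succ)) (ι (x 0))) with hf
  have hf0 : 0 ≤ f := hs.isTransform.dtran_nonneg _
  have hn0 : (0 : ℝ) < n := by exact_mod_cast hs.one_le
  rcases (dist_nonneg (x := c) (y := c')).eq_or_lt with h | hD
  · rw [← h]; simp
  have hfin : ∀ y : Q, ddtran τ (max (dist y c) (dist y c')) ≠ ⊤ := by
    intro y
    refine ddtran_ne_top ?_
    have := dist_triangle_left c c' y
    rw [lt_max_iff]
    by_contra! h
    linarith
  have h1 : ∀ i, curv τ ι M j i x ≠ ⊤ := fun i => hfin _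
  have h2 : ∀ i, curv τ ι M j i (exchange j x) ≠ ⊤ := fun i => by
    rw [curv, exchange_exchange, max_comm]; exact hfin _
  have hst := hs.isTransform.sample_stability hs.isHadamard (j := j)
    (y := fun i => ι (x i.succ)) (y' := fun i => ι (exchange j x i.succ))
    (fun i hi => by rw [exchange_succ_of_ne hi]) (hs.isMean _) (hs.isMean _)
    (κ := fun i => (curv τ ι M j i x).toReal)
    (κ' := fun i => (curv τ ι M j i (exchange j x)).toReal) (fun i => ENNReal.toReal_nonneg)
    (fun i => ENNReal.ofReal_toReal_le) (fun i => ENNReal.toReal_nonneg)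
    (fun i => by
      refine ENNReal.ofReal_toReal_le.trans_eq ?_
      rw [curv, exchange_exchange, max_comm]
      rfl)
  simp only [exchange_succ_self] at hst
  set K := ∑ i : Fin n, (curv τ ι M j i x).toReal + ∑ i : Fin n, (curv τ ι M j i (exchange j x)).toReal with hK
  have hKeq : curvSum τ ι M j x = ENNReal.ofReal K := by
    rw [curvSum, hK, ENNReal.ofReal_add (Finset.sum_nonneg fun i _ => ENNReal.toReal_nonneg)
      (Finset.sum_nonneg fun i _ => ENNReal.toReal_nonneg),
      ENNReal.ofReal_sum_of_nonneg fun i _ => ENNReal.toReal_nonneg,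
      ENNReal.ofReal_sum_of_nonneg fun i _ => ENNReal.toReal_nonneg]
    congr 1
    · exact Finset.sum_congr rfl fun i _ => (ENNReal.ofReal_toReal (h1 i)).symm
    · exact Finset.sum_congr rfl fun i _ => (ENNReal.ofReal_toReal (h2 i)).symm
  have hKpos : 0 < K := by
    have := hs.curvSum_ne_zero j x
    rw [hKeq, Ne, ENNReal.ofReal_eq_zero, not_le] at this
    exact this
  have h2n : (2 * n : ℝ≥0∞) = ENNReal.ofReal (2 * n) := by
    rw [ENNReal.ofReal_mul zero_le_two]; simp
  rw [invCurv, hKeq, h2n, ← ENNReal.ofReal_div_of_pos hKpos, ← ENNReal.ofReal_mul (by positivity),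
    ← ENNReal.ofReal_mul (by positivity)]
  refine ENNReal.ofReal_le_ofReal ?_
  have h3 : dist c c' ≤ 16 / 3 * f / K := (le_div_iff₀ hKpos).2 hst
  calc dist c c' * f ≤ 16 / 3 * f / K * f := by gcongr
    _ = _ := by field_simp; ring

/-- Both distances are at most `dist y m + R`, hence at most twice the larger summand, well within
the factor `7` in `g`. -/
theorem inv_ddtran_le (hτ : IsTransform τ) {y c c' m : Q} {R : ℝ} (hc : dist m c ≤ R)
    (hc' : dist m c' ≤ R) :
    (ddtran τ (max (dist y c) (dist y c')))⁻¹ ≤ max (g τ (dist y m)) (g τ R) := by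
  rw [← hτ.monotone_g.map_max, g]
  refine ENNReal.inv_le_inv.2 (hτ.antitone_ddtran ?_)
  have h0 : 0 ≤ R := dist_nonneg.trans hc
  have h1 := dist_triangle y m c
  have h2 := dist_triangle y m c'
  have h3 := le_max_left (dist y m) R
  have h4 := le_max_right (dist y m) R
  exact max_le (by linarith) (by linarith)

theorem h_max_le (hs : SampleSetting τ ι M) (m : Q) (j : Fin n) (x : Fin (n + 1) → T) :
    h τ (max (empMoment τ ι m fun i : Fin n => x i.succ) (empMoment τ ι m fun i : Fin n => exchange j x i.succ))
      ≤ max (h τ (2 * (n : ℝ)⁻¹ * dtran τ (dist (ι (x j.succ)) m)))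
        (h τ (2 * empMoment τ ι m fun i : Fin n => exchange j x i.succ)) := by
  have hmono := hs.isTransform.monotone_h hs.tendsto_dtran
  rw [← hmono.map_max]
  refine hmono ?_
  have h1 := empMoment_le_exchange hs.isTransform ι m j x
  have h2 := empMoment_nonneg hs.isTransform ι m fun i : Fin n => exchange j x i.succ
  set a := (n : ℝ)⁻¹ * dtran τ (dist (ι (x j.succ)) m)
  set b := empMoment τ ι m fun i : Fin n => exchange j x i.succ
  rw [mul_assoc]
  have h3 := le_max_left (2 * a) (2 * b)
  have h4 := le_max_right (2 * a) (2 * b)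
  exact max_le (by linarith) (by linarith)

theorem inv_curv_le (hs : SampleSetting τ ι M) (m : Q) (j i : Fin n) (x : Fin (n + 1) → T) :
    (curv τ ι M j i x)⁻¹ ≤ max (g τ (dist (ι (x i.succ)) m))
      (h τ (max (empMoment τ ι m fun i : Fin n => x i.succ)
        (empMoment τ ι m fun i : Fin n => exchange j x i.succ))) := by
  have h1 := empMoment_nonneg hs.isTransform ι m fun i : Fin n => x i.succ
  have h2 := empMoment_nonneg hs.isTransform ι m fun i : Fin n => exchange j x i.succ
  have hmono := hs.isTransform.monotone_invDtran hs.tendsto_dtran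
  refine inv_ddtran_le hs.isTransform ?_ ?_
  · refine (hs.dist_sampleMean_le m x).trans (hmono ?_)
    have := le_max_left (empMoment τ ι m fun i : Fin n => x i.succ)
      (empMoment τ ι m fun i : Fin n => exchange j x i.succ)
    linarith
  · refine (hs.dist_sampleMean_le m (exchange j x)).trans (hmono ?_)
    have := le_max_right (empMoment τ ι m fun i : Fin n => x i.succ)
      (empMoment τ ι m fun i : Fin n => exchange j x i.succ)
    linarith

theorem inv_curv_rpow_le (hs : SampleSetting τ ι M) (m : Q) (j i : Fin n) (x : Fin (n + 1) → T)
    {p : ℝ} (hp : 0 ≤ p) {H : ℝ≥0∞} (hH : h τ (max (empMoment τ ι m fun i : Fin n => x i.succ)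
        (empMoment τ ι m fun i : Fin n => exchange j x i.succ)) ^ p ≤ H) :
    (curv τ ι M j i x)⁻¹ ^ p ≤ g τ (dist (ι (x i.succ)) m) ^ p + H := by
  refine (ENNReal.rpow_le_rpow (hs.inv_curv_le m j i x) hp).trans ?_
  rw [(ENNReal.monotone_rpow_of_nonneg hp).map_max]
  exact max_le le_self_add (hH.trans le_add_self)

/-- `invCurv` is the harmonic mean of the `2 n` reciprocal curvatures, hence at most their
arithmetic mean, and Jensen moves the power inside. The part coming from `h` is common to all
indices. -/
theorem invCurv_rpow_le (hs : SampleSetting τ ι M) (m : Q) (j : Fin n) (x : Fin (n + 1) → T)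
    {p : ℝ} (hp : 1 ≤ p) :
    invCurv τ ι M j x ^ p ≤ (2 * n : ℝ≥0∞)⁻¹ * (∑ i : Fin n, g τ (dist (ι (x i.succ)) m) ^ p
        + ∑ i : Fin n, g τ (dist (ι (exchange j x i.succ)) m) ^ p)
      + (h τ (2 * (n : ℝ)⁻¹ * dtran τ (dist (ι (x j.succ)) m)) ^ p
        + h τ (2 * empMoment τ ι m fun i : Fin n => exchange j x i.succ) ^ p) := by
  have hp0 : 0 ≤ p := zero_le_one.trans hp
  set H := h τ (2 * (n : ℝ)⁻¹ * dtran τ (dist (ι (x j.succ)) m)) ^ p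
        + h τ (2 * empMoment τ ι m fun i : Fin n => exchange j x i.succ) ^ p with hHdef
  have hH : h τ (max (empMoment τ ι m fun i : Fin n => x i.succ)
      (empMoment τ ι m fun i : Fin n => exchange j x i.succ)) ^ p ≤ H := by
    refine (ENNReal.rpow_le_rpow (hs.h_max_le m j x) hp0).trans ?_
    rw [(ENNReal.monotone_rpow_of_nonneg hp0).map_max]
    exact max_le le_self_add le_add_self
  let κ : Fin n ⊕ Fin n → ℝ≥0∞ :=
    Sum.elim (fun i => curv τ ι M j i x) fun i => curv τ ι M j i (exchange j x)
  let G : Fin n ⊕ Fin n → ℝ≥0∞ := Sum.elim (fun i => g τ (dist (ι (x i.succ)) m) ^ p)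
    fun i => g τ (dist (ι (exchange j x i.succ)) m) ^ p
  have hcard : ((Finset.univ : Finset (Fin n ⊕ Fin n)).card : ℝ≥0∞) = 2 * n := by
    simp [two_mul]
  have hn : (n : ℝ≥0∞) ≠ 0 := by
    have := hs.one_le
    simp; omega
  have hw : ∑ _a : Fin n ⊕ Fin n, (2 * n : ℝ≥0∞)⁻¹ = 1 := by
    rw [Finset.sum_const, nsmul_eq_mul, hcard]
    exact ENNReal.mul_inv_cancel (by simp [hn]) (ENNReal.mul_ne_top (by simp) (by simp))
  have hκ : ∀ a, (κ a)⁻¹ ^ p ≤ G a + H := by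
    rintro (i | i)
    · exact hs.inv_curv_rpow_le m j i x hp0 hH
    · refine hs.inv_curv_rpow_le m j i (exchange j x) hp0 ?_
      rw [exchange_exchange, max_comm]
      exact hH
  have hne : (Finset.univ : Finset (Fin n ⊕ Fin n)).Nonempty := ⟨Sum.inl j, Finset.mem_univ _⟩
  have h1 : invCurv τ ι M j x ≤ ∑ a, (2 * n : ℝ≥0∞)⁻¹ * (κ a)⁻¹ := by
    have := card_div_sum_le Finset.univ hne κ
    rw [hcard, Fintype.sum_sum_type] at this
    refine (show invCurv τ ι M j x ≤ _ from this).trans_eq ?_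
    rw [← Finset.mul_sum, ENNReal.div_eq_inv_mul]
  calc invCurv τ ι M j x ^ p ≤ (∑ a, (2 * n : ℝ≥0∞)⁻¹ * (κ a)⁻¹) ^ p :=
        ENNReal.rpow_le_rpow h1 hp0
    _ ≤ ∑ a, (2 * n : ℝ≥0∞)⁻¹ * (κ a)⁻¹ ^ p :=
        ENNReal.rpow_arith_mean_le_arith_mean_rpow _ _ _ hw hp
    _ ≤ ∑ a, (2 * n : ℝ≥0∞)⁻¹ * (G a + H) := by gcongr with a _; exact hκ a
    _ = _ := by
        simp_rw [mul_add]
        rw [Finset.sum_add_distrib, ← Finset.sum_mul, hw, one_mul, ← Finset.mul_sum,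
          Fintype.sum_sum_type, mul_add]
        rfl

end SampleSetting

end Exchange

/-! ### Moment bounds for the inverse curvature. -/

section Sample

set_option linter.unusedSectionVars false

variable {Q T : Type*} [MetricSpace Q] [MetricSpace T] [SecondCountableTopology T]
  [MeasurableSpace T] [BorelSpace T] {n : ℕ} {τ : ℝ → ℝ} {ι : T → Q} {M : (Fin n → Q) → Q}
  {μ : Measure T} [IsProbabilityMeasure μ]

theorem injective_swap_succ (j : Fin n) :
    Function.Injective fun i : Fin n => Equiv.swap (0 : Fin (n + 1)) j.succ i.succ :=
  (Equiv.injective _).comp (Fin.succ_injective n)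

/-- The exchange moves `x j.succ` to the ghost position, so the exchanged sample is independent of
it. -/
theorem swap_succ_ne (i j : Fin n) : Equiv.swap (0 : Fin (n + 1)) j.succ i.succ ≠ j.succ := by
  intro h
  have := congrArg (Equiv.swap (0 : Fin (n + 1)) j.succ) h
  rw [Equiv.swap_apply_self, Equiv.swap_apply_right] at this
  exact Fin.succ_ne_zero i this

theorem measurePreserving_exchange (j : Fin n) :
    MeasurePreserving (exchange (T := T) j) (Measure.pi fun _ => μ) (Measure.pi fun _ => μ) :=
  measurePreserving_comp_pi (Equiv.injective _)

namespace IsTransform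

theorem continuous_dtran_dist (hτ : IsTransform τ) (hι : Continuous ι)
    (m : Q) : Continuous fun t => dtran τ (dist (ι t) m) :=
  hτ.continuous_dtran.comp (hι.dist continuous_const)

theorem measurable_dtran_dist (hτ : IsTransform τ) (hι : Continuous ι) (m : Q) :
    Measurable fun t => dtran τ (dist (ι t) m) :=
  (hτ.continuous_dtran_dist hι m).measurable

theorem measurable_empMoment (hτ : IsTransform τ) (hι : Continuous ι) (m : Q) :
    Measurable (empMoment (n := n) τ ι m) := by
  have := hτ.measurable_dtran_dist hι m
  exact (Finset.measurable_fun_sum _ fun i _ => this.comp (measurable_pi_apply i)).div_const _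

theorem measurable_g (hτ : IsTransform τ) : Measurable (g τ) := hτ.monotone_g.measurable

theorem measurable_h (hτ : IsTransform τ) (hlim : Tendsto (dtran τ) atTop atTop) :
    Measurable (h τ) := (hτ.monotone_h hlim).measurable

end IsTransform

namespace SampleSetting

theorem continuous_sampleMean (hs : SampleSetting τ ι M) (hι : Continuous ι) :
    Continuous (sampleMean ι M) :=
  (hs.isTransform.continuous_sampleMean hs.tendsto_dtran hs.isHadamard hs.one_le hs.isMean).comp
    (by fun_prop)

theorem continuous_exchange (j : Fin n) : Continuous (exchange (T := T) j) := by
  unfold exchange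
  fun_prop

theorem measurable_curv (hs : SampleSetting τ ι M) (hι : Continuous ι) (j i : Fin n) :
    Measurable (curv τ ι M j i) := by
  refine hs.isTransform.antitone_ddtran.measurable.comp (Continuous.measurable ?_)
  have h1 := hs.continuous_sampleMean hι
  have h2 := h1.comp (continuous_exchange j)
  have h3 : Continuous fun x : Fin (n + 1) → T => ι (x i.succ) := by fun_prop
  exact (h3.dist h1).max (h3.dist h2)

theorem measurable_invCurv (hs : SampleSetting τ ι M) (hι : Continuous ι) (j : Fin n) :
    Measurable (invCurv τ ι M j) := by
  have h1 := fun i => hs.measurable_curv hι j i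
  have h2 : Measurable (exchange (T := T) j) := (continuous_exchange j).measurable
  have h3 : Measurable (curvSum τ ι M j) := by
    unfold curvSum
    exact (Finset.measurable_fun_sum _ fun i _ => h1 i).add
      (Finset.measurable_fun_sum _ fun i _ => (h1 i).comp h2)
  exact measurable_const.div h3

/-- The moment bound for the inverse average curvature. -/
theorem lintegral_rpow_mul_invCurv_rpow_le (hs : SampleSetting τ ι M) (hι : Continuous ι) (m : Q)
    (j : Fin n) {p : ℝ} (hp : 1 ≤ p) {s : ℝ≥0∞}
    (hG : moment μ ι m (fun x => g τ x ^ p) ≤ s)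
    (hH : ∫⁻ y, h τ (2 * empMoment (n := n) τ ι m y) ^ p ∂(Measure.pi fun _ => μ) ≤ s) :
    ∫⁻ x, ENNReal.ofReal (dtran τ (dist (ι (x j.succ)) m)) ^ (2 * p) * invCurv τ ι M j x ^ p
        ∂(Measure.pi fun _ => μ)
      ≤ V n τ μ ι m p + 4 * powMoment τ μ ι m (2 * p) * s := by
  have hτ := hs.isTransform
  set A : T → ℝ≥0∞ := fun t => ENNReal.ofReal (dtran τ (dist (ι t) m)) ^ (2 * p) with hA
  set G : T → ℝ≥0∞ := fun t => g τ (dist (ι t) m) ^ p with hGdef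
  set H₁ : T → ℝ≥0∞ := fun t => h τ (2 * (n : ℝ)⁻¹ * dtran τ (dist (ι t) m)) ^ p with hH₁
  set H₂ : (Fin n → T) → ℝ≥0∞ := fun y => h τ (2 * empMoment τ ι m y) ^ p with hH₂
  have hf := hτ.measurable_dtran_dist hι m
  have hAm : Measurable A := hf.ennreal_ofReal.pow_const _
  have hGm : Measurable G :=
    (hτ.measurable_g.comp (hι.dist continuous_const).measurable).pow_const _
  have hhm := hτ.measurable_h hs.tendsto_dtran
  have hH₁m : Measurable H₁ := (hhm.comp (hf.const_mul _)).pow_const _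
  have hH₂m : Measurable H₂ :=
    (hhm.comp ((hτ.measurable_empMoment hι m).const_mul _)).pow_const _
  set σ := powMoment τ μ ι m (2 * p) with hσ
  have hσA : ∫⁻ t, A t ∂μ = σ := rfl
  set AG := ∫⁻ t, A t * G t ∂μ with hAG
  set AH := ∫⁻ t, A t * H₁ t ∂μ with hAH
  have hV : V n τ μ ι m p = (n : ℝ≥0∞)⁻¹ * AG + AH := rfl
  have hn : (n : ℝ≥0∞) ≠ 0 := by
    have := hs.one_le
    simp; omega
  set π := Measure.pi fun _ : Fin (n + 1) => μ with hπ
  have hpair : ∀ i : Fin (n + 1), i ≠ j.succ → ∫⁻ x, A (x j.succ) * G (x i) ∂π ≤ σ * s := by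
    intro i hi
    rw [lintegral_eval_mul_eval_pi hAm hGm hi, hσA]
    exact mul_le_mul_right hG _
  -- Only the diagonal term `i = j` fails to factorize; it produces the first summand of `V`.
  have h1 : ∑ i : Fin n, ∫⁻ x, A (x j.succ) * G (x i.succ) ∂π ≤ AG + n * (σ * s) := by
    calc ∑ i : Fin n, ∫⁻ x, A (x j.succ) * G (x i.succ) ∂π
        ≤ ∑ i : Fin n, ((if i = j then AG else 0) + σ * s) := by
          refine Finset.sum_le_sum fun i _ => ?_
          by_cases hij : i = j
          · subst hij
            rw [if_pos rfl, lintegral_eval_pi (A := fun t => A t * G t) (hAm.mul hGm)]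
            exact le_self_add
          · rw [if_neg hij, zero_add]
            exact hpair _ (by simpa using hij)
      _ = _ := by simp [Finset.sum_add_distrib]
  have h2 : ∑ i : Fin n, ∫⁻ x, A (x j.succ) * G (exchange j x i.succ) ∂π ≤ n * (σ * s) := by
    calc ∑ i : Fin n, ∫⁻ x, A (x j.succ) * G (exchange j x i.succ) ∂π
        ≤ ∑ _i : Fin n, σ * s := Finset.sum_le_sum fun i _ => hpair _ (swap_succ_ne i j)
      _ = _ := by simp
  have h3 : ∫⁻ x, A (x j.succ) * H₁ (x j.succ) ∂π = AH :=
    lintegral_eval_pi (A := fun t => A t * H₁ t) (hAm.mul hH₁m) _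
  have h4 : ∫⁻ x, A (x j.succ) * H₂ (fun i => exchange j x i.succ) ∂π ≤ σ * s := by
    refine (lintegral_eval_mul_comp_pi hAm hH₂m (injective_swap_succ j)
      fun i => swap_succ_ne i j).trans_le ?_
    rw [hσA]
    exact mul_le_mul_right hH _
  have hm1 : ∀ i : Fin n, Measurable fun x : Fin (n + 1) → T => A (x j.succ) * G (x i.succ) :=
    fun i => (hAm.comp (measurable_pi_apply _)).mul (hGm.comp (measurable_pi_apply _))
  have hm2 : ∀ i : Fin n, Measurable fun x : Fin (n + 1) → T =>
      A (x j.succ) * G (exchange j x i.succ) :=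
    fun i => (hAm.comp (measurable_pi_apply _)).mul (hGm.comp (measurable_pi_apply _))
  have hm3 : Measurable fun x : Fin (n + 1) → T => A (x j.succ) * H₁ (x j.succ) :=
    (hAm.comp (measurable_pi_apply _)).mul (hH₁m.comp (measurable_pi_apply _))
  have hm4 : Measurable fun x : Fin (n + 1) → T =>
      ∑ i : Fin n, A (x j.succ) * G (x i.succ)
        + ∑ i : Fin n, A (x j.succ) * G (exchange j x i.succ) :=
    (Finset.measurable_fun_sum _ fun i _ => hm1 i).add (Finset.measurable_fun_sum _ fun i _ => hm2 i)
  calc ∫⁻ x, A (x j.succ) * invCurv τ ι M j x ^ p ∂π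
      ≤ ∫⁻ x, (2 * n : ℝ≥0∞)⁻¹ * (∑ i : Fin n, A (x j.succ) * G (x i.succ)
          + ∑ i : Fin n, A (x j.succ) * G (exchange j x i.succ))
          + (A (x j.succ) * H₁ (x j.succ)
            + A (x j.succ) * H₂ fun i => exchange j x i.succ) ∂π := by
        refine lintegral_mono fun x => ?_
        refine (mul_le_mul_right (hs.invCurv_rpow_le m j x hp) _).trans_eq ?_
        rw [← Finset.mul_sum, ← Finset.mul_sum]
        ring
    _ = (2 * n : ℝ≥0∞)⁻¹ * (∑ i : Fin n, ∫⁻ x, A (x j.succ) * G (x i.succ) ∂π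
          + ∑ i : Fin n, ∫⁻ x, A (x j.succ) * G (exchange j x i.succ) ∂π)
          + (∫⁻ x, A (x j.succ) * H₁ (x j.succ) ∂π
            + ∫⁻ x, A (x j.succ) * H₂ (fun i => exchange j x i.succ) ∂π) := by
        rw [lintegral_add_left (hm4.const_mul _), lintegral_const_mul _ hm4,
          lintegral_add_left (Finset.measurable_fun_sum _ fun i _ => hm1 i),
          lintegral_finsetSum _ fun i _ => hm1 i, lintegral_finsetSum _ fun i _ => hm2 i,
          lintegral_add_left hm3]
    _ ≤ (2 * n : ℝ≥0∞)⁻¹ * (AG + n * (σ * s) + n * (σ * s)) + (AH + σ * s) := by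
        rw [h3]
        gcongr
    _ = (2 * n : ℝ≥0∞)⁻¹ * AG + (2 * n : ℝ≥0∞)⁻¹ * (2 * n) * (σ * s) + (AH + σ * s) := by ring
    _ ≤ (n : ℝ≥0∞)⁻¹ * AG + 1 * (σ * s) + (AH + σ * s) := by
        rw [ENNReal.inv_mul_cancel (by simp [hn]) (ENNReal.mul_ne_top (by simp) (by simp))]
        gcongr
        exact le_mul_of_one_le_left zero_le one_le_two
    _ = V n τ μ ι m p + 2 * σ * s := by rw [hV]; ring
    _ ≤ _ := by
        gcongr
        norm_num

/-- The integrability condition that makes the symmetrization argument work. -/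
theorem lintegral_sq_mul_h_ne_top (hs : SampleSetting τ ι M) (hι : Continuous ι) (m : Q)
    (j : Fin n) {p : ℝ} (hp : 1 ≤ p) {s : ℝ≥0∞}
    (hH : ∫⁻ y, h τ (2 * empMoment (n := n) τ ι m y) ^ p ∂(Measure.pi fun _ => μ) ≤ s)
    (hfin : V n τ μ ι m p + 4 * powMoment τ μ ι m (2 * p) * s ≠ ⊤) :
    ∫⁻ y, ENNReal.ofReal (dtran τ (dist (ι (y j)) m)) ^ (2 : ℝ) * h τ (empMoment τ ι m y)
        ∂(Measure.pi fun _ => μ) ≠ ⊤ := by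
  have hτ := hs.isTransform
  have hp0 : 0 ≤ p := zero_le_one.trans hp
  set F : T → ℝ≥0∞ := fun t => ENNReal.ofReal (dtran τ (dist (ι t) m)) with hF
  set A : T → ℝ≥0∞ := fun t => ENNReal.ofReal (dtran τ (dist (ι t) m)) ^ (2 * p) with hA
  set H₁ : T → ℝ≥0∞ := fun t => h τ (2 * (n : ℝ)⁻¹ * dtran τ (dist (ι t) m)) ^ p with hH₁
  set H₂ : (Fin n → T) → ℝ≥0∞ := fun y => h τ (2 * empMoment τ ι m y) ^ p with hH₂
  have hf := hτ.measurable_dtran_dist hι m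
  have hAm : Measurable A := hf.ennreal_ofReal.pow_const _
  have hhm := hτ.measurable_h hs.tendsto_dtran
  have hem := hτ.measurable_empMoment (n := n) hι m
  have hH₁m : Measurable H₁ := (hhm.comp (hf.const_mul _)).pow_const _
  have hH₂m : Measurable H₂ := (hhm.comp (hem.const_mul _)).pow_const _
  have hWm : Measurable fun y : Fin n → T => F (y j) ^ (2 : ℝ) * h τ (empMoment τ ι m y) :=
    ((hf.ennreal_ofReal.comp (measurable_pi_apply j)).pow_const _).mul (hhm.comp hem)
  set π := Measure.pi fun _ : Fin (n + 1) => μ with hπ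
  have hmp := measurePreserving_comp_pi (μ := μ) (Fin.succ_injective n)
  rw [← hmp.lintegral_comp hWm]
  have hm3 : Measurable fun x : Fin (n + 1) → T => A (x j.succ) * H₁ (x j.succ) :=
    (hAm.comp (measurable_pi_apply _)).mul (hH₁m.comp (measurable_pi_apply _))
  refine ne_top_of_le_ne_top (ENNReal.add_ne_top.2 ⟨ENNReal.one_ne_top, hfin⟩) ?_
  calc ∫⁻ x, F (x j.succ) ^ (2 : ℝ) * h τ (empMoment τ ι m fun i => x i.succ) ∂π
      ≤ ∫⁻ x, 1 + (A (x j.succ) * H₁ (x j.succ)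
        + A (x j.succ) * H₂ fun i => exchange j x i.succ) ∂π := by
        refine lintegral_mono fun x => ?_
        -- This reduces the first moment to the `p`-th at the cost of the constant `1`, finite under
        -- a probability measure.
        have h1 : ∀ z : ℝ≥0∞, z ≤ 1 + z ^ p := by
          intro z
          rcases le_total z 1 with hz | hz
          · exact hz.trans le_self_add
          · calc z = z ^ (1 : ℝ) := (ENNReal.rpow_one z).symm
              _ ≤ z ^ p := ENNReal.rpow_le_rpow_of_exponent_le hz hp
              _ ≤ _ := le_add_self
        refine (h1 _).trans (add_le_add le_rfl ?_)
        rw [ENNReal.mul_rpow_of_nonneg _ _ hp0, ← ENNReal.rpow_mul, ← mul_add]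
        refine mul_le_mul_right ?_ _
        have h2 := (hτ.monotone_h hs.tendsto_dtran (le_max_left _ _)).trans (hs.h_max_le m j x)
        refine (ENNReal.rpow_le_rpow h2 hp0).trans ?_
        rw [(ENNReal.monotone_rpow_of_nonneg hp0).map_max]
        exact max_le le_self_add le_add_self
    _ = 1 + (∫⁻ t, A t * H₁ t ∂μ
        + (∫⁻ t, A t ∂μ) * ∫⁻ y, H₂ y ∂(Measure.pi fun _ => μ)) := by
        rw [lintegral_add_left measurable_const, lintegral_add_left hm3,
          lintegral_eval_pi (A := fun t => A t * H₁ t) (hAm.mul hH₁m)]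
        congr 2
        · simp [hπ]
        · exact lintegral_eval_mul_comp_pi hAm hH₂m (injective_swap_succ j)
            fun i => swap_succ_ne i j
    _ ≤ 1 + (V n τ μ ι m p + 4 * powMoment τ μ ι m (2 * p) * s) := by
        gcongr
        · exact le_add_self
        · calc ∫⁻ t, A t ∂μ = 1 * powMoment τ μ ι m (2 * p) := (one_mul _).symm
            _ ≤ 4 * powMoment τ μ ι m (2 * p) := by gcongr; norm_num

end SampleSetting

/-! ### Excess risk, ghost losses and symmetrization. -/

/-- The excess of the population risk of `q` over that of `m`. -/
def excessRisk (τ : ℝ → ℝ) (μ : Measure T) (ι : T → Q) (m q : Q) : ℝ :=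
  ∫ t, (τ (dist (ι t) q) - τ (dist (ι t) m)) ∂μ

/-- The loss function of the main theorem, as a function of the estimator. -/
def weightedLoss (τ : ℝ → ℝ) (χ : ℝ) (m q : Q) : ℝ≥0∞ :=
  ENNReal.ofReal (dist m q) ^ 2 * min (ddtran τ (2 * χ)) (ddtran τ (2 * dist m q))

/-- The integrand of the symmetrization argument. -/
def ghostLoss (τ : ℝ → ℝ) (ι : T → Q) (M : (Fin n → Q) → Q) (m : Q) (j : Fin n)
    (x : Fin (n + 1) → T) : ℝ :=
  τ (dist (ι (x 0)) (sampleMean ι M x)) - τ (dist (ι (x 0)) m)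
    - τ (dist (ι (x j.succ)) (sampleMean ι M x)) + τ (dist (ι (x j.succ)) m)

namespace IsTransform

theorem integrable_sub (hτ : IsTransform τ) (hι : Continuous ι) {m : Q}
    (hint : Integrable (fun t => dtran τ (dist (ι t) m)) μ) (p q : Q) :
    Integrable (fun t => τ (dist (ι t) p) - τ (dist (ι t) q)) μ := by
  refine Integrable.mono' ((hint.add (integrable_const (dtran τ (dist m p + dist m q)))).const_mul
    (dist p q)) ?_ (Eventually.of_forall fun t => ?_)
  · exact ((hτ.continuous_comp_dist hι continuous_const).sub
      (hτ.continuous_comp_dist hι continuous_const)).aestronglyMeasurable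
  · have h1 := dist_triangle (ι t) m p
    have h2 := dist_triangle (ι t) m q
    have h3 := hτ.abs_sub_le (M := dist (ι t) m + (dist m p + dist m q))
      (dist_nonneg (x := ι t) (y := p)) (dist_nonneg (x := ι t) (y := q))
      (by linarith [dist_nonneg (x := m) (y := q)]) (by linarith [dist_nonneg (x := m) (y := p)])
    have h4 := hτ.dtran_add_le (dist_nonneg (x := ι t) (y := m))
      (add_nonneg (dist_nonneg (x := m) (y := p)) (dist_nonneg (x := m) (y := q)))
    have h5 : |dist (ι t) p - dist (ι t) q| ≤ dist p q := by
      rw [dist_comm (ι t) p, dist_comm (ι t) q]; exact abs_dist_sub_le _ _ _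
    rw [Real.norm_eq_abs]
    simp only [Pi.add_apply]
    exact h3.trans (mul_le_mul h5 h4 (hτ.dtran_nonneg _) dist_nonneg)

/-- The population variance inequality. -/
theorem weightedLoss_le (hτ : IsTransform τ) (hQ : IsHadamard Q)
    (hι : Continuous ι) {m : Q} (hint : Integrable (fun t => dtran τ (dist (ι t) m)) μ)
    (hmin : ∀ q, 0 ≤ excessRisk τ μ ι m q) {χ : ℝ} (hχ : 1 / 2 ≤ μ {t | dist (ι t) m ≤ χ})
    (q : Q) : weightedLoss τ χ m q ≤ ENNReal.ofReal (16 / 3 * excessRisk τ μ ι m q) := by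
  rcases (dist_nonneg (x := m) (y := q)).eq_or_lt with h | hD
  · simp [weightedLoss, ← h]
  set w := min (ddtran τ (2 * χ)) (ddtran τ (2 * dist m q)) with hw
  have hwtop : w ≠ ⊤ :=
    ne_top_of_le_ne_top (ddtran_ne_top (by positivity : 0 < 2 * dist m q)) (min_le_right _ _)
  set κ := w.toReal with hκ
  have hκ0 : 0 ≤ κ := ENNReal.toReal_nonneg
  have hκw : ENNReal.ofReal κ = w := ENNReal.ofReal_toReal hwtop
  obtain ⟨c, hc⟩ := hτ.exists_point hQ m q (t := 1 / 4) (by norm_num)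
  set s : Set T := {t | dist (ι t) m ≤ χ} with hs
  have hsm : MeasurableSet s :=
    (isClosed_le (hι.dist continuous_const) continuous_const).measurableSet
  -- Curvature is used only on the set `s`, of mass at least `1 / 2`, where both distances are at
  -- most `χ + dist m q`. Elsewhere `κ = 0`, that is plain convexity, suffices.
  have hpt : ∀ t, τ (dist (ι t) c) - τ (dist (ι t) m)
      ≤ 1 / 4 * (τ (dist (ι t) q) - τ (dist (ι t) m))
        - s.indicator (fun _ => 3 / 32 * κ * dist m q ^ 2) t := by
    intro t
    by_cases ht : t ∈ s
    · have h1 := hc (ι t) κ hκ0 (by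
        rw [hκw, hw, ← hτ.antitone_ddtran.map_max]
        refine hτ.antitone_ddtran ?_
        have h1 := dist_triangle (ι t) m q
        have h2 : dist (ι t) m ≤ χ := ht
        have h3 := le_max_left (2 * χ) (2 * dist m q)
        have h4 := le_max_right (2 * χ) (2 * dist m q)
        exact max_le (by linarith) (by linarith))
      rw [indicator_of_mem ht]
      linarith
    · have h1 := hc (ι t) 0 le_rfl (by simp)
      rw [indicator_of_notMem ht]
      linarith
  have hi1 := hτ.integrable_sub hι hint c m
  have hi2 := hτ.integrable_sub hι hint q m
  have hi3 : Integrable (s.indicator fun _ : T => 3 / 32 * κ * dist m q ^ 2) μ :=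
    (integrable_const _).indicator hsm
  have h2 := integral_mono hi1 ((hi2.const_mul (1 / 4)).sub hi3) hpt
  have h3 : ∫ t, (1 / 4 * (τ (dist (ι t) q) - τ (dist (ι t) m))
      - s.indicator (fun _ => 3 / 32 * κ * dist m q ^ 2) t) ∂μ
      = 1 / 4 * excessRisk τ μ ι m q - μ.real s * (3 / 32 * κ * dist m q ^ 2) := by
    rw [integral_sub (hi2.const_mul _) hi3, integral_const_mul, integral_indicator hsm]
    simp [excessRisk]
  have h4 := (hmin c).trans (h2.trans_eq h3)
  have hreal : 1 / 2 ≤ μ.real s := by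
    have := ENNReal.toReal_mono (measure_ne_top μ s) hχ
    simpa [Measure.real] using this
  rw [weightedLoss, ← hw, ← hκw, ← ENNReal.ofReal_pow dist_nonneg,
    ← ENNReal.ofReal_mul (by positivity)]
  refine ENNReal.ofReal_le_ofReal ?_
  have h5 := mul_le_mul_of_nonneg_right hreal
    (by positivity : 0 ≤ 3 / 32 * κ * dist m q ^ 2)
  linarith

end IsTransform

namespace SampleSetting

theorem abs_ghostLoss_le (hs : SampleSetting τ ι M) (m : Q) (j : Fin n) (x : Fin (n + 1) → T) :
    |ghostLoss τ ι M m j x| ≤ 2 * dist m (sampleMean ι M x)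
      * (dtran τ (dist (ι (x 0)) m) + dtran τ (dist (ι (x j.succ)) m)) := by
  have hτ := hs.isTransform
  have h1 := hτ.quadruple hs.isHadamard (ι (x 0)) (ι (x j.succ)) m (sampleMean ι M x)
  have h2 := hτ.quadruple hs.isHadamard (ι (x j.succ)) (ι (x 0)) m (sampleMean ι M x)
  rw [dist_comm (ι (x j.succ)) (ι (x 0))] at h2
  have h3 := (hτ.monotone_dtran (dist_triangle_right (ι (x 0)) (ι (x j.succ)) m)).trans
    (hτ.dtran_add_le dist_nonneg dist_nonneg)
  have h4 := mul_le_mul_of_nonneg_left h3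
    (by positivity : 0 ≤ 2 * dist m (sampleMean ι M x))
  rw [ghostLoss, abs_le]
  constructor <;> linarith

/-- All terms at `m` cancel, and the rest is the quadruple difference of the two observations and
the two sample means. -/
theorem ghostLoss_add_exchange_le (hs : SampleSetting τ ι M) (m : Q) (j : Fin n)
    (x : Fin (n + 1) → T) :
    ghostLoss τ ι M m j x + ghostLoss τ ι M m j (exchange j x)
      ≤ 2 * (dist (sampleMean ι M x) (sampleMean ι M (exchange j x))
        * dtran τ (dist (ι (x j.succ)) (ι (x 0)))) := by
  have h1 := hs.isTransform.quadruple hs.isHadamard (ι (x j.succ)) (ι (x 0)) (sampleMean ι M x)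
    (sampleMean ι M (exchange j x))
  simp only [ghostLoss, exchange_zero, exchange_succ_self]
  linarith

theorem measurable_ghostLoss (hs : SampleSetting τ ι M) (hι : Continuous ι) (m : Q) (j : Fin n) :
    Measurable (ghostLoss τ ι M m j) := by
  have hτ := hs.isTransform
  have h1 := hs.continuous_sampleMean hι
  have h2 : ∀ i, Continuous fun x : Fin (n + 1) → T => ι (x i) := fun i => by fun_prop
  refine Continuous.measurable ?_
  exact (((hτ.continuous_comp_dist (h2 _) h1).sub (hτ.continuous_comp_dist (h2 _)
    continuous_const)).sub (hτ.continuous_comp_dist (h2 _) h1)).add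
    (hτ.continuous_comp_dist (h2 _) continuous_const)

/-- With `e` the empirical moment, the distance from `m` to the sample mean is at most `12 e h(e)`.
Next to the ghost factor, `e h(e) ≤ h(1) + W` is integrated by independence; next to an observation,
`e F(y j)` is at most a sum of squares, which yields `W`. Ghost losses are signed, so symmetrization
needs their integrability. -/
theorem integrable_ghostLoss (hs : SampleSetting τ ι M) (hι : Continuous ι) {m : Q}
    (hint : Integrable (fun t => dtran τ (dist (ι t) m)) μ)
    (hfin : ∀ j, ∫⁻ y, ENNReal.ofReal (dtran τ (dist (ι (y j)) m)) ^ (2 : ℝ)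
      * h τ (empMoment (n := n) τ ι m y) ∂(Measure.pi fun _ => μ) ≠ ⊤) (j : Fin n) :
    Integrable (ghostLoss τ ι M m j) (Measure.pi fun _ => μ) := by
  have hτ := hs.isTransform
  have hn0 : (0 : ℝ) < n := by exact_mod_cast hs.one_le
  refine ⟨(hs.measurable_ghostLoss hι m j).aestronglyMeasurable, ?_⟩
  set F : T → ℝ≥0∞ := fun t => ENNReal.ofReal (dtran τ (dist (ι t) m)) with hF
  have hf := hτ.measurable_dtran_dist hι m
  have hFm : Measurable F := hf.ennreal_ofReal
  have hhm := hτ.measurable_h hs.tendsto_dtran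
  have hem := hτ.measurable_empMoment (n := n) hι m
  let W : (Fin n → T) → ℝ≥0∞ := fun y => ∑ i, F (y i) ^ (2 : ℝ) * h τ (empMoment τ ι m y)
  have hWim : ∀ i : Fin n, Measurable fun y : Fin n → T =>
      F (y i) ^ (2 : ℝ) * h τ (empMoment τ ι m y) := fun i =>
    ((hFm.comp (measurable_pi_apply i)).pow_const _).mul (hhm.comp hem)
  have hWm : Measurable W := Finset.measurable_fun_sum _ fun i _ => hWim i
  have hWfin : ∫⁻ y, W y ∂(Measure.pi fun _ => μ) ≠ ⊤ := by
    rw [lintegral_finsetSum _ fun i _ => hWim i]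
    exact ENNReal.sum_ne_top.2 fun i _ => hfin i
  -- elementary bounds for the empirical moment
  have hsq : ∀ y : Fin n → T, empMoment τ ι m y ^ 2 ≤ ∑ i, dtran τ (dist (ι (y i)) m) ^ 2 := by
    intro y
    have h1 := sq_sum_le_card_mul_sum_sq (s := (Finset.univ : Finset (Fin n)))
      (f := fun i => dtran τ (dist (ι (y i)) m))
    rw [Finset.card_univ, Fintype.card_fin] at h1
    have h2 : (0 : ℝ) ≤ ∑ i, dtran τ (dist (ι (y i)) m) ^ 2 :=
      Finset.sum_nonneg fun i _ => sq_nonneg _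
    have h3 : (1 : ℝ) ≤ n := by exact_mod_cast hs.one_le
    rw [empMoment, div_pow, div_le_iff₀ (by positivity)]
    nlinarith [mul_nonneg h2 hn0.le]
  have hsqE : ∀ y : Fin n → T, ENNReal.ofReal (∑ i, dtran τ (dist (ι (y i)) m) ^ 2)
      * h τ (empMoment τ ι m y) = W y := by
    intro y
    rw [ENNReal.ofReal_sum_of_nonneg fun i _ => sq_nonneg _, Finset.sum_mul]
    refine Finset.sum_congr rfl fun i _ => ?_
    rw [hF, ENNReal.rpow_two, ENNReal.ofReal_pow (hτ.dtran_nonneg _)]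
  have hB1 : ∀ y : Fin n → T, ENNReal.ofReal (empMoment τ ι m y) * h τ (empMoment τ ι m y)
      ≤ h τ 1 + W y := by
    intro y
    rcases le_total (empMoment τ ι m y) 1 with h1 | h1
    · refine le_trans ?_ le_self_add
      calc ENNReal.ofReal (empMoment τ ι m y) * h τ (empMoment τ ι m y)
          ≤ 1 * h τ 1 := mul_le_mul' (ENNReal.ofReal_le_one.2 h1)
            (hτ.monotone_h hs.tendsto_dtran h1)
        _ = _ := one_mul _
    · refine le_trans ?_ le_add_self
      rw [← hsqE y]
      refine mul_le_mul_left (ENNReal.ofReal_le_ofReal ?_) _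
      exact (le_self_pow₀ h1 two_ne_zero).trans (hsq y)
  have hB2 : ∀ y : Fin n → T, ENNReal.ofReal (empMoment τ ι m y) * h τ (empMoment τ ι m y)
      * F (y j) ≤ W y := by
    intro y
    rw [← hsqE y, mul_right_comm, hF, ← ENNReal.ofReal_mul (empMoment_nonneg hτ ι m y)]
    refine mul_le_mul_left (ENNReal.ofReal_le_ofReal ?_) _
    have h1 : dtran τ (dist (ι (y j)) m) ^ 2 ≤ ∑ i, dtran τ (dist (ι (y i)) m) ^ 2 :=
      Finset.single_le_sum (f := fun i => dtran τ (dist (ι (y i)) m) ^ 2)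
        (fun i _ => sq_nonneg _) (Finset.mem_univ j)
    have h2 := two_mul_le_add_sq (empMoment τ ι m y) (dtran τ (dist (ι (y j)) m))
    linarith [hsq y]
  have hpt : ∀ x : Fin (n + 1) → T, ‖ghostLoss τ ι M m j x‖ₑ
      ≤ 24 * (F (x 0) * (h τ 1 + W fun i => x i.succ) + W fun i => x i.succ) := by
    intro x
    set y : Fin n → T := fun i => x i.succ with hy
    have h1 := hs.abs_ghostLoss_le m j x
    have h2 : ENNReal.ofReal (dist m (sampleMean ι M x))
        ≤ 12 * (ENNReal.ofReal (empMoment τ ι m y) * h τ (empMoment τ ι m y)) := by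
      have h3 := (hs.dist_sampleMean_le m x).trans (hτ.monotone_invDtran hs.tendsto_dtran
        (by linarith [empMoment_nonneg hτ ι m y] :
          4 * empMoment τ ι m y ≤ 12 * empMoment τ ι m y))
      refine (ENNReal.ofReal_le_ofReal h3).trans ((hτ.invDtran_le_mul_h _).trans_eq ?_)
      rw [ENNReal.ofReal_mul (by norm_num), mul_assoc]
      norm_num
    rw [Real.enorm_eq_ofReal_abs]
    calc ENNReal.ofReal |ghostLoss τ ι M m j x|
        ≤ ENNReal.ofReal (2 * dist m (sampleMean ι M x)
          * (dtran τ (dist (ι (x 0)) m) + dtran τ (dist (ι (x j.succ)) m))) :=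
          ENNReal.ofReal_le_ofReal h1
      _ = 2 * ENNReal.ofReal (dist m (sampleMean ι M x)) * (F (x 0) + F (y j)) := by
          rw [ENNReal.ofReal_mul (by positivity), ENNReal.ofReal_mul (by norm_num),
            ENNReal.ofReal_add (hτ.dtran_nonneg _) (hτ.dtran_nonneg _)]
          norm_num [hF, hy]
      _ ≤ 2 * (12 * (ENNReal.ofReal (empMoment τ ι m y) * h τ (empMoment τ ι m y)))
          * (F (x 0) + F (y j)) := by gcongr
      _ = 24 * (F (x 0) * (ENNReal.ofReal (empMoment τ ι m y) * h τ (empMoment τ ι m y))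
          + ENNReal.ofReal (empMoment τ ι m y) * h τ (empMoment τ ι m y) * F (y j)) := by ring
      _ ≤ _ := by
          gcongr
          · exact hB1 y
          · exact hB2 y
  have hWm' : Measurable fun x : Fin (n + 1) → T => W fun i => x i.succ :=
    hWm.comp (measurePreserving_comp_pi (μ := μ) (Fin.succ_injective n)).measurable
  have hm1 : Measurable fun x : Fin (n + 1) → T =>
      F (x 0) * (h τ 1 + W fun i => x i.succ) :=
    (hFm.comp (measurable_pi_apply _)).mul (measurable_const.add hWm')
  have hFint : ∫⁻ t, F t ∂μ ≠ ⊤ := by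
    rw [hF, ← ofReal_integral_eq_lintegral_ofReal hint
      (Eventually.of_forall fun t => hτ.dtran_nonneg _)]
    exact ENNReal.ofReal_ne_top
  rw [hasFiniteIntegral_iff_enorm]
  refine (lintegral_mono hpt).trans_lt ?_
  have hm2 : Measurable fun x : Fin (n + 1) → T =>
      F (x 0) * (h τ 1 + W fun i => x i.succ) + W fun i => x i.succ := hm1.add hWm'
  rw [lintegral_const_mul _ hm2, lintegral_add_left hm1,
    lintegral_eval_mul_comp_pi (B := fun y => h τ 1 + W y) hFm (measurable_const.add hWm)
      (Fin.succ_injective n) fun i => Fin.succ_ne_zero i,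
    (measurePreserving_comp_pi (μ := μ) (Fin.succ_injective n)).lintegral_comp hWm,
    lintegral_add_left measurable_const, lintegral_const]
  refine ENNReal.mul_lt_top (by norm_num) (ENNReal.add_lt_top.2 ⟨ENNReal.mul_lt_top
    hFint.lt_top (ENNReal.add_lt_top.2 ⟨?_, hWfin.lt_top⟩), hWfin.lt_top⟩)
  simpa using (hτ.h_ne_top hs.tendsto_dtran 1).lt_top

end SampleSetting

/-- Splits off the ghost coordinate, so that it can be integrated out with the sample held fixed. -/
theorem measurePreserving_cons :
    MeasurePreserving (fun w : T × (Fin n → T) => (Fin.cons w.1 w.2 : Fin (n + 1) → T))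
      (μ.prod (Measure.pi fun _ => μ)) (Measure.pi fun _ => μ) := by
  have h := (measurePreserving_piFinSuccAbove (fun _ : Fin (n + 1) => μ) 0).symm
  convert h using 1
  funext w
  simp [MeasurableEquiv.piFinSuccAbove, Fin.insertNthEquiv]

namespace SampleSetting

theorem sq_dtran_dist_le (hτ : IsTransform τ) (y z m : Q) :
    ENNReal.ofReal (dtran τ (dist y z) ^ 2) ≤ 2 * (ENNReal.ofReal (dtran τ (dist y m)) ^ (2 : ℝ)
      + ENNReal.ofReal (dtran τ (dist z m)) ^ (2 : ℝ)) := by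
  have h1 := (hτ.monotone_dtran (dist_triangle_right y z m)).trans
    (hτ.dtran_add_le dist_nonneg dist_nonneg)
  have h0 := hτ.dtran_nonneg (dist y z)
  rw [ENNReal.rpow_two, ENNReal.rpow_two, ← ENNReal.ofReal_pow (hτ.dtran_nonneg _),
    ← ENNReal.ofReal_pow (hτ.dtran_nonneg _), ← ENNReal.ofReal_add (sq_nonneg _) (sq_nonneg _),
    ← ENNReal.ofReal_ofNat 2, ← ENNReal.ofReal_mul (by norm_num)]
  refine ENNReal.ofReal_le_ofReal ((pow_le_pow_left₀ h0 h1 2).trans ?_)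
  exact add_sq_le

/-- `invCurv` is invariant under the exchange, so the terms with `x 0` and `x j.succ` have equal
integrals. The constant is `8 / 3` times `2` from `sq_dtran_dist_le` times `2` from this symmetry.
-/
theorem lintegral_stability_le (hs : SampleSetting τ ι M) (hι : Continuous ι) (m : Q)
    (j : Fin n) :
    ∫⁻ x, ENNReal.ofReal (dist (sampleMean ι M x) (sampleMean ι M (exchange j x))
        * dtran τ (dist (ι (x j.succ)) (ι (x 0)))) ∂(Measure.pi fun _ => μ)
      ≤ ENNReal.ofReal (32 / (3 * n)) * ∫⁻ x, ENNReal.ofReal (dtran τ (dist (ι (x j.succ)) m))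
        ^ (2 : ℝ) * invCurv τ ι M j x ∂(Measure.pi fun _ => μ) := by
  have hτ := hs.isTransform
  set F : T → ℝ≥0∞ := fun t => ENNReal.ofReal (dtran τ (dist (ι t) m)) ^ (2 : ℝ) with hF
  have hFm : Measurable F := (hτ.measurable_dtran_dist hι m).ennreal_ofReal.pow_const _
  have hUm := hs.measurable_invCurv hι j
  have hFU : ∀ i : Fin (n + 1), Measurable fun x => F (x i) * invCurv τ ι M j x := fun i =>
    (hFm.comp (measurable_pi_apply i)).mul hUm
  have hex : ∫⁻ x, F (x 0) * invCurv τ ι M j x ∂(Measure.pi fun _ => μ)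
      = ∫⁻ x, F (x j.succ) * invCurv τ ι M j x ∂(Measure.pi fun _ => μ) := by
    rw [← (measurePreserving_exchange (μ := μ) j).lintegral_comp (hFU 0)]
    simp only [exchange_zero, invCurv_exchange]
  calc ∫⁻ x, ENNReal.ofReal (dist (sampleMean ι M x) (sampleMean ι M (exchange j x))
        * dtran τ (dist (ι (x j.succ)) (ι (x 0)))) ∂(Measure.pi fun _ => μ)
      ≤ ∫⁻ x, ENNReal.ofReal (8 / (3 * n)) * 2
          * (F (x j.succ) * invCurv τ ι M j x + F (x 0) * invCurv τ ι M j x)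
          ∂(Measure.pi fun _ => μ) := by
        refine lintegral_mono fun x => (hs.stability j x).trans ?_
        calc _ ≤ ENNReal.ofReal (8 / (3 * n)) * (2 * (F (x j.succ) + F (x 0))
              * invCurv τ ι M j x) := by
              gcongr
              exact sq_dtran_dist_le hτ _ _ m
          _ = _ := by ring
    _ = ENNReal.ofReal (8 / (3 * n)) * 2 * (2 * ∫⁻ x, F (x j.succ) * invCurv τ ι M j x
          ∂(Measure.pi fun _ => μ)) := by
        have hadd : Measurable fun x : Fin (n + 1) → T => F (x j.succ) * invCurv τ ι M j x
            + F (x 0) * invCurv τ ι M j x := (hFU j.succ).add (hFU 0)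
        rw [lintegral_const_mul _ hadd, lintegral_add_left (hFU j.succ), hex,
          two_mul (∫⁻ x, F (x j.succ) * invCurv τ ι M j x ∂(Measure.pi fun _ => μ))]
    _ = _ := by
        have : ENNReal.ofReal (32 / (3 * n)) = ENNReal.ofReal (8 / (3 * n)) * 4 := by
          rw [← ENNReal.ofReal_ofNat 4, ← ENNReal.ofReal_mul (by positivity)]
          congr 1
          ring
        rw [this]
        ring

/-- The exchange preserves the law, so the ghost loss may be averaged with its exchanged version;
only then is the stability bound available. -/
theorem integral_ghostLoss_le (hs : SampleSetting τ ι M) (hι : Continuous ι) {m : Q} (j : Fin n)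
    (hi : Integrable (ghostLoss τ ι M m j) (Measure.pi fun _ => μ)) {B : ℝ≥0∞} (hBtop : B ≠ ⊤)
    (hB : ∫⁻ x, ENNReal.ofReal (dtran τ (dist (ι (x j.succ)) m)) ^ (2 : ℝ) * invCurv τ ι M j x
      ∂(Measure.pi fun _ => μ) ≤ B) :
    ∫ x, ghostLoss τ ι M m j x ∂(Measure.pi fun _ => μ) ≤ 32 / (3 * n) * B.toReal := by
  have hmp := measurePreserving_exchange (μ := μ) j
  have hi2 : Integrable (fun x => ghostLoss τ ι M m j (exchange j x)) (Measure.pi fun _ => μ) :=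
    hmp.integrable_comp_of_integrable hi
  have heq : ∫ x, ghostLoss τ ι M m j (exchange j x) ∂(Measure.pi fun _ => μ)
      = ∫ x, ghostLoss τ ι M m j x ∂(Measure.pi fun _ => μ) := by
    have := integral_map (μ := Measure.pi fun _ => μ) hmp.measurable.aemeasurable
      (hs.measurable_ghostLoss hι m j).aestronglyMeasurable
    rw [hmp.map_eq] at this
    exact this.symm
  have hsym : ∫ x, ghostLoss τ ι M m j x ∂(Measure.pi fun _ => μ)
      = ∫ x, 1 / 2 * (ghostLoss τ ι M m j x + ghostLoss τ ι M m j (exchange j x))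
        ∂(Measure.pi fun _ => μ) := by
    rw [integral_const_mul, integral_add hi hi2, heq]
    ring
  have h1 : ENNReal.ofReal (∫ x, ghostLoss τ ι M m j x ∂(Measure.pi fun _ => μ))
      ≤ ENNReal.ofReal (32 / (3 * n)) * B := by
    rw [hsym]
    refine (ofReal_integral_le_lintegral ((hi.add hi2).const_mul (1 / 2))).trans ?_
    refine le_trans ?_ ((hs.lintegral_stability_le (μ := μ) hι m j).trans
      (mul_le_mul_right hB _))
    refine lintegral_mono fun x => ENNReal.ofReal_le_ofReal ?_
    have := hs.ghostLoss_add_exchange_le m j x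
    simp only [Pi.add_apply]
    linarith
  rw [ENNReal.ofReal_le_iff_le_toReal (ENNReal.mul_ne_top ENNReal.ofReal_ne_top hBtop),
    ENNReal.toReal_mul, ENNReal.toReal_ofReal (by positivity)] at h1
  exact h1

/-- The excess risk is bounded by the average of the ghost losses. -/
theorem mul_excessRisk_le (hs : SampleSetting τ ι M) (hι : Continuous ι) {m : Q}
    (hint : Integrable (fun t => dtran τ (dist (ι t) m)) μ) (y : Fin n → T) :
    n * excessRisk τ μ ι m (M fun i => ι (y i))
      ≤ ∑ j : Fin n, ∫ t, ghostLoss τ ι M m j (Fin.cons t y : Fin (n + 1) → T) ∂μ := by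
  set c := M fun i => ι (y i) with hc
  have h1 : ∀ j : Fin n, ∫ t, ghostLoss τ ι M m j (Fin.cons t y : Fin (n + 1) → T) ∂μ
      = excessRisk τ μ ι m c - (τ (dist (ι (y j)) c) - τ (dist (ι (y j)) m)) := by
    intro j
    have h2 : ∀ t, ghostLoss τ ι M m j (Fin.cons t y : Fin (n + 1) → T)
        = (τ (dist (ι t) c) - τ (dist (ι t) m))
          - (τ (dist (ι (y j)) c) - τ (dist (ι (y j)) m)) := by
      intro t
      simp only [ghostLoss, sampleMean, Fin.cons_zero, Fin.cons_succ, ← hc]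
      ring
    simp_rw [h2]
    rw [integral_sub (hs.isTransform.integrable_sub hι hint c m) (integrable_const _)]
    simp [excessRisk]
  rw [Finset.sum_congr rfl fun j _ => h1 j, Finset.sum_sub_distrib, Finset.sum_sub_distrib]
  have h3 := hs.isMean (fun i => ι (y i)) m
  simp only [Finset.sum_const, Finset.card_univ, Fintype.card_fin, nsmul_eq_mul, ← hc] at h3 ⊢
  linarith

theorem lintegral_weightedLoss_le (hs : SampleSetting τ ι M) (hι : Continuous ι) {m : Q}
    (hint : Integrable (fun t => dtran τ (dist (ι t) m)) μ)
    (hmin : ∀ q, 0 ≤ excessRisk τ μ ι m q) {χ : ℝ} (hχ : 1 / 2 ≤ μ {t | dist (ι t) m ≤ χ})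
    (hfin : ∀ j, ∫⁻ y, ENNReal.ofReal (dtran τ (dist (ι (y j)) m)) ^ (2 : ℝ)
      * h τ (empMoment (n := n) τ ι m y) ∂(Measure.pi fun _ => μ) ≠ ⊤) {B : ℝ≥0∞}
    (hB : ∀ j : Fin n, ∫⁻ x, ENNReal.ofReal (dtran τ (dist (ι (x j.succ)) m)) ^ (2 : ℝ)
      * invCurv τ ι M j x ∂(Measure.pi fun _ => μ) ≤ B) :
    ∫⁻ y, weightedLoss τ χ m (M fun i => ι (y i)) ∂(Measure.pi fun _ => μ)
      ≤ 64 / (n : ℝ≥0∞) * B := by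
  have hn0 : (0 : ℝ) < n := by exact_mod_cast hs.one_le
  rcases eq_or_ne B ⊤ with rfl | hBtop
  · rw [ENNReal.mul_top]
    · exact le_top
    · simp [ENNReal.div_eq_zero_iff]
  have hi := fun j => hs.integrable_ghostLoss hι hint hfin j
  have hic : ∀ j, Integrable (fun w : T × (Fin n → T) =>
      ghostLoss τ ι M m j (Fin.cons w.1 w.2 : Fin (n + 1) → T))
      (μ.prod (Measure.pi fun _ => μ)) := fun j =>
    measurePreserving_cons.integrable_comp_of_integrable (hi j)
  let G : Fin n → (Fin n → T) → ℝ := fun j y =>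
    ∫ t, ghostLoss τ ι M m j (Fin.cons t y : Fin (n + 1) → T) ∂μ
  have hGi : ∀ j, Integrable (G j) (Measure.pi fun _ => μ) := fun j =>
    (hic j).integral_prod_right
  have hGint : ∀ j, ∫ y, G j y ∂(Measure.pi fun _ => μ)
      = ∫ x, ghostLoss τ ι M m j x ∂(Measure.pi fun _ => μ) := by
    intro j
    have h1 := integral_prod_symm _ (hic j)
    have h2 := integral_map (μ := μ.prod (Measure.pi fun _ => μ))
      (measurePreserving_cons (n := n) (μ := μ)).measurable.aemeasurable
      (hs.measurable_ghostLoss hι m j).aestronglyMeasurable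
    rw [measurePreserving_cons.map_eq] at h2
    rw [h2, h1]
  have hsum : Integrable (fun y => 16 / (3 * n) * ∑ j : Fin n, G j y)
      (Measure.pi fun _ => μ) :=
    (integrable_finsetSum _ fun j _ => hGi j).const_mul _
  have hle : ∀ y : Fin n → T, 16 / 3 * excessRisk τ μ ι m (M fun i => ι (y i))
      ≤ 16 / (3 * n) * ∑ j : Fin n, G j y := by
    intro y
    have := mul_le_mul_of_nonneg_left (hs.mul_excessRisk_le hι hint y)
      (by positivity : (0 : ℝ) ≤ 16 / (3 * n))
    refine le_trans (le_of_eq ?_) this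
    field_simp
  calc ∫⁻ y, weightedLoss τ χ m (M fun i => ι (y i)) ∂(Measure.pi fun _ => μ)
      ≤ ∫⁻ y, ENNReal.ofReal (16 / (3 * n) * ∑ j : Fin n, G j y) ∂(Measure.pi fun _ => μ) :=
        lintegral_mono fun y => (hs.isTransform.weightedLoss_le hs.isHadamard hι hint hmin hχ
          _).trans (ENNReal.ofReal_le_ofReal (hle y))
    _ = ENNReal.ofReal (∫ y, 16 / (3 * n) * ∑ j : Fin n, G j y ∂(Measure.pi fun _ => μ)) := by
        refine (ofReal_integral_eq_lintegral_ofReal hsum (Eventually.of_forall fun y => ?_)).symm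
        exact (mul_nonneg (by norm_num) (hmin _)).trans (hle y)
    _ ≤ ENNReal.ofReal (64 / n * B.toReal) := by
        refine ENNReal.ofReal_le_ofReal ?_
        rw [integral_const_mul, integral_finsetSum _ fun j _ => hGi j]
        have h1 : ∑ j : Fin n, ∫ y, G j y ∂(Measure.pi fun _ => μ)
            ≤ ∑ _j : Fin n, 32 / (3 * n) * B.toReal := by
          refine Finset.sum_le_sum fun j _ => ?_
          rw [hGint]
          exact hs.integral_ghostLoss_le hι j (hi j) hBtop (hB j)
        refine (mul_le_mul_of_nonneg_left h1 (by positivity)).trans ?_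
        rw [Finset.sum_const, Finset.card_univ, Fintype.card_fin, nsmul_eq_mul]
        -- The factor `16 / 3` of the variance inequality times `32 / 3` from stability is `512 /
        -- 9`, below `64`.
        have h2 : 16 / (3 * n) * (n * (32 / (3 * n) * B.toReal)) = 512 / 9 / n * B.toReal := by
          field_simp
          ring
        rw [h2]
        gcongr
        norm_num
    _ = _ := by
        rw [ENNReal.ofReal_mul (by positivity), ENNReal.ofReal_toReal hBtop,
          ENNReal.ofReal_div_of_pos hn0]
        simp

/-! ### The bad event and the two bounds for canonical observations. -/

/-- If half of the observations are close to `m`, then the average curvature is bounded below. -/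
theorem invCurv_le_of_count (hs : SampleSetting τ ι M) {m : Q} {j : Fin n}
    {x : Fin (n + 1) → T} {χ R r : ℝ} (hr : χ + R ≤ r) (h1 : dist m (sampleMean ι M x) ≤ R)
    (h2 : dist m (sampleMean ι M (exchange j x)) ≤ R)
    (hc : (n : ℝ) / 2 ≤ ∑ i : Fin n, {t | dist (ι t) m ≤ χ}.indicator (fun _ => (1 : ℝ)) (x i.succ)
      + ∑ i : Fin n, {t | dist (ι t) m ≤ χ}.indicator (fun _ => (1 : ℝ)) (exchange j x i.succ)) :
    invCurv τ ι M j x ≤ 4 / ddtran τ r := by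
  set ψ : T → ℝ := {t | dist (ι t) m ≤ χ}.indicator fun _ => (1 : ℝ) with hψ
  have hψ0 : ∀ t, 0 ≤ ψ t := fun t => indicator_nonneg (fun _ _ => zero_le_one) t
  have hn : (0 : ℝ) < n := by exact_mod_cast hs.one_le
  have key : ∀ (t : T) (c c' : Q), dist m c ≤ R → dist m c' ≤ R →
      ENNReal.ofReal (ψ t) * ddtran τ r ≤ ddtran τ (max (dist (ι t) c) (dist (ι t) c')) := by
    intro t c c' hc hc'
    by_cases ht : dist (ι t) m ≤ χ
    · have : ψ t = 1 := indicator_of_mem (s := {t | dist (ι t) m ≤ χ}) ht _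
      rw [this, ENNReal.ofReal_one, one_mul]
      refine hs.isTransform.antitone_ddtran (max_le ?_ ?_)
      · linarith [dist_triangle (ι t) m c]
      · linarith [dist_triangle (ι t) m c']
    · have : ψ t = 0 := indicator_of_notMem (s := {t | dist (ι t) m ≤ χ}) ht _
      simp [this]
  have hsum : ENNReal.ofReal (n / 2) * ddtran τ r ≤ curvSum τ ι M j x := by
    refine (mul_le_mul_left (ENNReal.ofReal_le_ofReal hc) _).trans ?_
    rw [ENNReal.ofReal_add (Finset.sum_nonneg fun i _ => hψ0 _)
        (Finset.sum_nonneg fun i _ => hψ0 _), ENNReal.ofReal_sum_of_nonneg fun i _ => hψ0 _,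
      ENNReal.ofReal_sum_of_nonneg fun i _ => hψ0 _, add_mul, Finset.sum_mul, Finset.sum_mul,
      curvSum]
    refine add_le_add (Finset.sum_le_sum fun i _ => key _ _ _ h1 h2)
      (Finset.sum_le_sum fun i _ => key _ _ _ h2 ?_)
    rwa [exchange_exchange]
  have hd := hs.isTransform.ddtran_ne_zero hs.tendsto_dtran r
  rw [invCurv]
  refine (ENNReal.div_le_div_left hsum _).trans ?_
  have h4 : (2 * n : ℝ≥0∞) = ENNReal.ofReal (n / 2) * 4 := by
    rw [← ENNReal.ofReal_ofNat 4, ← ENNReal.ofReal_mul (by positivity),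
      show (n : ℝ) / 2 * 4 = 2 * n by ring, ENNReal.ofReal_mul (by norm_num)]
    simp
  rw [h4, ENNReal.mul_div_mul_left _ _ (by simpa using hn) ENNReal.ofReal_ne_top]

/-- The event that few observations are close to `m` or that an empirical moment is large. -/
def badSet (τ : ℝ → ℝ) (μ : Measure T) (ι : T → Q) (m : Q) (χ : ℝ) (j : Fin n) :
    Set (Fin (n + 1) → T) :=
  {x | ∑ i : Fin n, {t | dist (ι t) m ≤ χ}.indicator (fun _ => (1 : ℝ)) (x i.succ)
      + ∑ i : Fin n, {t | dist (ι t) m ≤ χ}.indicator (fun _ => (1 : ℝ))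
        (x (Equiv.swap 0 j.succ i.succ)) < (n : ℝ) / 2}
    ∪ ((fun x (i : Fin n) => x i.succ) ⁻¹' {y | 2 * sigma τ μ ι m < empMoment τ ι m y}
      ∪ (fun x (i : Fin n) => x (Equiv.swap 0 j.succ i.succ)) ⁻¹'
        {y | 2 * sigma τ μ ι m < empMoment τ ι m y})

theorem measurableSet_dist_le (hι : Continuous ι) (m : Q) (χ : ℝ) :
    MeasurableSet {t | dist (ι t) m ≤ χ} :=
  measurableSet_le (hι.dist continuous_const).measurable measurable_const

theorem measurableSet_lt_empMoment (hτ : IsTransform τ) (hι : Continuous ι) (m : Q) (z : ℝ) :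
    MeasurableSet {y : Fin n → T | z < empMoment τ ι m y} :=
  measurableSet_lt measurable_const (hτ.measurable_empMoment hι m)

theorem measurableSet_badSet (hτ : IsTransform τ) (hι : Continuous ι) (m : Q) (χ : ℝ)
    (j : Fin n) : MeasurableSet (badSet τ μ ι m χ j) := by
  have hψ : Measurable ({t | dist (ι t) m ≤ χ}.indicator fun _ => (1 : ℝ)) :=
    measurable_const.indicator (measurableSet_dist_le hι m χ)
  refine (measurableSet_lt ?_ measurable_const).union (MeasurableSet.union ?_ ?_)
  · exact (Finset.measurable_fun_sum _ fun i _ => hψ.comp (measurable_pi_apply _)).add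
      (Finset.measurable_fun_sum _ fun i _ => hψ.comp (measurable_pi_apply _))
  · exact measurableSet_lt_empMoment hτ hι m _ |>.preimage (by fun_prop)
  · exact measurableSet_lt_empMoment hτ hι m _ |>.preimage (by fun_prop)

/-- One Chernoff bound for the joint count and one Chebyshev bound for each of the two samples.
Chernoff yields `exp (-n / 8)`, of which only `exp (-n / 16)` is kept. -/
theorem measure_badSet_le (hs : SampleSetting τ ι M) (hι : Continuous ι) {m : Q}
    (hint : Integrable (fun t => dtran τ (dist (ι t) m)) μ) {χ : ℝ}
    (hχ : 1 / 2 ≤ μ {t | dist (ι t) m ≤ χ}) (j : Fin n) :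
    (Measure.pi fun _ => μ) (badSet τ μ ι m χ j) ≤ ENNReal.ofReal (Real.exp (-(n : ℝ) / 16))
      + 2 / (n : ℝ≥0∞) * (powMoment τ μ ι m 2 / ENNReal.ofReal (sigma τ μ ι m ^ 2) - 1) := by
  have hτ := hs.isTransform
  have h1 := measure_count_lt (μ := μ) (measurableSet_dist_le hι m χ) hχ
    (Fin.succ_injective n) (injective_swap_succ j)
  have h2 := measure_two_mul_mean_lt (hτ.measurable_dtran_dist hι m)
    (fun t => hτ.dtran_nonneg _) hint hs.one_le
  have h3 : ∀ {e : Fin n → Fin (n + 1)}, Function.Injective e →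
      (Measure.pi fun _ => μ) ((fun x i => x (e i)) ⁻¹'
        {y | 2 * sigma τ μ ι m < empMoment τ ι m y}) ≤ (n : ℝ≥0∞)⁻¹ *
          (powMoment τ μ ι m 2 / ENNReal.ofReal (sigma τ μ ι m ^ 2) - 1) := by
    intro e he
    rw [(measurePreserving_comp_pi (μ := μ) he).measure_preimage
      (measurableSet_lt_empMoment hτ hι m _).nullMeasurableSet]
    exact h2
  refine (measure_union_le _ _).trans (add_le_add (h1.trans ?_)
    ((measure_union_le _ _).trans ((add_le_add (h3 (Fin.succ_injective n))
      (h3 (injective_swap_succ j))).trans_eq ?_)))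
  · refine ENNReal.ofReal_le_ofReal (Real.exp_le_exp.2 ?_)
    have : (0 : ℝ) ≤ n := Nat.cast_nonneg n
    linarith
  · rw [← two_mul, ← mul_assoc, ENNReal.div_eq_inv_mul (a := 2), mul_comm 2]

/-- Off the bad set both means lie within `R = (τ')⁻¹(16 σ)` of `m`, and `χ + R ≤ 4 r₀` because `χ ≤
r₀` and `2 R ≤ r₀`. -/
theorem invCurv_le_of_notMem_badSet (hs : SampleSetting τ ι M) {m : Q} {χ : ℝ} {j : Fin n}
    {x : Fin (n + 1) → T} (hx : x ∉ badSet τ μ ι m χ j) :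
    invCurv τ ι M j x ≤ 4 / ddtran τ (4 * r₀ τ μ ι m χ) := by
  simp only [badSet, mem_union, mem_preimage, mem_ofPred_eq, not_or, not_lt] at hx
  obtain ⟨h1, h2, h3⟩ := hx
  have hmono := hs.isTransform.monotone_invDtran hs.tendsto_dtran
  have hR : ∀ x : Fin (n + 1) → T,
      empMoment τ ι m (fun i : Fin n => x i.succ) ≤ 2 * sigma τ μ ι m →
      dist m (sampleMean ι M x) ≤ invDtran τ (16 * sigma τ μ ι m) := by
    intro x hx
    have h0 := empMoment_nonneg hs.isTransform ι m fun i : Fin n => x i.succ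
    exact (hs.dist_sampleMean_le m x).trans (hmono (by linarith))
  refine hs.invCurv_le_of_count ?_ (hR x h2) (hR (exchange j x) h3) h1
  have h4 := le_max_left χ (2 * invDtran τ (16 * sigma τ μ ι m))
  have h5 := le_max_right χ (2 * invDtran τ (16 * sigma τ μ ι m))
  have h6 : 0 ≤ invDtran τ (16 * sigma τ μ ι m) := invDtran_nonneg _
  rw [r₀]
  linarith

/-- The moment bound that separates the event of small curvature. -/
theorem lintegral_sq_mul_invCurv_le (hs : SampleSetting τ ι M) (hι : Continuous ι) {m : Q}
    (hint : Integrable (fun t => dtran τ (dist (ι t) m)) μ) {χ : ℝ}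
    (hχ : 1 / 2 ≤ μ {t | dist (ι t) m ≤ χ}) (j : Fin n) {p q : ℝ} (hpq : p.HolderConjugate q)
    {s : ℝ≥0∞} (hG : moment μ ι m (fun x => g τ x ^ p) ≤ s)
    (hH : ∫⁻ y, h τ (2 * empMoment (n := n) τ ι m y) ^ p ∂(Measure.pi fun _ => μ) ≤ s) :
    ∫⁻ x, ENNReal.ofReal (dtran τ (dist (ι (x j.succ)) m)) ^ (2 : ℝ) * invCurv τ ι M j x
        ∂(Measure.pi fun _ => μ)
      ≤ 4 * powMoment τ μ ι m 2 / ddtran τ (4 * r₀ τ μ ι m χ)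
        + (V n τ μ ι m p + 4 * powMoment τ μ ι m (2 * p) * s) ^ (1 / p)
          * (ENNReal.ofReal (Real.exp (-(n : ℝ) / 16)) + 2 / (n : ℝ≥0∞)
            * (powMoment τ μ ι m 2 / ENNReal.ofReal (sigma τ μ ι m ^ 2) - 1)) ^ (1 / q) := by
  have hτ := hs.isTransform
  set F : T → ℝ≥0∞ := fun t => ENNReal.ofReal (dtran τ (dist (ι t) m)) ^ (2 : ℝ) with hF
  have hFm : Measurable F := (hτ.measurable_dtran_dist hι m).ennreal_ofReal.pow_const _
  have hUm := hs.measurable_invCurv hι j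
  set B := badSet τ μ ι m χ j with hBdef
  have hB : MeasurableSet B := measurableSet_badSet hτ hι m χ j
  have hFU : Measurable fun x => F (x j.succ) * invCurv τ ι M j x :=
    (hFm.comp (measurable_pi_apply _)).mul hUm
  have hp0 : 0 ≤ p := hpq.nonneg
  have hbad : ∫⁻ x in B, F (x j.succ) * invCurv τ ι M j x ∂(Measure.pi fun _ => μ)
      ≤ (V n τ μ ι m p + 4 * powMoment τ μ ι m (2 * p) * s) ^ (1 / p)
          * (ENNReal.ofReal (Real.exp (-(n : ℝ) / 16)) + 2 / (n : ℝ≥0∞)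
            * (powMoment τ μ ι m 2 / ENNReal.ofReal (sigma τ μ ι m ^ 2) - 1)) ^ (1 / q) := by
    -- Hölder against the constant `1` on the bad set: the exponent `p` meets the moment bound, the
    -- exponent `q` the probability of the set.
    have h1 := ENNReal.lintegral_mul_le_Lp_mul_Lq ((Measure.pi fun _ => μ).restrict B) hpq
      hFU.aemeasurable (aemeasurable_const (b := (1 : ℝ≥0∞)))
    simp only [Pi.mul_apply, mul_one, ENNReal.one_rpow, lintegral_const, one_mul,
      Measure.restrict_apply_univ] at h1
    refine h1.trans (mul_le_mul' (ENNReal.rpow_le_rpow ?_ (one_div_nonneg.2 hp0))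
      (ENNReal.rpow_le_rpow (hs.measure_badSet_le hι hint hχ j)
        (one_div_nonneg.2 hpq.symm.nonneg)))
    refine (setLIntegral_le_lintegral _ _).trans ?_
    refine le_trans (le_of_eq ?_) (hs.lintegral_rpow_mul_invCurv_rpow_le hι m j hpq.lt.le hG hH)
    refine lintegral_congr fun x => ?_
    rw [ENNReal.mul_rpow_of_nonneg _ _ hp0, hF, ← ENNReal.rpow_mul]
  have hgood : ∫⁻ x in Bᶜ, F (x j.succ) * invCurv τ ι M j x ∂(Measure.pi fun _ => μ)
      ≤ 4 * powMoment τ μ ι m 2 / ddtran τ (4 * r₀ τ μ ι m χ) := by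
    calc ∫⁻ x in Bᶜ, F (x j.succ) * invCurv τ ι M j x ∂(Measure.pi fun _ => μ)
        ≤ ∫⁻ x in Bᶜ, F (x j.succ) * (4 / ddtran τ (4 * r₀ τ μ ι m χ))
          ∂(Measure.pi fun _ => μ) :=
          setLIntegral_mono' hB.compl fun x hx =>
            mul_le_mul_right (hs.invCurv_le_of_notMem_badSet hx) _
      _ ≤ ∫⁻ x, F (x j.succ) * (4 / ddtran τ (4 * r₀ τ μ ι m χ)) ∂(Measure.pi fun _ => μ) :=
          setLIntegral_le_lintegral _ _
      _ = powMoment τ μ ι m 2 * (4 / ddtran τ (4 * r₀ τ μ ι m χ)) := by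
          have hFj : Measurable fun x : Fin (n + 1) → T => F (x j.succ) :=
            hFm.comp (measurable_pi_apply _)
          rw [lintegral_mul_const _ hFj, lintegral_eval_pi hFm]
          rfl
      _ = _ := by
          rw [← mul_div_assoc, mul_comm]
  rw [← lintegral_add_compl _ hB, add_comm]
  exact add_le_add hgood hbad

/-- The main bound for canonical observations. -/
theorem lintegral_weightedLoss_le_min (hs : SampleSetting τ ι M) (hι : Continuous ι) {m : Q}
    (hint : Integrable (fun t => dtran τ (dist (ι t) m)) μ)
    (hmin : ∀ q, 0 ≤ excessRisk τ μ ι m q) {χ : ℝ} (hχ : 1 / 2 ≤ μ {t | dist (ι t) m ≤ χ})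
    {p q : ℝ} (hpq : p.HolderConjugate q) {s : ℝ → ℝ≥0∞}
    (hG : ∀ r, moment μ ι m (fun x => g τ x ^ r) ≤ s r)
    (hH : ∀ r, ∫⁻ y, h τ (2 * empMoment (n := n) τ ι m y) ^ r ∂(Measure.pi fun _ => μ) ≤ s r) :
    ∫⁻ y, weightedLoss τ χ m (M fun i => ι (y i)) ∂(Measure.pi fun _ => μ)
      ≤ 64 / (n : ℝ≥0∞) * min (4 * powMoment τ μ ι m 2 * s 1 + V n τ μ ι m 1)
        (4 * powMoment τ μ ι m 2 / ddtran τ (4 * r₀ τ μ ι m χ)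
          + (V n τ μ ι m p + 4 * powMoment τ μ ι m (2 * p) * s p) ^ (1 / p)
            * (ENNReal.ofReal (Real.exp (-(n : ℝ) / 16)) + 2 / (n : ℝ≥0∞)
              * (powMoment τ μ ι m 2 / ENNReal.ofReal (sigma τ μ ι m ^ 2) - 1)) ^ (1 / q)) := by
  have hn0 : (64 / (n : ℝ≥0∞)) ≠ 0 := by simp [ENNReal.div_eq_zero_iff]
  rcases min_choice (4 * powMoment τ μ ι m 2 * s 1 + V n τ μ ι m 1)
    (4 * powMoment τ μ ι m 2 / ddtran τ (4 * r₀ τ μ ι m χ)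
      + (V n τ μ ι m p + 4 * powMoment τ μ ι m (2 * p) * s p) ^ (1 / p)
        * (ENNReal.ofReal (Real.exp (-(n : ℝ) / 16)) + 2 / (n : ℝ≥0∞)
          * (powMoment τ μ ι m 2 / ENNReal.ofReal (sigma τ μ ι m ^ 2) - 1)) ^ (1 / q)) with
    h | h <;> rw [h]
  -- An infinite bound is trivial; a finite one provides the integrability that symmetrization
  -- requires.
  · rcases eq_or_ne (4 * powMoment τ μ ι m 2 * s 1 + V n τ μ ι m 1) ⊤ with htop | htop
    · rw [htop, ENNReal.mul_top hn0]
      exact le_top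
    · refine hs.lintegral_weightedLoss_le hι hint hmin hχ (fun j =>
        hs.lintegral_sq_mul_h_ne_top hι m j le_rfl (hH 1) ?_) fun j => ?_
      · rwa [mul_one, add_comm]
      · have := hs.lintegral_rpow_mul_invCurv_rpow_le hι m j le_rfl (hG 1) (hH 1)
        simp only [mul_one, ENNReal.rpow_one] at this
        exact this.trans_eq (add_comm _ _)
  · rcases eq_or_ne (V n τ μ ι m p + 4 * powMoment τ μ ι m (2 * p) * s p) ⊤ with htop | htop
    · rw [htop, ENNReal.top_rpow_of_pos (one_div_pos.2 hpq.pos), ENNReal.top_mul, add_top,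
        ENNReal.mul_top hn0]
      · exact le_top
      -- The exponential keeps the probability factor positive, so the product with `⊤` does not
      -- collapse to `0`.
      · rw [Ne, ENNReal.rpow_eq_zero_iff_of_pos (one_div_pos.2 hpq.symm.pos), add_eq_zero]
        simp [Real.exp_pos]
    · exact hs.lintegral_weightedLoss_le hι hint hmin hχ (fun j =>
        hs.lintegral_sq_mul_h_ne_top hι m j hpq.lt.le (hH p) htop) fun j =>
        hs.lintegral_sq_mul_invCurv_le hι hint hχ j hpq (hG p) (hH p)

end SampleSetting

end Sample

/-! ### From canonical observations back to the given random variables. -/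

section Transfer

set_option linter.unusedSectionVars false

variable {Q T Ω : Type*} [MetricSpace Q] [MetricSpace T] [SecondCountableTopology T]
  [MeasurableSpace T] [BorelSpace T] [MeasurableSpace Ω] {P : Measure Ω} {τ : ℝ → ℝ} {ι : T → Q}
  {X : Ω → T} {Y : Ω → Q}

theorem moment_map (hι : Continuous ι) (hX : AEMeasurable X P) (hY : Y =ᵐ[P] fun ω => ι (X ω))
    (m : Q) {f : ℝ → ℝ≥0∞} (hf : Measurable f) : moment P Y m f = moment (P.map X) ι m f := by
  have hd : Measurable fun t => dist (ι t) m := (hι.dist continuous_const).measurable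
  have hfd : Measurable fun t => f (dist (ι t) m) := hf.comp hd
  rw [moment, moment, lintegral_map' hfd.aemeasurable hX]
  exact lintegral_congr_ae (hY.mono fun ω hω => by simp only [hω])

theorem IsTransform.powMoment_map (hτ : IsTransform τ) (hι : Continuous ι) (hX : AEMeasurable X P)
    (hY : Y =ᵐ[P] fun ω => ι (X ω)) (m : Q) (r : ℝ) :
    powMoment τ P Y m r = powMoment τ (P.map X) ι m r :=
  moment_map hι hX hY m (hτ.continuous_dtran.measurable.ennreal_ofReal.pow_const r)

theorem IsTransform.V_map (hτ : IsTransform τ) (hlim : Tendsto (dtran τ) atTop atTop)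
    (hι : Continuous ι) (hX : AEMeasurable X P)
    (hY : Y =ᵐ[P] fun ω => ι (X ω)) (n : ℕ) (m : Q) (r : ℝ) :
    V n τ P Y m r = V n τ (P.map X) ι m r := by
  have hd := hτ.continuous_dtran.measurable
  have hA := hd.ennreal_ofReal.pow_const (2 * r)
  have hH : Measurable fun x => h τ (2 * (n : ℝ)⁻¹ * dtran τ x) ^ r :=
    ((hτ.measurable_h hlim).comp (hd.const_mul _)).pow_const r
  exact congrArg₂ (fun a b => (n : ℝ≥0∞)⁻¹ * a + b)
    (moment_map hι hX hY m (hA.mul (hτ.measurable_g.pow_const r)))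
    (moment_map hι hX hY m (hA.mul hH))

theorem sigma_map (hτ : IsTransform τ) (hι : Continuous ι) (hX : AEMeasurable X P)
    (hY : Y =ᵐ[P] fun ω => ι (X ω)) (m : Q) : sigma τ P Y m = sigma τ (P.map X) ι m := by
  rw [sigma, sigma, integral_map hX (hτ.measurable_dtran_dist hι m).aestronglyMeasurable]
  exact integral_congr_ae (hY.mono fun ω hω => by simp only [hω])

/-- Subadditivity of `τ'` moves the reference point from `o` to `m` at the cost of a constant. -/
theorem integrable_dtran_dist_of_integrable [IsFiniteMeasure P] (hτ : IsTransform τ)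
    (hι : Continuous ι) (hX : AEMeasurable X P) (hY : Y =ᵐ[P] fun ω => ι (X ω)) {o : Q}
    (ho : Integrable (fun ω => dtran τ (dist (Y ω) o)) P) (m : Q) :
    Integrable (fun t => dtran τ (dist (ι t) m)) (P.map X) := by
  have h1 : Integrable (fun t => dtran τ (dist (ι t) o)) (P.map X) := by
    rw [integrable_map_measure (hτ.measurable_dtran_dist hι o).aestronglyMeasurable hX]
    exact ho.congr (hY.mono fun ω hω => by simp only [hω, Function.comp_apply])
  refine (h1.add (integrable_const (dtran τ (dist o m)))).mono'
    (hτ.measurable_dtran_dist hι m).aestronglyMeasurable (Eventually.of_forall fun t => ?_)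
  rw [Real.norm_eq_abs, abs_of_nonneg (hτ.dtran_nonneg _)]
  exact (hτ.monotone_dtran (dist_triangle (ι t) o m)).trans
    (hτ.dtran_add_le dist_nonneg dist_nonneg)

theorem excessRisk_nonneg [IsProbabilityMeasure P] (hτ : IsTransform τ) (hι : Continuous ι)
    (hX : AEMeasurable X P) (hY : Y =ᵐ[P] fun ω => ι (X ω)) {o m : Q}
    (hint : Integrable (fun t => dtran τ (dist (ι t) m)) (P.map X))
    (hm : IsFrechetMean τ P Y o m) (q : Q) : 0 ≤ excessRisk τ (P.map X) ι m q := by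
  have := Measure.isProbabilityMeasure_map hX
  have h1 : ∀ q, ∫ ω, (τ (dist (Y ω) q) - τ (dist (Y ω) o)) ∂P
      = ∫ t, (τ (dist (ι t) q) - τ (dist (ι t) o)) ∂(P.map X) := by
    intro q
    rw [integral_map hX (hτ.integrable_sub hι hint q o).aestronglyMeasurable]
    exact integral_congr_ae (hY.mono fun ω hω => by simp only [hω])
  have h2 := hm q
  rw [h1, h1] at h2
  have h3 : excessRisk τ (P.map X) ι m q
      = ∫ t, ((τ (dist (ι t) q) - τ (dist (ι t) o)) - (τ (dist (ι t) m) - τ (dist (ι t) o)))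
        ∂(P.map X) := by
    simp only [excessRisk, sub_sub_sub_cancel_right]
  rw [h3, integral_sub (hτ.integrable_sub hι hint q o) (hτ.integrable_sub hι hint m o)]
  exact sub_nonneg.2 h2

theorem measurable_weightedLoss_comp (hτ : IsTransform τ) {A : Type*} [TopologicalSpace A]
    [MeasurableSpace A] [OpensMeasurableSpace A] {c : A → Q} (hc : Continuous c) (χ : ℝ) (m : Q) :
    Measurable fun a => weightedLoss τ χ m (c a) := by
  have hd : Measurable fun a => dist m (c a) := (continuous_const.dist hc).measurable
  exact (hd.ennreal_ofReal.pow_const 2).mul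
    (measurable_const.min (hτ.antitone_ddtran.measurable.comp (hd.const_mul 2)))

/-- The main bound when the observations factor through a separable metric space. -/
theorem lintegral_weightedLoss_le_of_factorization [IsProbabilityMeasure P] (hQ : IsHadamard Q)
    (hτ : IsTransform τ) (hlim : Tendsto (dtran τ) atTop atTop) (hι : Continuous ι)
    (hX : AEMeasurable X P) (hY : Y =ᵐ[P] fun ω => ι (X ω)) {o m : Q}
    (ho : Integrable (fun ω => dtran τ (dist (Y ω) o)) P) (hm : IsFrechetMean τ P Y o m) {n : ℕ}
    (hn : 1 ≤ n) {Z : Fin n → Ω → T} {Ys : Fin n → Ω → Q} (hindep : iIndepFun Z P)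
    (hident : ∀ j, IdentDistrib (Z j) X P P) (hYs : ∀ j, Ys j =ᵐ[P] fun ω => ι (Z j ω))
    {mn : Ω → Q} (hmn : ∀ᵐ ω ∂P, IsSampleFrechetMean τ (fun j => Ys j ω) (mn ω)) {χ : ℝ}
    (hχ : 1 / 2 ≤ P {ω | dist (Y ω) m ≤ χ}) {p q : ℝ} (hpq : p.HolderConjugate q) :
    ∫⁻ ω, weightedLoss τ χ m (mn ω) ∂P ≤ 64 / (n : ℝ≥0∞)
      * min (4 * powMoment τ P Y m 2 * S τ P Y Ys m 1 + V n τ P Y m 1)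
        (4 * powMoment τ P Y m 2 / ddtran τ (4 * r₀ τ P Y m χ) + b τ P Y Ys m p q) := by
  set μ := P.map X with hμ
  have hprob : IsProbabilityMeasure μ := Measure.isProbabilityMeasure_map hX
  have hZ : ∀ j, AEMeasurable (Z j) P := fun j => (hident j).aemeasurable_fst
  have hZm : AEMeasurable (fun ω j => Z j ω) P := aemeasurable_pi_lambda _ hZ
  have hlaw : P.map (fun ω j => Z j ω) = Measure.pi fun _ => μ := by
    rw [(iIndepFun_iff_map_fun_eq_pi_map hZ).1 hindep]
    congr 1
    funext j
    exact (hident j).map_eq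
  have hYsa : ∀ᵐ ω ∂P, ∀ j, Ys j ω = ι (Z j ω) := ae_all_iff.2 hYs
  -- The selection is continuous, and by uniqueness it agrees almost surely with the given sample
  -- mean.
  choose M hM using hτ.exists_isSampleFrechetMean hlim hQ hn
  have hs : SampleSetting τ ι M := ⟨hτ, hlim, hQ, hn, hM⟩
  have hint := integrable_dtran_dist_of_integrable hτ hι hX hY ho m
  have hMc : Continuous fun y : Fin n → T => M fun i => ι (y i) :=
    (hτ.continuous_sampleMean hlim hQ hn hM).comp (by fun_prop)
  have hloss : ∫⁻ ω, weightedLoss τ χ m (mn ω) ∂P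
      = ∫⁻ y, weightedLoss τ χ m (M fun i => ι (y i)) ∂(Measure.pi fun _ => μ) := by
    rw [← hlaw, lintegral_map' (measurable_weightedLoss_comp hτ hMc χ m).aemeasurable hZm]
    refine lintegral_congr_ae ?_
    filter_upwards [hmn, hYsa] with ω h1 h2
    simp only [h2] at h1
    rw [hτ.isSampleFrechetMean_unique hlim hQ hn h1 (hM _)]
  have hS : ∀ r : ℝ, ∫⁻ y, h τ (2 * empMoment (n := n) τ ι m y) ^ r ∂(Measure.pi fun _ => μ)
      = ∫⁻ ω, h τ (2 * sigmaHat τ Ys m ω) ^ r ∂P := by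
    intro r
    have hmeas : Measurable fun y => h τ (2 * empMoment (n := n) τ ι m y) ^ r :=
      ((hτ.measurable_h hlim).comp ((hτ.measurable_empMoment hι m).const_mul 2)).pow_const r
    rw [← hlaw, lintegral_map' hmeas.aemeasurable hZm]
    refine lintegral_congr_ae ?_
    filter_upwards [hYsa] with ω hω
    simp only [sigmaHat, empMoment, hω]
  have hχ' : 1 / 2 ≤ μ {t | dist (ι t) m ≤ χ} := by
    rw [hμ, Measure.map_apply_of_aemeasurable hX
      (SampleSetting.measurableSet_dist_le hι m χ)]
    refine hχ.trans (le_of_eq (measure_congr ?_))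
    filter_upwards [hY] with ω hω
    exact congrArg (fun y => dist y m ≤ χ) hω
  have hG : ∀ r : ℝ, moment P Y m (fun x => g τ x ^ r) = moment μ ι m fun x => g τ x ^ r := fun r =>
    moment_map hι hX hY m (hτ.measurable_g.pow_const r)
  have key := hs.lintegral_weightedLoss_le_min hι hint (excessRisk_nonneg hτ hι hX hY hint hm)
    hχ' hpq (s := S τ P Y Ys m) (fun r => (hG r).ge.trans (le_max_left _ _))
    (fun r => (hS r).le.trans ((le_max_right _ _).trans (le_max_right _ _)))
  rw [hloss, b, r₀, hτ.V_map hlim hι hX hY, hτ.V_map hlim hι hX hY, hτ.powMoment_map hι hX hY,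
    hτ.powMoment_map hι hX hY, sigma_map hτ hι hX hY]
  exact key

end Transfer

/-! ### Reduction to a separable subset. -/

/-- A measurable retraction of a space with a point onto a measurable subset. -/
theorem exists_measurable_retraction {Q : Type*} [MeasurableSpace Q] {s : Set Q}
    (hs : MeasurableSet s) (hne : s.Nonempty) :
    ∃ ρ : Q → s, Measurable ρ ∧ ∀ x ∈ s, (ρ x : Q) = x := by
  classical
  obtain ⟨x₀, hx₀⟩ := hne
  refine ⟨fun x => if hx : x ∈ s then ⟨x, hx⟩ else ⟨x₀, hx₀⟩, ?_, fun x hx => by simp [hx]⟩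
  refine Measurable.dite (s := s) measurable_id measurable_const hs

end TransformedFrechet

end

theorem mainTheorem3 {Q Ω : Type*} [MetricSpace Q] [MeasurableSpace Q] [BorelSpace Q]
    [MeasurableSpace Ω] (hQ : TransformedFrechet.IsHadamard Q)
    (P : MeasureTheory.Measure Ω) [MeasureTheory.IsProbabilityMeasure P]
    (τ : ℝ → ℝ) (hτ : TransformedFrechet.IsTransform τ)
    (hlim : Filter.limsup (fun x : ℝ => ((TransformedFrechet.dtran τ x : ℝ) : EReal))
      Filter.atTop = ⊤)
    (Y : Ω → Q) (hY : MeasureTheory.AEStronglyMeasurable Y P)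
    (o : Q)
    (ho : MeasureTheory.Integrable (fun ω => TransformedFrechet.dtran τ (dist (Y ω) o)) P)
    (n : ℕ) (hn : 1 ≤ n) (Ys : Fin n → Ω → Q)
    (hindep : ProbabilityTheory.iIndepFun Ys P)
    (hident : ∀ j, ProbabilityTheory.IdentDistrib (Ys j) Y P P)
    (m : Q) (hm : TransformedFrechet.IsFrechetMean τ P Y o m)
    (mn : Ω → Q) (hmn_meas : AEMeasurable mn P)
    (hmn : ∀ᵐ ω ∂P, TransformedFrechet.IsSampleFrechetMean τ (fun j => Ys j ω) (mn ω))
    (χ : ℝ) (hχ : TransformedFrechet.IsMedian P (fun ω => dist (Y ω) m) χ)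
    (p q : ℝ) (hp : 1 < p) (hq : 1 < q) (hpq : 1 / p + 1 / q = 1) :
    ∫⁻ ω, ENNReal.ofReal (dist m (mn ω)) ^ 2
        * min (TransformedFrechet.ddtran τ (2 * χ))
            (TransformedFrechet.ddtran τ (2 * dist m (mn ω))) ∂P
      ≤ 64 / (n : ENNReal)
        * min (4 * TransformedFrechet.powMoment τ P Y m 2 * TransformedFrechet.S τ P Y Ys m 1
              + TransformedFrechet.V n τ P Y m 1)
            (4 * TransformedFrechet.powMoment τ P Y m 2
                / TransformedFrechet.ddtran τ (4 * TransformedFrechet.r₀ τ P Y m χ)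
              + TransformedFrechet.b τ P Y Ys m p q) := by
  have hΩ := MeasureTheory.nonempty_of_isProbabilityMeasure P
  -- A closed separable set that carries `Y`. As a subtype it is second countable, so Borel and
  -- product σ-algebras agree on its finite powers.
  let s : Set Q := closure (Set.range (hY.mk Y))
  have hs : MeasurableSet s := isClosed_closure.measurableSet
  have hsep : TopologicalSpace.IsSeparable s :=
    hY.stronglyMeasurable_mk.isSeparable_range.closure
  have := hsep.separableSpace
  have : SecondCountableTopology s := UniformSpace.secondCountable_of_separable s
  -- Composition with `ρ` makes the observations `s`-valued everywhere, changes them only on null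
  -- sets, and preserves independence and equality of laws.
  obtain ⟨ρ, hρ, hρs⟩ := TransformedFrechet.exists_measurable_retraction hs
    (Set.range_nonempty (hY.mk Y)).closure
  have hYs : ∀ᵐ ω ∂P, Y ω ∈ s := by
    filter_upwards [hY.ae_eq_mk] with ω hω
    rw [hω]
    exact subset_closure (Set.mem_range_self ω)
  have hρm : ∀ j, ProbabilityTheory.IdentDistrib (ρ ∘ Ys j) (ρ ∘ Y) P P := fun j =>
    (hident j).comp hρ
  have hY_meas : AEMeasurable Y P := hY.aemeasurable
  exact TransformedFrechet.lintegral_weightedLoss_le_of_factorization (ι := ((↑) : s → Q)) hQ hτ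
    (hτ.tendsto_dtran_atTop hlim) continuous_subtype_val (hρ.comp_aemeasurable hY_meas)
    (hYs.mono fun ω hω => (hρs _ hω).symm) ho hm hn (hindep.comp (fun _ => ρ) fun _ => hρ) hρm
    (fun j => ((hident j).symm.ae_mem_snd hs hYs).mono fun ω hω => (hρs _ hω).symm) hmn hχ.1
    (Real.holderConjugate_iff.2 ⟨hp, by simpa only [one_div] using hpq⟩)
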